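/- Let $n\ge 1$ and let $(M^{2n},\Omega,F)$, $F=(f_1,\dots,f_n)$, be a real-analytic integrable Hamiltonian system: $M$ is a real-analytic manifold, $\Omega$ a real-analytic symplectic form, and $f_1,\dots,f_n$ are real-analytic, pairwise Poisson-commuting functions that are functionally independent on a dense set. $F$ need not be proper and the flows need not be complete. Write $X_f$ for the Hamiltonian vector field of $f$, given by $\Omega(\cdot,X_f)=\mathrm{d}f$, $\operatorname{Sing}(F)=\{m:\operatorname{rank}\mathrm{d}F(m)<n\}$, $L_0=F^{-1}(0)$, and $\mathcal O_m$ for the orbit of $m$ under the local Hamiltonian $\mathbb R^n$-action generated by $f_1,\dots,f_n$. On $L_0\setminus\operatorname{Sing}(F)$ let $\theta_1,\dots,\theta_n$ be the 1-forms dual to the frame $X_{f_1},\dots,X_{f_n}$ of the tangent spaces of $L_0$, and let $\mathrm{d}s^2=\sum_{i=1}^n\theta_i^2$. Let $m_0\in M$ be a point with $F(m_0)=0$ and $\operatorname{rank}\mathrm{d}F(m_0)=0$. Suppose that $\hat\gamma$ is a (piecewise $C^1$) closed curve in $L_0\setminus\operatorname{Sing}(F)$ and $m_1\in\hat\gamma$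 is a point such that (a) $\oint_{\hat\gamma}\theta_1\neq0$; (b) either the flows of all $X_{f_i}$ are complete in $L_0$ and $m_0\in\overline{\mathcal O_{m_1}}$; or there are a coordinate chart $\phi:U\to B_{0,r}$ centred at $m_0$, onto the open ball of radius $r$ about $0$ in $\mathbb R^{2n}$, with $\Omega|_U=\phi^*\sum_{i=1}^n\mathrm{d}x_{2i-1}\wedge\mathrm{d}x_{2i}$, a constant $c>0$ with $|\mathrm{d}(f_i\circ\phi^{-1})(x)|\le c|x|$ for all $x\in B_{0,r}$ and $1\le i\le n$, and a continuous path $m_u\in(L_0\setminus\operatorname{Sing}(F))\cap\phi^{-1}(B_{0,re^{-nc\ell}})$, $0<u\le1$, ending at the given point $m_1$ for $u=1$, such that $m_0\in\overline{\{m_u\}_{0<u\le1}}$, where $\ell=\oint_{\hat\gamma}\mathrm{d}s$. Then there is a linear combination $f=\sum_{i=1}^na_if_i$ with real coefficients and $a_1\ne0$ such that $m_0$, $m_1$ and the momentum map $(f,f_2,\dots,f_n)$ satisfy the following periodicity condition: there exist a compact trajectory $\gamma_0$ of $X_f$ (a closed trajectory or an equilibrium) and a continuous one-parameter family of $2\pi$-periodic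 trajectories $\gamma_u\subset\mathcal O_{m_1}$, $0<u\le1$, of $X_f$ such that $m_1\in\gamma_1$ and $m_0\in\gamma_0\subset\overline{\bigcup_{0<u\le1}\gamma_u}$ (here $\mathcal O_{m_1}$ is the orbit for the functions $f,f_2,\dots,f_n$). -/

import Mathlib

open Set
open scoped Manifold ContDiff Topology

/-- The model space `ℝ²ⁿ` with its Euclidean norm. -/
abbrev R2 (n : ℕ) : Type := EuclideanSpace ℝ (Fin (2 * n))

section Symplectic

variable {n : ℕ} {M : Type*} [TopologicalSpace M] [ChartedSpace (R2 n) M]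

/-- The pullback `ψ^* ω` of a 2-form `ω` on `M` under a map `ψ : ℝ²ⁿ → M`. -/
noncomputable def pullbackForm
    (ω' : (m : M) → TangentSpace 𝓘(ℝ, R2 n) m [⋀^Fin 2]→L[ℝ] ℝ) (ψ : R2 n → M) (x : R2 n) :
    R2 n [⋀^Fin 2]→L[ℝ] ℝ :=
  (ω' (ψ x)).compContinuousLinearMap (mfderiv 𝓘(ℝ, R2 n) 𝓘(ℝ, R2 n) ψ x)

variable (n M) in
/-- A real-analytic symplectic form on the real-analytic manifold `M` of dimension `2n`:
a 2-form that is analytic and closed in every chart of the analytic structure, and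
nondegenerate at every point. -/
structure SymplecticForm where
  /-- the underlying 2-form -/
  form : (m : M) → TangentSpace 𝓘(ℝ, R2 n) m [⋀^Fin 2]→L[ℝ] ℝ
  analytic : ∀ e ∈ IsManifold.maximalAtlas 𝓘(ℝ, R2 n) ω M,
    ContDiffOn ℝ ω (pullbackForm form e.symm) e.target
  closed : ∀ e ∈ IsManifold.maximalAtlas 𝓘(ℝ, R2 n) ω M,
    ∀ x ∈ e.target, extDeriv (pullbackForm form e.symm) x = 0
  nondegenerate : ∀ (m : M) (v : TangentSpace 𝓘(ℝ, R2 n) m), (∀ w, form m ![w, v] = 0) → v = 0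

/-- The Hamiltonian vector field `X_f`, determined by `Ω(·, X_f) = df`. -/
noncomputable def hamVF (Ω : SymplecticForm n M) (f : M → ℝ) (m : M) :
    TangentSpace 𝓘(ℝ, R2 n) m :=
  Classical.epsilon fun X : TangentSpace 𝓘(ℝ, R2 n) m =>
    ∀ w : TangentSpace 𝓘(ℝ, R2 n) m, Ω.form m ![w, X] = mfderiv 𝓘(ℝ, R2 n) 𝓘(ℝ, ℝ) f m w

/-- `X_f` does satisfy its defining equation `Ω(·, X_f) = df`. -/
theorem hamVF_spec (Ω : SymplecticForm n M) (f : M → ℝ) (m : M)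
    (w : TangentSpace 𝓘(ℝ, R2 n) m) :
    Ω.form m ![w, hamVF Ω f m] = mfderiv 𝓘(ℝ, R2 n) 𝓘(ℝ, ℝ) f m w := by
  let A : R2 n [⋀^Fin 2]→L[ℝ] ℝ := Ω.form m
  have u0 : ∀ x y z : R2 n, Function.update ![x, y] 0 z = ![z, y] := by
    intro x y z; ext i : 1; fin_cases i <;> rfl
  have u1 : ∀ x y z : R2 n, Function.update ![x, y] 1 z = ![x, z] := by
    intro x y z; ext i : 1; fin_cases i <;> rfl
  let B : R2 n →ₗ[ℝ] Module.Dual ℝ (R2 n) := LinearMap.mk₂ ℝ (fun v w : R2 n => A ![w, v])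
    (fun v v' w => by simpa only [u1] using A.map_update_add ![w, v] 1 v v')
    (fun c v w => by simpa only [u1] using A.map_update_smul ![w, v] 1 c v)
    (fun v w w' => by simpa only [u0] using A.map_update_add ![w, v] 0 w w')
    (fun c v w => by simpa only [u0] using A.map_update_smul ![w, v] 0 c w)
  have hinj : Function.Injective B := by
    rw [← LinearMap.ker_eq_bot, LinearMap.ker_eq_bot']
    intro v hv
    exact Ω.nondegenerate m v fun w => LinearMap.congr_fun hv w
  have hsurj : Function.Surjective B :=
    (LinearMap.injective_iff_surjective_of_finrank_eq_finrank
      (Subspace.dual_finrank_eq (K := ℝ) (V := R2 n)).symm).1 hinj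
  obtain ⟨X, hX⟩ := hsurj (mfderiv 𝓘(ℝ, R2 n) 𝓘(ℝ, ℝ) f m).toLinearMap
  exact Classical.epsilon_spec (p := fun X : TangentSpace 𝓘(ℝ, R2 n) m =>
    ∀ w : TangentSpace 𝓘(ℝ, R2 n) m, Ω.form m ![w, X] = mfderiv 𝓘(ℝ, R2 n) 𝓘(ℝ, ℝ) f m w)
    ⟨X, fun w => LinearMap.congr_fun hX w⟩ w

/-- The `i`-th component `f_i` of the momentum map `F = (f_1, …, f_n)`. -/
def component (F : M → Fin n → ℝ) (i : Fin n) : M → ℝ := fun m => F m i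

/-- The rank of `dF` at `m`. -/
noncomputable def rankAt (F : M → Fin n → ℝ) (m : M) : ℕ :=
  Module.finrank ℝ
    (LinearMap.range (mfderiv 𝓘(ℝ, R2 n) 𝓘(ℝ, Fin n → ℝ) F m).toLinearMap)

/-- `Sing(F)`, the set of singular points of the momentum map. -/
def singSet (F : M → Fin n → ℝ) : Set M := {m | rankAt F m < n}

/-- `(M, Ω, F)` is a real-analytic integrable Hamiltonian system with `n` degrees of freedom:
the functions `f_i` are analytic, pairwise in involution (`{f_i, f_j} = Ω(X_{f_i}, X_{f_j})` up
to the sign convention), and functionally independent on a dense set. -/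
structure IsIntegrableSystem (Ω : SymplecticForm n M) (F : M → Fin n → ℝ) : Prop where
  analytic : ContMDiff 𝓘(ℝ, R2 n) 𝓘(ℝ, Fin n → ℝ) ω F
  involution : ∀ (i j : Fin n) (m : M),
    Ω.form m ![hamVF Ω (component F i) m, hamVF Ω (component F j) m] = 0
  independent : Dense (singSet F)ᶜ

/-- The regular part `L₀ \ Sing(F)` of the zero fibre `L₀ = F⁻¹(0)`. -/
def regFibre (F : M → Fin n → ℝ) : Set M := F ⁻¹' {0} \ singSet F

/-- The 1-form `θ_i` dual to the frame `X_{f_1}, …, X_{f_n}`: a linear form on `T_m M` with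
`θ_i(X_{f_j}) = δ_{ij}`. Its values on the tangent space of the fibre, which is spanned by
the `X_{f_j}` at a regular point `m`, are determined by this, and only these are used. -/
noncomputable def coframe (Ω : SymplecticForm n M) (F : M → Fin n → ℝ) (i : Fin n) (m : M) :
    TangentSpace 𝓘(ℝ, R2 n) m →ₗ[ℝ] ℝ :=
  Classical.epsilon fun θ : TangentSpace 𝓘(ℝ, R2 n) m →ₗ[ℝ] ℝ =>
    ∀ j : Fin n, θ (hamVF Ω (component F j) m) = if i = j then 1 else 0

/-- At a regular point of a differentiable momentum map the forms `θ_i` do form a dual basis. -/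
theorem coframe_spec (Ω : SymplecticForm n M) (F : M → Fin n → ℝ) (i : Fin n) (m : M)
    (hF : MDifferentiableAt 𝓘(ℝ, R2 n) 𝓘(ℝ, Fin n → ℝ) F m) (hm : m ∉ singSet F) (j : Fin n) :
    coframe Ω F i m (hamVF Ω (component F j) m) = if i = j then 1 else 0 := by
  let D : R2 n →L[ℝ] (Fin n → ℝ) := mfderiv 𝓘(ℝ, R2 n) 𝓘(ℝ, Fin n → ℝ) F m
  let A : R2 n [⋀^Fin 2]→L[ℝ] ℝ := Ω.form m
  let X : Fin n → R2 n := fun j => hamVF Ω (component F j) m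
  have hD : ∀ (j : Fin n) (w : R2 n), A ![w, X j] = D w j := by
    intro j w
    have h := hamVF_spec Ω (component F j) m w
    have hp : HasMFDerivAt 𝓘(ℝ, R2 n) 𝓘(ℝ, ℝ) (component F j) m
        ((ContinuousLinearMap.proj (R := ℝ) (φ := fun _ : Fin n => ℝ) j).comp D) :=
      (ContinuousLinearMap.hasMFDerivAt
        (ContinuousLinearMap.proj (R := ℝ) (φ := fun _ : Fin n => ℝ) j)).comp m hF.hasMFDerivAt
    rw [hp.mfderiv] at h
    exact h
  have hsurj : Function.Surjective D := by
    have h1 : ¬ Module.finrank ℝ (LinearMap.range D.toLinearMap) < n := hm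
    have h2 := Submodule.finrank_le (LinearMap.range D.toLinearMap)
    rw [Module.finrank_fin_fun] at h2
    have h3 : LinearMap.range D.toLinearMap = ⊤ := by
      apply Submodule.eq_top_of_finrank_eq
      rw [Module.finrank_fin_fun]
      omega
    exact LinearMap.range_eq_top.1 h3
  have hind : LinearIndependent ℝ X := by
    rw [Fintype.linearIndependent_iff]
    intro g hg k
    obtain ⟨w, hw⟩ := hsurj (Pi.single k 1)
    have u1 : ∀ x y z : R2 n, Function.update ![x, y] 1 z = ![x, z] := by
      intro x y z; ext i : 1; fin_cases i <;> rfl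
    let L : R2 n →ₗ[ℝ] ℝ :=
      { toFun := fun v => A ![w, v]
        map_add' := fun v v' => by simpa only [u1] using A.map_update_add ![w, v] 1 v v'
        map_smul' := fun c v => by simpa only [u1, RingHom.id_apply] using A.map_update_smul ![w, v] 1 c v }
    have h := congrArg L hg
    rw [map_sum, map_zero] at h
    have h' : ∀ j, L (g j • X j) = g j * (Pi.single k (1 : ℝ) : Fin n → ℝ) j := by
      intro j
      rw [map_smul, smul_eq_mul, ← hw]
      exact congrArg (g j * ·) (hD j w)
    simpa [h', Pi.single_apply] using h
  obtain ⟨P, hP⟩ := (Fintype.linearCombination ℝ X).exists_leftInverse_of_injective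
    (LinearMap.ker_eq_bot.2 hind.fintypeLinearCombination_injective)
  refine Classical.epsilon_spec (p := fun θ : TangentSpace 𝓘(ℝ, R2 n) m →ₗ[ℝ] ℝ =>
    ∀ j : Fin n, θ (hamVF Ω (component F j) m) = if i = j then 1 else 0)
    ⟨(LinearMap.proj (R := ℝ) (φ := fun _ : Fin n => ℝ) i).comp P, fun j => ?_⟩ j
  have h := LinearMap.congr_fun hP (Pi.single j 1)
  rw [LinearMap.comp_apply, Fintype.linearCombination_apply_single, one_smul] at h
  change P (X j) i = _
  rw [h]
  simp [Pi.single_apply]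

/-- The velocity vector of a curve. -/
noncomputable def velocity (γ : ℝ → M) (t : ℝ) : TangentSpace 𝓘(ℝ, R2 n) (γ t) :=
  mfderiv 𝓘(ℝ, ℝ) 𝓘(ℝ, R2 n) γ t (1 : ℝ)

/-- A piecewise continuously differentiable closed curve, parametrized by `[0, 1]`. -/
structure IsPiecewiseC1Loop (γ : ℝ → M) : Prop where
  closed : γ 0 = γ 1
  piecewise_C1 : ∃ (N : ℕ) (τ : ℕ → ℝ), Monotone τ ∧ τ 0 = 0 ∧ τ N = 1 ∧
    ∀ k < N, ContMDiffOn 𝓘(ℝ, ℝ) 𝓘(ℝ, R2 n) 1 γ (Icc (τ k) (τ (k + 1)))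

/-- The integral `∮_γ θ_i`. -/
noncomputable def loopIntegral (Ω : SymplecticForm n M) (F : M → Fin n → ℝ) (i : Fin n)
    (γ : ℝ → M) : ℝ :=
  ∫ t in (0 : ℝ)..1, coframe Ω F i (γ t) (velocity γ t)

/-- The length `∮_γ ds` for the flat metric `ds² = ∑ θ_i²` on the regular part of the fibre. -/
noncomputable def loopLength (Ω : SymplecticForm n M) (F : M → Fin n → ℝ) (γ : ℝ → M) : ℝ :=
  ∫ t in (0 : ℝ)..1, Real.sqrt (∑ i, (coframe Ω F i (γ t) (velocity γ t)) ^ 2)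

/-- The orbit `O_m` of `m` under the local Hamiltonian `ℝⁿ`-action generated by `f_1, …, f_n`:
all points reachable from `m` by following finitely many (not necessarily complete)
trajectories of the fields `X_{f_i}`, forwards or backwards. -/
def hamOrbit (Ω : SymplecticForm n M) (F : M → Fin n → ℝ) (m : M) : Set M :=
  {m' | Relation.ReflTransGen (fun p q : M => ∃ (i : Fin n) (γ : ℝ → M) (T : ℝ),
    IsMIntegralCurveOn (I := 𝓘(ℝ, R2 n)) γ (hamVF Ω (component F i)) (uIcc 0 T) ∧
      γ 0 = p ∧ γ T = q) m m'}

/-- The flows of all `X_{f_i}` are complete in the zero fibre `L₀ = F⁻¹(0)`. -/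
def FlowsCompleteInZeroFibre (Ω : SymplecticForm n M) (F : M → Fin n → ℝ) : Prop :=
  ∀ (i : Fin n), ∀ p ∈ F ⁻¹' {0}, ∃ γ : ℝ → M,
    IsMIntegralCurve (I := 𝓘(ℝ, R2 n)) γ (hamVF Ω (component F i)) ∧ γ 0 = p

/-- The standard symplectic form `∑ dx_{2i-1} ∧ dx_{2i}` on `ℝ²ⁿ` (coordinates are numbered
from `0` here). -/
def stdSymplectic (x y : R2 n) : ℝ :=
  ∑ i : Fin n,
    (x ⟨2 * i, by omega⟩ * y ⟨2 * i + 1, by omega⟩ - x ⟨2 * i + 1, by omega⟩ * y ⟨2 * i, by omega⟩)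

/-- `φ` is a canonical coordinate chart centred at `m₀` whose image is the open ball of
radius `r` about the origin. -/
structure IsCanonicalChart (Ω : SymplecticForm n M) (m₀ : M) (r : ℝ)
    (φ : OpenPartialHomeomorph M (R2 n)) : Prop where
  smooth : φ ∈ IsManifold.maximalAtlas 𝓘(ℝ, R2 n) ∞ M
  mem_source : m₀ ∈ φ.source
  centred : φ m₀ = 0
  target_eq : φ.target = Metric.ball 0 r
  canonical : ∀ m ∈ φ.source, ∀ v w : TangentSpace 𝓘(ℝ, R2 n) m,
    Ω.form m ![v, w] = stdSymplectic
      (mfderiv 𝓘(ℝ, R2 n) 𝓘(ℝ, R2 n) φ m v) (mfderiv 𝓘(ℝ, R2 n) 𝓘(ℝ, R2 n) φ m w)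

/-- The periodicity condition for the points `m₀, m₁` and the momentum map `F`: there are a
compact trajectory `γ₀` (closed or an equilibrium) of `X_{f_1}` and a continuous family
`γ_u ⊂ O_{m₁}`, `0 < u ≤ 1`, of `2π`-periodic trajectories of `X_{f_1}` with `m₁ ∈ γ_1` and
`m₀ ∈ γ₀ ⊂ closure (⋃ γ_u)`. -/
def PeriodicityCondition [NeZero n] (Ω : SymplecticForm n M) (F : M → Fin n → ℝ)
    (m₀ m₁ : M) : Prop :=
  ∃ (γ₀ : ℝ → M) (Γ : ℝ → ℝ → M),
    IsMIntegralCurve (I := 𝓘(ℝ, R2 n)) γ₀ (hamVF Ω (component F 0)) ∧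
    (∃ T > 0, Function.Periodic γ₀ T) ∧
    ContinuousOn (fun p : ℝ × ℝ => Γ p.1 p.2) (Ioc 0 1 ×ˢ univ) ∧
    (∀ u ∈ Ioc (0 : ℝ) 1,
      IsMIntegralCurve (I := 𝓘(ℝ, R2 n)) (Γ u) (hamVF Ω (component F 0)) ∧
      Function.Periodic (Γ u) (2 * Real.pi) ∧
      range (Γ u) ⊆ hamOrbit Ω F m₁) ∧
    m₁ ∈ range (Γ 1) ∧
    m₀ ∈ range γ₀ ∧
    range γ₀ ⊆ closure (⋃ u ∈ Ioc (0 : ℝ) 1, range (Γ u))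

/-- The momentum map `(f, f_2, …, f_n)` with `f = ∑ a_i f_i`. -/
def replaceFirst [NeZero n] (F : M → Fin n → ℝ) (a : Fin n → ℝ) : M → Fin n → ℝ :=
  fun m => Function.update (F m) 0 (∑ i, a i * F m i)

end Symplectic

/-!
The commuting fields `X_{fᵢ}` generate a local `ℝⁿ`-action, recorded by its orbit maps
`Φ(s) = s · p`, the solutions of `dΦ = ∑ᵢ X_{fᵢ}(Φ) dsᵢ`. Along a curve in the regular part of the
zero fibre `∫ θ` recovers the parameter `s`, so `w = (∮ θ₁, …, ∮ θₙ)` is a period: `w · m₁ = m₁`.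
At a regular point `s · p = p` persists along a path of base points: the level set is locally the
orbit, and translating an orbit map by `s` gives another orbit map. So all points `m_u` have the
period `w`, provided their orbit maps exist on a ball of radius greater than `‖w‖ ≤ ℓ`. Grönwall's
inequality in the canonical chart guarantees this, since there the fields are bounded by `n c |x|`.
When the flows are complete, the orbit maps are global and the path is taken dense in the orbit.
With `a = w / 2π`, each `m_u` lies on a `2π`-periodic trajectory of `f = ∑ᵢ aᵢ fᵢ`, and these
accumulate at the equilibrium `m₀`.
-/

section FlowOfCommutingFields

variable {E V : Type*} [NormedAddCommGroup E] [NormedSpace ℝ E] [NormedAddCommGroup V]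
  [NormedSpace ℝ V]

theorem gronwallBound_zero_mul (K ε b x : ℝ) :
    gronwallBound 0 K (ε * b) x = gronwallBound 0 K ε x * b := by
  unfold gronwallBound
  split_ifs <;> ring

theorem gronwallBound_mul_right (δ K a x : ℝ) :
    gronwallBound δ K (K * a) x = (a + δ) * Real.exp (K * x) - a := by
  by_cases hK : K = 0
  · simp [hK, gronwallBound_K0]
  · rw [gronwallBound_of_K_ne_0 hK]
    field_simp
    ring

theorem norm_le_gronwallBound_of_hasDerivWithinAt_Icc {f f' : ℝ → E} {δ K ε a b : ℝ}
    (hf : ∀ t ∈ Icc a b, HasDerivWithinAt f (f' t) (Icc a b) t) (ha : ‖f a‖ ≤ δ)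
    (bound : ∀ t ∈ Icc a b, ‖f' t‖ ≤ K * ‖f t‖ + ε) :
    ∀ t ∈ Icc a b, ‖f t‖ ≤ gronwallBound δ K ε (t - a) :=
  norm_le_gronwallBound_of_norm_deriv_right_le (fun t ht => (hf t ht).continuousWithinAt)
    (fun t ht => (hf t (Ico_subset_Icc_self ht)).mono_of_mem_nhdsWithin
      (Filter.mem_of_superset (Icc_mem_nhdsGE ht.2) (Icc_subset_Icc_left ht.1)))
    ha fun t ht => bound t (Ico_subset_Icc_self ht)

theorem norm_image_sub_sub_le_of_lipschitz_hasFDerivAt {G : Type*} [NormedAddCommGroup G]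
    [NormedSpace ℝ G] {f : E → G} {f' : E → E →L[ℝ] G} {s : Set E} {C : ℝ} (hs : Convex ℝ s)
    (hC : 0 ≤ C) (hf : ∀ x ∈ s, HasFDerivAt f (f' x) x)
    (hf' : ∀ x ∈ s, ∀ y ∈ s, ‖f' y - f' x‖ ≤ C * ‖y - x‖) {x y : E} (hx : x ∈ s) (hy : y ∈ s) :
    ‖f y - f x - f' x (y - x)‖ ≤ C * ‖y - x‖ * ‖y - x‖ := by
  have hseg : segment ℝ x y ⊆ s := hs.segment_subset hx hy
  refine (convex_segment x y).norm_image_sub_le_of_norm_hasFDerivWithin_le'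
    (fun z hz => (hf z (hseg hz)).hasFDerivWithinAt) (fun z hz => ?_)
    (left_mem_segment ℝ x y) (right_mem_segment ℝ x y)
  calc ‖f' z - f' x‖ ≤ C * ‖z - x‖ := hf' x hx z (hseg hz)
    _ ≤ C * ‖y - x‖ := by gcongr; exact norm_sub_le_of_mem_segment hz

section TimeOne

variable {A : E → V →L[ℝ] E} {A' : E → E →L[ℝ] V →L[ℝ] E} {W : Set E} {C₀ K₁ K₂ : ℝ}
  {s v : V} {x y : ℝ → E}

theorem norm_integralCurve_sub_le (hC₀ : ∀ p ∈ W, ‖A p‖ ≤ C₀)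
    (hlip : ∀ p ∈ W, ∀ q ∈ W, ‖A q - A p‖ ≤ K₁ * ‖q - p‖) (hK₁ : 0 ≤ K₁)
    (hx : IsIntegralCurveOn x (fun _ p => A p s) (Icc 0 1)) (hxW : MapsTo x (Icc 0 1) W)
    (hy : IsIntegralCurveOn y (fun _ p => A p (s + v)) (Icc 0 1)) (hyW : MapsTo y (Icc 0 1) W)
    (h0 : y 0 = x 0) {t : ℝ} (ht : t ∈ Icc (0 : ℝ) 1) :
    ‖y t - x t‖ ≤ gronwallBound 0 (K₁ * ‖s‖) C₀ 1 * ‖v‖ := by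
  have hC₀' : 0 ≤ C₀ := (norm_nonneg _).trans (hC₀ _ (hxW ht))
  have bound : ∀ t ∈ Icc (0 : ℝ) 1,
      ‖A (y t) (s + v) - A (x t) s‖ ≤ K₁ * ‖s‖ * ‖y t - x t‖ + C₀ * ‖v‖ := fun t ht => calc
    _ = ‖(A (y t) - A (x t)) s + A (y t) v‖ := by
      simp only [map_add, sub_apply]
      abel_nf
    _ ≤ ‖A (y t) - A (x t)‖ * ‖s‖ + ‖A (y t)‖ * ‖v‖ :=
      norm_add_le_of_le (ContinuousLinearMap.le_opNorm _ _) (ContinuousLinearMap.le_opNorm _ _)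
    _ ≤ K₁ * ‖y t - x t‖ * ‖s‖ + C₀ * ‖v‖ := by
      gcongr
      exacts [hlip _ (hxW ht) _ (hyW ht), hC₀ _ (hyW ht)]
    _ = _ := by ring
  have h := norm_le_gronwallBound_of_hasDerivWithinAt_Icc (δ := 0)
    (fun t ht => (hy t ht).sub (hx t ht)) (by simp [h0]) bound t ht
  refine h.trans ?_
  rw [← gronwallBound_zero_mul]
  exact gronwallBound_mono le_rfl (by positivity) (by positivity) (by linarith [ht.2])

/-- The commutation identity lets the derivative of `t • A (x t) v` along `x` be written as
`A' p (t • A p v) s`, so that all first-order terms cancel. -/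
theorem norm_sub_sub_sub_le_of_commuting {p q : E} {C t : ℝ} (hC₁ : ‖A' p‖ ≤ K₁)
    (hlip : ‖A q - A p‖ ≤ K₁ * ‖q - p‖)
    (htaylor : ‖A q - A p - A' p (q - p)‖ ≤ K₂ * ‖q - p‖ * ‖q - p‖) (hK₁ : 0 ≤ K₁) (hK₂ : 0 ≤ K₂)
    (hcomm : A' p (A p s) v = A' p (A p v) s) (hqp : ‖q - p‖ ≤ C * ‖v‖) :
    ‖A q (s + v) - A p s - (t • A' p (A p s) v + A p v)‖ ≤
      K₁ * ‖s‖ * ‖q - p - t • A p v‖ + (K₂ * C * C * ‖s‖ + K₁ * C) * ‖v‖ ^ 2 := by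
  have hCv : 0 ≤ C * ‖v‖ := (norm_nonneg _).trans hqp
  calc
    _ = ‖(A q - A p - A' p (q - p)) s + A' p (q - p - t • A p v) s + (A q - A p) v‖ := by
      rw [hcomm]
      simp only [map_add, map_sub, map_smul, sub_apply, smul_apply]
      abel_nf
    _ ≤ ‖A q - A p - A' p (q - p)‖ * ‖s‖ + ‖A' p‖ * ‖q - p - t • A p v‖ * ‖s‖
        + ‖A q - A p‖ * ‖v‖ :=
      norm_add_le_of_le (norm_add_le_of_le (ContinuousLinearMap.le_opNorm _ _)
        (ContinuousLinearMap.le_opNorm₂ _ _ _)) (ContinuousLinearMap.le_opNorm _ _)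
    _ ≤ K₂ * (C * ‖v‖) * (C * ‖v‖) * ‖s‖ + K₁ * ‖q - p - t • A p v‖ * ‖s‖
        + K₁ * (C * ‖v‖) * ‖v‖ := by
      gcongr
      · exact htaylor.trans (by gcongr)
      · exact hlip.trans (by gcongr)
    _ = _ := by ring

theorem exists_norm_integralCurve_sub_sub_le_of_commuting (hW : Convex ℝ W) (hK₂ : 0 ≤ K₂)
    (hA : ∀ p ∈ W, HasFDerivAt A (A' p) p) (hC₀ : ∀ p ∈ W, ‖A p‖ ≤ C₀)
    (hA₁ : ∀ p ∈ W, ‖A' p‖ ≤ K₁) (hA₂ : ∀ p ∈ W, ∀ q ∈ W, ‖A' q - A' p‖ ≤ K₂ * ‖q - p‖)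
    (hcomm : ∀ p ∈ W, ∀ v w, A' p (A p v) w = A' p (A p w) v)
    (hx : IsIntegralCurveOn x (fun _ p => A p s) (Icc 0 1)) (hxW : MapsTo x (Icc 0 1) W) :
    ∃ C, ∀ (v : V) (y : ℝ → E), IsIntegralCurveOn y (fun _ p => A p (s + v)) (Icc 0 1) →
      MapsTo y (Icc 0 1) W → y 0 = x 0 → ‖y 1 - x 1 - A (x 1) v‖ ≤ C * ‖v‖ ^ 2 := by
  have h1 : (1 : ℝ) ∈ Icc (0 : ℝ) 1 := right_mem_Icc.2 zero_le_one
  have hK₁ : 0 ≤ K₁ := (norm_nonneg (A' (x 1))).trans (hA₁ _ (hxW h1))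
  have hlip : ∀ p ∈ W, ∀ q ∈ W, ‖A q - A p‖ ≤ K₁ * ‖q - p‖ := fun p hp q hq =>
    hW.norm_image_sub_le_of_norm_hasFDerivWithin_le
      (fun z hz => (hA z hz).hasFDerivWithinAt) hA₁ hp hq
  have hderiv : ∀ (v : V) (y : ℝ → E),
      IsIntegralCurveOn y (fun _ p => A p (s + v)) (Icc 0 1) → ∀ t ∈ Icc (0 : ℝ) 1,
      HasDerivWithinAt (fun t => y t - x t - t • A (x t) v)
        (A (y t) (s + v) - A (x t) s - (t • A' (x t) (A (x t) s) v + A (x t) v))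
        (Icc 0 1) t := by
    intro v y hy t ht
    have hAx := (ContinuousLinearMap.apply ℝ E v).hasFDerivAt.comp_hasDerivWithinAt t
      ((hA _ (hxW ht)).comp_hasDerivWithinAt t (hx t ht))
    have hmul := (hasDerivWithinAt_id t (Icc 0 1)).smul hAx
    rw [one_smul] at hmul
    exact ((hy t ht).sub (hx t ht)).sub hmul
  let C₁ := gronwallBound 0 (K₁ * ‖s‖) C₀ 1
  refine ⟨gronwallBound 0 (K₁ * ‖s‖) (K₂ * C₁ * C₁ * ‖s‖ + K₁ * C₁) 1, fun v y hy hyW h0 => ?_⟩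
  have h := norm_le_gronwallBound_of_hasDerivWithinAt_Icc (δ := 0) (hderiv v y hy) (by simp [h0])
    (fun t ht => norm_sub_sub_sub_le_of_commuting (hA₁ _ (hxW ht)) (hlip _ (hxW ht) _ (hyW ht))
      (norm_image_sub_sub_le_of_lipschitz_hasFDerivAt hW hK₂ hA hA₂ (hxW ht) (hyW ht)) hK₁ hK₂
      (hcomm _ (hxW ht) s v)
      (norm_integralCurve_sub_le hC₀ hlip hK₁ hx hxW hy hyW h0 ht)) 1 h1
  rwa [sub_zero, one_smul, gronwallBound_zero_mul] at h

theorem hasFDerivAt_timeOne_of_commuting (hW : Convex ℝ W) (hK₂ : 0 ≤ K₂)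
    (hA : ∀ p ∈ W, HasFDerivAt A (A' p) p) (hC₀ : ∀ p ∈ W, ‖A p‖ ≤ C₀)
    (hA₁ : ∀ p ∈ W, ‖A' p‖ ≤ K₁) (hA₂ : ∀ p ∈ W, ∀ q ∈ W, ‖A' q - A' p‖ ≤ K₂ * ‖q - p‖)
    (hcomm : ∀ p ∈ W, ∀ v w, A' p (A p v) w = A' p (A p w) v)
    {Z : Set V} (hZ : IsOpen Z) {u : V → ℝ → E} {x₀ : E} (hu₀ : ∀ s ∈ Z, u s 0 = x₀)
    (hu : ∀ s ∈ Z, IsIntegralCurveOn (u s) (fun _ p => A p s) (Icc 0 1))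
    (huW : ∀ s ∈ Z, MapsTo (u s) (Icc 0 1) W) (hs : s ∈ Z) :
    HasFDerivAt (fun s => u s 1) (A (u s 1)) s := by
  rw [hasFDerivAt_iff_isLittleO_nhds_zero]
  have hO : (fun v => u (s + v) 1 - u s 1 - A (u s 1) v) =O[𝓝 0] fun v => ‖v‖ ^ 2 := by
    have hnear : ∀ᶠ v in 𝓝 (0 : V), s + v ∈ Z :=
      (continuous_const_add s).continuousAt.eventually (by simpa using hZ.mem_nhds hs)
    obtain ⟨C, hC⟩ := exists_norm_integralCurve_sub_sub_le_of_commuting hW hK₂ hA hC₀ hA₁ hA₂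
      hcomm (hu s hs) (huW s hs)
    refine Asymptotics.IsBigO.of_bound C (hnear.mono fun v hv => ?_)
    simpa only [norm_pow, norm_norm] using
      hC v _ (hu _ hv) (huW _ hv) ((hu₀ _ hv).trans (hu₀ s hs).symm)
  exact hO.trans_isLittleO (Asymptotics.isLittleO_norm_pow_id one_lt_two)

end TimeOne

theorem exists_isIntegralCurveOn_of_lipschitz_of_bounded [CompleteSpace E] {Y : E → E}
    {K L : NNReal} (hK : LipschitzWith K Y) (hL : ∀ x, ‖Y x‖ ≤ L) (x₀ : E) :
    ∃ y : ℝ → E, y 0 = x₀ ∧ IsIntegralCurveOn y (fun _ => Y) (Icc 0 1) := by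
  have h : IsPicardLindelof (fun _ => Y) (⟨0, by simp⟩ : Icc (0 : ℝ) 1) x₀ L 0 L K :=
    { lipschitzOnWith := fun _ _ => hK.lipschitzOnWith
      continuousOn := fun _ _ => continuousOn_const
      norm_le := fun _ _ x _ => hL x
      mul_max_le := by simp }
  exact h.exists_eq_forall_mem_Icc_hasDerivWithinAt₀

theorem exists_isIntegralCurveOn_of_contDiff_of_hasCompactSupport [CompleteSpace E] {Y : E → E}
    (hY : ContDiff ℝ 1 Y) (hc : HasCompactSupport Y) (x₀ : E) :
    ∃ y : ℝ → E, y 0 = x₀ ∧ IsIntegralCurveOn y (fun _ => Y) (Icc 0 1) := by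
  obtain ⟨K, hK⟩ := hY.lipschitzWith_of_hasCompactSupport hc one_ne_zero
  obtain ⟨L, hL⟩ := hc.exists_bound_of_continuous hY.continuous
  exact exists_isIntegralCurveOn_of_lipschitz_of_bounded hK
    (fun x => (hL x).trans (Real.le_coe_toNNReal L)) x₀

theorem contDiff_smul_of_tsupport_subset {f : E → ℝ} {Y : E → V} {U : Set E} {k : ℕ∞}
    (hf : ContDiff ℝ k f) (hU : IsOpen U) (hfU : tsupport f ⊆ U) (hY : ContDiffOn ℝ k Y U) :
    ContDiff ℝ k fun x => f x • Y x :=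
  (contMDiff_of_tsupport fun _ hx => (hf.contDiffAt.smul (hY.contDiffAt
    (hU.mem_nhds (hfU (tsupport_smul_subset_left f Y hx))))).contMDiffAt).contDiff

theorem norm_integralCurve_sub_le_of_linear_growth {Y : E → E} {y : ℝ → E} {c : E} {κ α : ℝ}
    (hα : 0 ≤ α) (hκ : 0 ≤ κ) (hY : ∀ x, ‖Y x‖ ≤ κ * (α + ‖x - c‖))
    (hy : IsIntegralCurveOn y (fun _ => Y) (Icc 0 1)) {t : ℝ} (ht : t ∈ Icc (0 : ℝ) 1) :
    ‖y t - c‖ ≤ (α + ‖y 0 - c‖) * Real.exp κ - α := by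
  have h := norm_le_gronwallBound_of_hasDerivWithinAt_Icc (K := κ) (ε := κ * α)
    (fun t ht => (hy t ht).sub_const c) le_rfl (fun t _ => (hY _).trans_eq (by ring)) t ht
  rw [gronwallBound_mul_right, sub_zero] at h
  refine h.trans ?_
  gcongr
  exact mul_le_of_le_one_right hκ ht.2

theorem exists_isIntegralCurveOn_family_of_linear_growth [FiniteDimensional ℝ E]
    {A : E → V →L[ℝ] E} {c x₀ : E} {R R₁ κ α ρ : ℝ} (hκ : 0 ≤ κ) (hα : 0 ≤ α)
    (hA : ContDiffOn ℝ 1 A (Metric.ball c R))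
    (hbd : ∀ x ∈ Metric.ball c R, ‖A x‖ ≤ κ * (α + ‖x - c‖)) (hR₁0 : 0 < R₁) (hR₁R : R₁ < R)
    (hR₁ : (α + ‖x₀ - c‖) * Real.exp (κ * ρ) - α ≤ R₁) :
    ∃ u : V → ℝ → E, (∀ s, u s 0 = x₀) ∧ ∀ s ∈ Metric.ball (0 : V) ρ,
      IsIntegralCurveOn (u s) (fun _ p => A p s) (Icc 0 1) ∧
        MapsTo (u s) (Icc 0 1) (Metric.closedBall c R₁) := by
  obtain ⟨R₂, hR₁₂, hR₂R⟩ := exists_between hR₁R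
  let f : ContDiffBump c := ⟨R₁, R₂, hR₁0, hR₁₂⟩
  have hfU : tsupport f ⊆ Metric.ball c R :=
    f.tsupport_eq.trans_subset (Metric.closedBall_subset_ball hR₂R)
  have hsol : ∀ s : V, ∃ y : ℝ → E,
      y 0 = x₀ ∧ IsIntegralCurveOn y (fun _ p => f p • A p s) (Icc 0 1) := fun s =>
    exists_isIntegralCurveOn_of_contDiff_of_hasCompactSupport
      (contDiff_smul_of_tsupport_subset f.contDiff Metric.isOpen_ball hfU
        (hA.clm_apply contDiffOn_const))
      f.hasCompactSupport.smul_right x₀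
  choose u hu₀ hu using hsol
  have hgrowth : ∀ s p, ‖f p • A p s‖ ≤ κ * ‖s‖ * (α + ‖p - c‖) := by
    intro s p
    by_cases hp : p ∈ Metric.ball c R
    · calc ‖f p • A p s‖ ≤ 1 * (κ * (α + ‖p - c‖) * ‖s‖) := by
            rw [norm_smul, Real.norm_of_nonneg f.nonneg]
            gcongr
            exacts [f.le_one, (A p).le_of_opNorm_le (hbd p hp) s]
        _ = _ := by ring
    · rw [image_eq_zero_of_notMem_tsupport fun h => hp (hfU h), zero_smul, norm_zero]
      positivity
  have huW : ∀ s ∈ Metric.ball (0 : V) ρ, MapsTo (u s) (Icc 0 1) (Metric.closedBall c R₁) := by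
    intro s hs t ht
    rw [mem_closedBall_iff_norm]
    refine (norm_integralCurve_sub_le_of_linear_growth hα (by positivity) (hgrowth s) (hu s)
      ht).trans (le_trans ?_ hR₁)
    rw [hu₀]
    gcongr
    exact (mem_ball_zero_iff.1 hs).le
  refine ⟨u, hu₀, fun s hs => ⟨fun t ht => ?_, huW s hs⟩⟩
  simpa only [f.one_of_mem_closedBall (huW s hs ht), one_smul] using hu s t ht

theorem exists_timeOne_of_commuting [FiniteDimensional ℝ E] {A : E → V →L[ℝ] E} {c x₀ : E}
    {R κ α ρ : ℝ} (hκ : 0 ≤ κ) (hα : 0 ≤ α) (hA : ContDiffOn ℝ 2 A (Metric.ball c R))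
    (hcomm : ∀ x ∈ Metric.ball c R, ∀ v w, fderiv ℝ A x (A x v) w = fderiv ℝ A x (A x w) v)
    (hbd : ∀ x ∈ Metric.ball c R, ‖A x‖ ≤ κ * (α + ‖x - c‖)) (hρ : 0 < ρ)
    (hR : (α + ‖x₀ - c‖) * Real.exp (κ * ρ) < α + R) :
    ∃ Ψ : V → E, Ψ 0 = x₀ ∧ ∀ s ∈ Metric.ball (0 : V) ρ,
      Ψ s ∈ Metric.ball c R ∧ HasFDerivAt Ψ (A (Ψ s)) s := by
  obtain ⟨R₁, hR₁, hR₁R⟩ : ∃ R₁, (α + ‖x₀ - c‖) * Real.exp (κ * ρ) - α < R₁ ∧ R₁ < R :=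
    exists_between (by linarith)
  have hR₁0 : 0 < R₁ := by
    have hexp : 1 ≤ Real.exp (κ * ρ) := Real.one_le_exp (by positivity)
    nlinarith [norm_nonneg (x₀ - c)]
  have hball : Metric.closedBall c R₁ ⊆ Metric.ball c R := Metric.closedBall_subset_ball hR₁R
  have hK : IsCompact (Metric.closedBall c R₁) :=
    haveI := FiniteDimensional.proper ℝ E
    isCompact_closedBall c R₁
  have hA1 : ContDiffOn ℝ 1 (fderiv ℝ A) (Metric.ball c R) :=
    hA.fderiv_of_isOpen Metric.isOpen_ball (by norm_num)
  obtain ⟨C₀, hC₀⟩ := hK.exists_bound_of_continuousOn (hA.continuousOn.mono hball)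
  obtain ⟨K₁, hK₁⟩ : ∃ C, ∀ x ∈ Metric.closedBall c R₁, ‖fderiv ℝ A x‖ ≤ C :=
    hK.exists_bound_of_continuousOn (E := E →L[ℝ] V →L[ℝ] E) (hA1.continuousOn.mono hball)
  obtain ⟨K₂, hK₂⟩ := (hA1.mono hball).exists_lipschitzOnWith one_ne_zero
    (convex_closedBall c R₁) hK
  obtain ⟨u, hu₀, hu⟩ := exists_isIntegralCurveOn_family_of_linear_growth hκ hα
    (hA.of_le one_le_two) hbd hR₁0 hR₁R hR₁.le
  have hderiv : ∀ s ∈ Metric.ball (0 : V) ρ, HasFDerivAt (fun s => u s 1) (A (u s 1)) s :=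
    fun s hs => hasFDerivAt_timeOne_of_commuting (convex_closedBall c R₁) K₂.coe_nonneg
      (fun x hx => ((hA.differentiableOn two_ne_zero).differentiableAt
        (Metric.isOpen_ball.mem_nhds (hball hx))).hasFDerivAt)
      hC₀ hK₁ (fun x hx y hy => hK₂.norm_sub_le hy hx) (fun x hx => hcomm x (hball hx))
      Metric.isOpen_ball (fun s _ => hu₀ s) (fun s hs => (hu s hs).1) (fun s hs => (hu s hs).2) hs
  have hone : (1 : ℝ) ∈ Icc (0 : ℝ) 1 := right_mem_Icc.2 zero_le_one
  refine ⟨fun s => u s 1, ?_, fun s hs => ⟨hball ((hu s hs).2 hone), hderiv s hs⟩⟩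
  have hconst := norm_le_gronwallBound_of_hasDerivWithinAt_Icc (f := fun t => u 0 t - x₀) (δ := 0)
    (K := 0) (ε := 0) (fun t ht => ((hu 0 (Metric.mem_ball_self hρ)).1 t ht).sub_const x₀)
    (by simp [hu₀]) (by simp) 1 hone
  simpa [gronwallBound_ε0_δ0, sub_eq_zero] using hconst

end FlowOfCommutingFields

section HamiltonianFields

variable {E V : Type*} [NormedAddCommGroup E] [NormedSpace ℝ E]
  [NormedAddCommGroup V] [NormedSpace ℝ V]

/-- The bilinear map `(v, w) ↦ η(w, v)` of a 2-form. The arguments are exchanged so that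
`formBilin η X = η(·, X)` is the left-hand side of the equation defining a Hamiltonian field. -/
noncomputable def formBilin (η : E [⋀^Fin 2]→L[ℝ] ℝ) : E →L[ℝ] E →L[ℝ] ℝ :=
  ((continuousMultilinearCurryFin1 ℝ E ℝ).toContinuousLinearEquiv.toContinuousLinearMap.comp
    η.toContinuousMultilinearMap.curryLeft).flip

theorem formBilin_apply (η : E [⋀^Fin 2]→L[ℝ] ℝ) (v w : E) : formBilin η v w = η ![w, v] := by
  refine congrArg η ?_
  ext i : 1
  fin_cases i <;> rfl

theorem form_swap (η : E [⋀^Fin 2]→L[ℝ] ℝ) (v w : E) : η ![v, w] = -η ![w, v] := by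
  have hswap : ![w, v] ∘ Equiv.swap 0 1 = ![v, w] := by
    ext i : 1
    fin_cases i <;> simp
  rw [← hswap]
  exact η.map_swap ![w, v] (i := 0) (j := 1) (by decide)

theorem form_sum_smul_right {ι : Type*} [Fintype ι] (η : E [⋀^Fin 2]→L[ℝ] ℝ) (w : E)
    (c : ι → ℝ) (u : ι → E) : η ![w, ∑ i, c i • u i] = ∑ i, c i * η ![w, u i] := by
  simp only [← formBilin_apply, map_sum, map_smul, sum_apply, smul_apply, smul_eq_mul]

theorem fderiv_formBilin_apply {η : E → E [⋀^Fin 2]→L[ℝ] ℝ} {x : E}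
    (hη : DifferentiableAt ℝ (fun y => formBilin (η y)) x) (z a b : E) :
    fderiv ℝ (fun y => formBilin (η y)) x z a b = fderiv ℝ (fun y => η y ![b, a]) x z := by
  have h := (hη.hasFDerivAt.clm_apply (hasFDerivAt_const a x)).clm_apply (hasFDerivAt_const b x)
  simp only [formBilin_apply] at h
  rw [h.fderiv]
  simp

theorem fderiv_formBilin_cyclic {η : E → E [⋀^Fin 2]→L[ℝ] ℝ} {x : E}
    (hη : DifferentiableAt ℝ η x) (hB : DifferentiableAt ℝ (fun y => formBilin (η y)) x)
    (hclosed : extDeriv η x = 0) (a b c : E) :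
    fderiv ℝ (fun y => formBilin (η y)) x a c b - fderiv ℝ (fun y => formBilin (η y)) x b c a
      + fderiv ℝ (fun y => formBilin (η y)) x c b a = 0 := by
  have h := extDeriv_apply hη ![a, b, c]
  rw [hclosed, Fin.sum_univ_three] at h
  have hbc : (0 : Fin 3).removeNth ![a, b, c] = ![b, c] := by
    ext i : 1; fin_cases i <;> rfl
  have hac : (1 : Fin 3).removeNth ![a, b, c] = ![a, c] := by
    ext i : 1; fin_cases i <;> rfl
  have hab : (2 : Fin 3).removeNth ![a, b, c] = ![a, b] := by
    ext i : 1; fin_cases i <;> rfl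
  rw [hbc, hac, hab, ← fderiv_formBilin_apply hB, ← fderiv_formBilin_apply hB,
    ← fderiv_formBilin_apply hB] at h
  simp only [ContinuousAlternatingMap.coe_zero, Pi.zero_apply, Fin.val_zero, Fin.val_one,
    Fin.val_two, pow_zero, pow_one, neg_one_sq, one_smul, neg_smul, Matrix.cons_val] at h
  linarith

section Bilinear

variable {B : E → E →L[ℝ] E →L[ℝ] ℝ} {A : E → V →L[ℝ] E} {x : E}

theorem hasFDerivAt_apply_vector (hA : DifferentiableAt ℝ A x) (v : V) :
    HasFDerivAt (fun y => A y v) ((fderiv ℝ A x).flip v) x :=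
  (ContinuousLinearMap.apply ℝ E v).hasFDerivAt.comp x hA.hasFDerivAt

theorem hasFDerivAt_contraction (hB : DifferentiableAt ℝ B x) (hA : DifferentiableAt ℝ A x)
    (v : V) :
    HasFDerivAt (fun y => B y (A y v))
      ((B x).comp ((fderiv ℝ A x).flip v) + (fderiv ℝ B x).flip (A x v)) x :=
  hB.hasFDerivAt.clm_apply (hasFDerivAt_apply_vector hA v)

theorem fderiv_fderiv_eq_of_contraction_eq (hB : DifferentiableAt ℝ B x)
    (hA : DifferentiableAt ℝ A x) {v : V} {f : E → ℝ}
    (hf : (fun y => B y (A y v)) =ᶠ[𝓝 x] fderiv ℝ f) (z p : E) :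
    fderiv ℝ (fderiv ℝ f) x z p = B x (fderiv ℝ A x z v) p + fderiv ℝ B x z (A x v) p := by
  rw [← hf.fderiv_eq, (hasFDerivAt_contraction hB hA v).fderiv]
  rfl

theorem fderiv_eq_zero_of_isotropic (hB : DifferentiableAt ℝ B x) (hA : DifferentiableAt ℝ A x)
    {v w : V} (h0 : (fun y => B y (A y w) (A y v)) =ᶠ[𝓝 x] fun _ => 0) (z : E) :
    B x (fderiv ℝ A x z w) (A x v) + fderiv ℝ B x z (A x w) (A x v)
      + B x (A x w) (fderiv ℝ A x z v) = 0 := by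
  have h := h0.fderiv_eq (𝕜 := ℝ)
  rw [((hasFDerivAt_contraction hB hA w).clm_apply (hasFDerivAt_apply_vector hA v)).fderiv] at h
  have hz := congrArg (fun L : E →L[ℝ] ℝ => L z) h
  simp only [ContinuousLinearMap.flip_add, add_apply, ContinuousLinearMap.comp_apply,
    ContinuousLinearMap.flip_apply, fderiv_fun_const, Pi.zero_apply, zero_apply] at hz
  linarith

end Bilinear

variable [FiniteDimensional ℝ E]

theorem contDiffOn_formBilin {η : E → E [⋀^Fin 2]→L[ℝ] ℝ} {W : Set E} {k : WithTop ℕ∞}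
    (h : ContDiffOn ℝ k η W) : ContDiffOn ℝ k (fun x => formBilin (η x)) W := by
  refine contDiffOn_clm_apply.2 fun v => contDiffOn_clm_apply.2 fun w => ?_
  simp only [formBilin_apply]
  exact (ContinuousAlternatingMap.apply ℝ E ℝ ![w, v]).contDiff.comp_contDiffOn h

theorem exists_equiv_eq_formBilin {η : E [⋀^Fin 2]→L[ℝ] ℝ}
    (h : ∀ v, (∀ w, η ![w, v] = 0) → v = 0) :
    ∃ e : E ≃L[ℝ] (E →L[ℝ] ℝ), (e : E →L[ℝ] (E →L[ℝ] ℝ)) = formBilin η := by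
  have hinj : Function.Injective (formBilin η).toLinearMap := by
    rw [← LinearMap.ker_eq_bot, LinearMap.ker_eq_bot']
    intro v hv
    refine h v fun w => ?_
    rw [← formBilin_apply]
    exact congrArg (fun L : E →L[ℝ] ℝ => L w) hv
  have hdual : Module.finrank ℝ E = Module.finrank ℝ (E →L[ℝ] ℝ) :=
    (Subspace.dual_finrank_eq (K := ℝ) (V := E)).symm.trans
      (LinearMap.toContinuousLinearMap : (E →ₗ[ℝ] ℝ) ≃ₗ[ℝ] (E →L[ℝ] ℝ)).finrank_eq
  exact ⟨(LinearEquiv.ofInjectiveOfFinrankEq _ hinj hdual).toContinuousLinearEquiv, rfl⟩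

variable [FiniteDimensional ℝ V]

section Hamiltonian

variable {η : E → E [⋀^Fin 2]→L[ℝ] ℝ} {W : Set E} {f : V → E → ℝ} {A : E → V →L[ℝ] E}

theorem contDiffOn_hamiltonian (hW : IsOpen W) (hη : ContDiffOn ℝ ∞ η W)
    (hnd : ∀ x ∈ W, ∀ v, (∀ w, η x ![w, v] = 0) → v = 0) (hf : ∀ v, ContDiffOn ℝ ∞ (f v) W)
    (hA : ∀ x ∈ W, ∀ v w, η x ![w, A x v] = fderiv ℝ (f v) x w) : ContDiffOn ℝ ∞ A W := by
  have hdf : ContDiffOn ℝ ∞ (fun x => (formBilin (η x)).comp (A x)) W := by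
    refine contDiffOn_clm_apply.2 fun v => ?_
    refine ((hf v).fderiv_of_isOpen hW (m := ∞) (by simp)).congr fun x hx => ?_
    ext w
    simp [formBilin_apply, hA x hx]
  have hA_eq : ∀ y ∈ W, A y = (formBilin (η y)).inverse.comp ((formBilin (η y)).comp (A y)) := by
    intro y hy
    obtain ⟨e, he⟩ := exists_equiv_eq_formBilin (hnd y hy)
    ext v
    simp [← he]
  intro x hx
  obtain ⟨e, he⟩ := exists_equiv_eq_formBilin (hnd x hx)
  have hinv : ContDiffWithinAt ℝ ∞ (fun x => (formBilin (η x)).inverse) W x := by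
    have := contDiffAt_map_inverse (n := ∞) e
    rw [he] at this
    exact this.comp_contDiffWithinAt x (contDiffOn_formBilin hη x hx)
  exact (hinv.clm_comp (hdf x hx)).congr hA_eq (hA_eq x hx)

/-- Paired with any vector, the difference of the two sides is a combination of the symmetry of
the Hessians, the derivative of the involution relation, and the closedness of the form. -/
theorem fderiv_hamiltonian_comm (hW : IsOpen W) (hη : ContDiffOn ℝ ∞ η W)
    (hclosed : ∀ x ∈ W, extDeriv η x = 0)
    (hnd : ∀ x ∈ W, ∀ v, (∀ w, η x ![w, v] = 0) → v = 0) (hf : ∀ v, ContDiffOn ℝ ∞ (f v) W)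
    (hA : ∀ x ∈ W, ∀ v w, η x ![w, A x v] = fderiv ℝ (f v) x w)
    (hinv : ∀ x ∈ W, ∀ v w, η x ![A x v, A x w] = 0) {x : E} (hx : x ∈ W) (v w : V) :
    fderiv ℝ A x (A x v) w = fderiv ℝ A x (A x w) v := by
  have hWx := hW.mem_nhds hx
  have hAx : DifferentiableAt ℝ A x :=
    ((contDiffOn_hamiltonian hW hη hnd hf hA).contDiffAt hWx).differentiableAt (by simp)
  have hBx : DifferentiableAt ℝ (fun y => formBilin (η y)) x :=
    ((contDiffOn_formBilin hη).contDiffAt hWx).differentiableAt (by simp)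
  have hess : ∀ v z p, fderiv ℝ (fderiv ℝ (f v)) x z p = _ := fun v =>
    fderiv_fderiv_eq_of_contraction_eq hBx hAx <| by
      filter_upwards [hWx] with y hy
      ext w
      rw [← hA y hy, formBilin_apply]
  have hsymm : ∀ v z p, fderiv ℝ (fderiv ℝ (f v)) x z p = fderiv ℝ (fderiv ℝ (f v)) x p z :=
    fun v z p => ((hf v).contDiffAt hWx).isSymmSndFDerivAt
      (by simpa using WithTop.coe_le_coe.2 (le_top : (2 : ℕ∞) ≤ ⊤)) z p
  rw [← sub_eq_zero]
  refine hnd x hx _ fun p => ?_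
  have hisotropic := fderiv_eq_zero_of_isotropic hBx hAx (v := v) (w := w) (by
    filter_upwards [hWx] with y hy
    rw [formBilin_apply, hinv y hy]) p
  have hcyclic := fderiv_formBilin_cyclic ((hη.contDiffAt hWx).differentiableAt (by simp)) hBx
    (hclosed x hx) p (A x w) (A x v)
  have hswap : formBilin (η x) (fderiv ℝ A x p v) (A x w)
      = -formBilin (η x) (A x w) (fderiv ℝ A x p v) := by
    simp only [formBilin_apply, form_swap (η x) (A x w)]
  rw [← formBilin_apply, map_sub, sub_apply]
  linarith [hess w (A x v) p, hess w p (A x v), hess v (A x w) p, hess v p (A x w),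
    hsymm w (A x v) p, hsymm v (A x w) p]

end Hamiltonian

end HamiltonianFields

section CommutingFamilies

variable {E V M : Type*} [NormedAddCommGroup E] [NormedSpace ℝ E] [NormedAddCommGroup V]
  [NormedSpace ℝ V] [TopologicalSpace M] [ChartedSpace E M]

/-- The expression in the chart `e` of a family of vector fields on `M` depending linearly on a
parameter in `V`. -/
noncomputable def chartRep (A : (m : M) → V →L[ℝ] TangentSpace 𝓘(ℝ, E) m)
    (e : OpenPartialHomeomorph M E) (x : E) : V →L[ℝ] E :=
  (mfderiv 𝓘(ℝ, E) 𝓘(ℝ, E) e (e.symm x)).comp (A (e.symm x))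

/-- In the chart `e` the fields `m ↦ A m v`, for `v` in `V`, are twice continuously differentiable
and commute. -/
structure IsCommutingInChart (A : (m : M) → V →L[ℝ] TangentSpace 𝓘(ℝ, E) m)
    (e : OpenPartialHomeomorph M E) : Prop where
  mem : e ∈ IsManifold.maximalAtlas 𝓘(ℝ, E) 1 M
  contDiffOn : ContDiffOn ℝ 2 (chartRep A e) e.target
  commute : ∀ x ∈ e.target, ∀ v w, fderiv ℝ (chartRep A e) x (chartRep A e x v) w
    = fderiv ℝ (chartRep A e) x (chartRep A e x w) v

/-- The fields `m ↦ A m v`, for `v` in `V`, are pairwise commuting vector fields on `M`: the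
infinitesimal generators of a local action of the vector group `V`. -/
def IsCommutingFamily (A : (m : M) → V →L[ℝ] TangentSpace 𝓘(ℝ, E) m) : Prop :=
  ∀ m, IsCommutingInChart A (chartAt E m)

/-- On `Z` the map `Φ` is an orbit map `s ↦ s · Φ(0)` of the local action generated by `A`,
expressed by the differential equation `dΦ(s) = A (Φ s)`. -/
def IsOrbitMapOn (A : (m : M) → V →L[ℝ] TangentSpace 𝓘(ℝ, E) m) (Φ : V → M) (Z : Set V) : Prop :=
  ∀ s ∈ Z, HasMFDerivAt 𝓘(ℝ, V) 𝓘(ℝ, E) Φ s (A (Φ s))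

theorem mdifferentiable_of_mem_maximalAtlas {e : OpenPartialHomeomorph M E}
    (he : e ∈ IsManifold.maximalAtlas 𝓘(ℝ, E) 1 M) : e.MDifferentiable 𝓘(ℝ, E) 𝓘(ℝ, E) :=
  ⟨(contMDiffOn_of_mem_maximalAtlas he).mdifferentiableOn one_ne_zero,
    (contMDiffOn_symm_of_mem_maximalAtlas he).mdifferentiableOn one_ne_zero⟩

variable {A : (m : M) → V →L[ℝ] TangentSpace 𝓘(ℝ, E) m} {e : OpenPartialHomeomorph M E}

theorem mfderiv_symm_chartRep (he : e ∈ IsManifold.maximalAtlas 𝓘(ℝ, E) 1 M) {x : E}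
    (hx : x ∈ e.target) (v : V) :
    mfderiv 𝓘(ℝ, E) 𝓘(ℝ, E) e.symm x (chartRep A e x v) = A (e.symm x) v := by
  have h := (mdifferentiable_of_mem_maximalAtlas he).symm_comp_deriv (e.map_target hx)
  rw [e.right_inv hx] at h
  exact congrArg (fun L : E →L[ℝ] E => L (A (e.symm x) v)) h

theorem hasMFDerivAt_symm_comp_of_chartRep (he : e ∈ IsManifold.maximalAtlas 𝓘(ℝ, E) 1 M)
    {Ψ : V → E} {s : V} (hs : Ψ s ∈ e.target) (h : HasFDerivAt Ψ (chartRep A e (Ψ s)) s) :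
    HasMFDerivAt 𝓘(ℝ, V) 𝓘(ℝ, E) (fun s => e.symm (Ψ s)) s (A (e.symm (Ψ s))) := by
  have hsymm := ((mdifferentiable_of_mem_maximalAtlas he).mdifferentiableAt_symm hs).hasMFDerivAt
  exact (hsymm.comp s h.hasMFDerivAt).congr_mfderiv
    (ContinuousLinearMap.ext fun v : V => mfderiv_symm_chartRep he hs v)

theorem hasDerivWithinAt_chart_comp (he : e ∈ IsManifold.maximalAtlas 𝓘(ℝ, E) 1 M) {η : ℝ → M}
    {S : Set ℝ} {t : ℝ} {v : V} (ht : η t ∈ e.source)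
    (h : HasMFDerivWithinAt 𝓘(ℝ, ℝ) 𝓘(ℝ, E) η S t ((1 : ℝ →L[ℝ] ℝ).smulRight (A (η t) v))) :
    HasDerivWithinAt (fun t => e (η t)) (chartRep A e (e (η t)) v) S t := by
  have hmf := ((mdifferentiable_of_mem_maximalAtlas he).mdifferentiableAt ht).hasMFDerivAt
  have hrep : chartRep A e (e (η t)) v = mfderiv 𝓘(ℝ, E) 𝓘(ℝ, E) e (η t) (A (η t) v) := by
    rw [chartRep, e.left_inv ht]
    rfl
  have hf : HasFDerivWithinAt (fun t => e (η t))
      ((1 : ℝ →L[ℝ] ℝ).smulRight (chartRep A e (e (η t)) v)) S t := by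
    refine ((hmf.comp_hasMFDerivWithinAt t h).congr_mfderiv ?_).hasFDerivWithinAt
    refine ContinuousLinearMap.ext fun x : ℝ => ?_
    rw [hrep]
    exact ContinuousLinearMap.map_smul (mfderiv 𝓘(ℝ, E) 𝓘(ℝ, E) e (η t)) x (A (η t) v)
  exact hf.hasDerivWithinAt.congr_deriv (one_smul ℝ _)

namespace IsOrbitMapOn

variable {Φ Φ₁ Φ₂ : V → M} {Z Z₁ Z₂ : Set V}

theorem mono (h : IsOrbitMapOn A Φ Z) (hZ : Z₁ ⊆ Z) : IsOrbitMapOn A Φ Z₁ :=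
  fun s hs => h s (hZ hs)

theorem continuousOn (h : IsOrbitMapOn A Φ Z) : ContinuousOn Φ Z :=
  fun s hs => (h s hs).continuousAt.continuousWithinAt

theorem comp_const_add (h : IsOrbitMapOn A Φ Z) (a : V) :
    IsOrbitMapOn A (fun s => Φ (a + s)) ((a + ·) ⁻¹' Z) := fun s hs =>
  (h _ hs).comp s (f' := ContinuousLinearMap.id ℝ V)
    ((hasFDerivAt_id s).const_add a).hasMFDerivAt

theorem congr (h : IsOrbitMapOn A Φ Z) (hΦ : ∀ s ∈ Z, Φ₁ =ᶠ[𝓝 s] Φ) : IsOrbitMapOn A Φ₁ Z := by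
  intro s hs
  rw [(hΦ s hs).eq_of_nhds]
  exact (h s hs).congr_of_eventuallyEq (hΦ s hs)

theorem isMIntegralCurveOn (h : IsOrbitMapOn A Φ Z) (a v : V) {S : Set ℝ}
    (hS : ∀ t ∈ S, a + t • v ∈ Z) :
    IsMIntegralCurveOn (I := 𝓘(ℝ, E)) (fun t => Φ (a + t • v)) (fun m => A m v) S := by
  intro t ht
  have hline : HasFDerivAt (fun t : ℝ => a + t • v) ((1 : ℝ →L[ℝ] ℝ).smulRight v) t := by
    have := ((hasDerivAt_id t).smul_const v).const_add a
    rw [one_smul] at this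
    exact this.hasFDerivAt
  refine (((h _ (hS t ht)).comp t hline.hasMFDerivAt).hasMFDerivWithinAt (s := S)).congr_mfderiv
    (ContinuousLinearMap.ext fun x => ?_)
  exact ContinuousLinearMap.map_smul _ _ _

end IsOrbitMapOn

theorem isMIntegralCurveOn_comp_mul_Icc {v : V} {η : ℝ → M} {T : ℝ}
    (hη : IsMIntegralCurveOn (I := 𝓘(ℝ, E)) η (fun m => A m v) (uIcc 0 T)) :
    IsMIntegralCurveOn (I := 𝓘(ℝ, E)) (fun t => η (t * T)) (fun m => A m (T • v)) (Icc 0 1) := by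
  have hmem : ∀ t ∈ Icc (0 : ℝ) 1, t * T ∈ uIcc 0 T := fun t ht => by
    rw [← segment_eq_uIcc]
    exact ⟨1 - t, t, by linarith [ht.2], ht.1, by ring, by simp⟩
  intro t ht
  refine (((hη.comp_mul T) t (hmem t ht)).mono hmem).congr_mfderiv
    (ContinuousLinearMap.ext fun x : ℝ => ?_)
  exact congrArg (fun w : E => x • w) (ContinuousLinearMap.map_smul (A (η (t * T))) T v).symm

theorem integralCurves_eqOn_Icc_of_lipschitzOn (he : IsCommutingInChart A e) {v : V}
    {η₁ η₂ : ℝ → M} {a b : ℝ} {K : NNReal} {U : Set E}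
    (hK : LipschitzOnWith K (fun x => chartRep A e x v) U)
    (h₁ : IsMIntegralCurveOn (I := 𝓘(ℝ, E)) η₁ (fun m => A m v) (Icc a b))
    (h₂ : IsMIntegralCurveOn (I := 𝓘(ℝ, E)) η₂ (fun m => A m v) (Icc a b))
    (hU₁ : ∀ t ∈ Icc a b, η₁ t ∈ e.source ∩ e ⁻¹' U)
    (hU₂ : ∀ t ∈ Icc a b, η₂ t ∈ e.source ∩ e ⁻¹' U) (h0 : η₁ a = η₂ a) :
    EqOn η₁ η₂ (Icc a b) := by
  have hderiv : ∀ {η : ℝ → M}, IsMIntegralCurveOn (I := 𝓘(ℝ, E)) η (fun m => A m v) (Icc a b) →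
      (∀ t ∈ Icc a b, η t ∈ e.source ∩ e ⁻¹' U) → ∀ t ∈ Icc a b,
      HasDerivWithinAt (fun t => e (η t)) (chartRep A e (e (η t)) v) (Icc a b) t :=
    fun h hU t ht => hasDerivWithinAt_chart_comp he.mem (hU t ht).1 (h t ht)
  have hright : ∀ {f : ℝ → E} {f' : E} {t : ℝ}, t ∈ Ico a b →
      HasDerivWithinAt f f' (Icc a b) t → HasDerivWithinAt f f' (Ici t) t := fun ht h =>
    h.mono_of_mem_nhdsWithin
      (Filter.mem_of_superset (Icc_mem_nhdsGE ht.2) (Icc_subset_Icc_left ht.1))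
  have heq := ODE_solution_unique_of_mem_Icc_right (v := fun _ x => chartRep A e x v)
    (s := fun _ => U) (K := K) (f := fun t => e (η₁ t)) (g := fun t => e (η₂ t))
    (fun _ _ => hK) (fun t ht => (hderiv h₁ hU₁ t ht).continuousWithinAt)
    (fun t ht => hright ht (hderiv h₁ hU₁ t (Ico_subset_Icc_self ht)))
    (fun t ht => (hU₁ t (Ico_subset_Icc_self ht)).2)
    (fun t ht => (hderiv h₂ hU₂ t ht).continuousWithinAt)
    (fun t ht => hright ht (hderiv h₂ hU₂ t (Ico_subset_Icc_self ht)))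
    (fun t ht => (hU₂ t (Ico_subset_Icc_self ht)).2) (by rw [h0])
  exact fun t ht => e.injOn (hU₁ t ht).1 (hU₂ t ht).1 (heq ht)

namespace IsCommutingFamily

theorem exists_eqOn_Icc (hA : IsCommutingFamily A) {v : V} {η₁ η₂ : ℝ → M} {a b : ℝ}
    (hab : a < b) (h₁ : IsMIntegralCurveOn (I := 𝓘(ℝ, E)) η₁ (fun m => A m v) (Icc a b))
    (h₂ : IsMIntegralCurveOn (I := 𝓘(ℝ, E)) η₂ (fun m => A m v) (Icc a b)) (h0 : η₁ a = η₂ a) :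
    ∃ c > a, EqOn η₁ η₂ (Icc a c) := by
  set e := chartAt E (η₁ a)
  have he : IsCommutingInChart A e := hA _
  have ha : η₁ a ∈ e.source := mem_chart_source _ _
  obtain ⟨K, U, hU, hK⟩ := ((he.contDiffOn.contDiffAt
    (e.open_target.mem_nhds (e.map_source ha))).of_le (by norm_num : (1 : WithTop ℕ∞) ≤ 2)
      |>.clm_apply (contDiffAt_const (c := v))).exists_lipschitzOnWith
  have hnear : ∀ {η : ℝ → M}, ContinuousOn η (Icc a b) → η a = η₁ a →
      ∀ᶠ t in 𝓝[≥] a, η t ∈ e.source ∩ e ⁻¹' U := by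
    intro η hη hηa
    have hc : ContinuousWithinAt η (Ici a) a :=
      (hη a (left_mem_Icc.2 hab.le)).mono_of_mem_nhdsWithin (Icc_mem_nhdsGE hab)
    rw [ContinuousWithinAt, hηa] at hc
    exact hc (Filter.inter_mem (e.open_source.mem_nhds ha) (e.continuousAt ha hU))
  obtain ⟨c, hc, hsub⟩ := mem_nhdsGE_iff_exists_Icc_subset.1 (Filter.inter_mem
    (Icc_mem_nhdsGE hab) ((hnear h₁.continuousOn rfl).and (hnear h₂.continuousOn h0.symm)))
  have hcb : Icc a c ⊆ Icc a b := fun t ht => (hsub ht).1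
  exact ⟨c, hc, integralCurves_eqOn_Icc_of_lipschitzOn he hK (h₁.mono hcb) (h₂.mono hcb)
    (fun t ht => (hsub ht).2.1) (fun t ht => (hsub ht).2.2) h0⟩

theorem exists_isOrbitMapOn_ball [FiniteDimensional ℝ E] [FiniteDimensional ℝ V]
    (hA : IsCommutingFamily A) (p : M) :
    ∃ ε > 0, ∃ Φ : V → M, Φ 0 = p ∧ IsOrbitMapOn A Φ (Metric.ball 0 ε) := by
  set e := chartAt E p
  have he : IsCommutingInChart A e := hA p
  have hp : p ∈ e.source := mem_chart_source _ p
  have htarget := e.open_target.mem_nhds (e.map_source hp)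
  set κ := ‖chartRep A e (e p)‖ + 1
  have hκ : 0 ≤ κ := by positivity
  obtain ⟨R, hR, hball⟩ := Metric.mem_nhds_iff.1 (Filter.inter_mem htarget
    ((he.contDiffOn.continuousOn.continuousAt htarget).norm.eventually_lt_const
      (lt_add_one ‖chartRep A e (e p)‖)))
  obtain ⟨ρ, hρ, hρR⟩ : ∃ ρ > 0, Real.exp (κ * ρ) < 1 + R := by
    have hcont : ContinuousAt (fun ρ => Real.exp (κ * ρ)) 0 := by fun_prop
    have hev : ∀ᶠ ρ in 𝓝 (0 : ℝ), Real.exp (κ * ρ) < 1 + R :=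
      hcont.eventually_lt_const (by simpa using hR)
    obtain ⟨ρ, hlt, hpos⟩ := ((hev.filter_mono nhdsWithin_le_nhds).and
      (self_mem_nhdsWithin : Ioi (0 : ℝ) ∈ 𝓝[>] 0)).exists
    exact ⟨ρ, hpos, hlt⟩
  obtain ⟨Ψ, hΨ0, hΨ⟩ := exists_timeOne_of_commuting (A := chartRep A e) (c := e p)
    (x₀ := e p) (R := R) (α := 1) hκ zero_le_one (he.contDiffOn.mono fun x hx => (hball hx).1)
    (fun x hx => he.commute x (hball hx).1)
    (fun x hx => (hball hx).2.le.trans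
      (le_mul_of_one_le_right hκ (le_add_of_nonneg_right (norm_nonneg _)))) hρ
    (by simpa using hρR)
  exact ⟨ρ, hρ, fun s => e.symm (Ψ s), by simp [hΨ0, e.left_inv hp], fun s hs =>
    hasMFDerivAt_symm_comp_of_chartRep he.mem (hball (hΨ s hs).1).1 (hΨ s hs).2⟩

variable [T2Space M]

theorem eqOn_Icc (hA : IsCommutingFamily A) {v : V} {η₁ η₂ : ℝ → M} {a b : ℝ}
    (h₁ : IsMIntegralCurveOn (I := 𝓘(ℝ, E)) η₁ (fun m => A m v) (Icc a b))
    (h₂ : IsMIntegralCurveOn (I := 𝓘(ℝ, E)) η₂ (fun m => A m v) (Icc a b)) (h0 : η₁ a = η₂ a) :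
    EqOn η₁ η₂ (Icc a b) := by
  have hclosed : IsClosed ({t | η₁ t = η₂ t} ∩ Icc a b) := by
    have := (h₁.continuousOn.prodMk h₂.continuousOn).preimage_isClosed_of_isClosed isClosed_Icc
      (isClosed_diagonal (X := M))
    rwa [inter_comm] at this
  refine hclosed.Icc_subset_of_forall_mem_nhdsWithin h0 fun t ⟨hteq, ht⟩ => ?_
  have hsub : Icc t b ⊆ Icc a b := Icc_subset_Icc_left ht.1
  obtain ⟨c, hc, heq⟩ := hA.exists_eqOn_Icc ht.2 (h₁.mono hsub) (h₂.mono hsub) hteq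
  filter_upwards [Ioc_mem_nhdsGT hc] with s hs using heq (Ioc_subset_Icc_self hs)

end IsCommutingFamily

namespace IsOrbitMapOn

variable [T2Space M] {Φ Φ₁ Φ₂ : V → M} {Z Z₁ Z₂ : Set V}

theorem eqOn (hA : IsCommutingFamily A) (hZ : Convex ℝ Z) (h₁ : IsOrbitMapOn A Φ₁ Z)
    (h₂ : IsOrbitMapOn A Φ₂ Z) {a : V} (ha : a ∈ Z) (h : Φ₁ a = Φ₂ a) : EqOn Φ₁ Φ₂ Z := by
  intro s hs
  have hS : ∀ t ∈ Icc (0 : ℝ) 1, a + t • (s - a) ∈ Z := fun t ht =>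
    hZ.add_smul_sub_mem ha hs ht
  simpa using hA.eqOn_Icc (h₁.isMIntegralCurveOn a (s - a) hS)
    (h₂.isMIntegralCurveOn a (s - a) hS) (by simpa using h) (right_mem_Icc.2 zero_le_one)

theorem eq_of_eq_translate (hA : IsCommutingFamily A) (hZ₁ : Convex ℝ Z₁)
    (h₁ : IsOrbitMapOn A Φ₁ Z₁) (hZ₂ : Convex ℝ Z₂) (h₂ : IsOrbitMapOn A Φ₂ Z₂) {a x y : V}
    (hx₁ : x ∈ Z₁) (hx₂ : a + x ∈ Z₂) (hx : Φ₁ x = Φ₂ (a + x)) (hy₁ : y ∈ Z₁)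
    (hy₂ : a + y ∈ Z₂) : Φ₁ y = Φ₂ (a + y) :=
  eqOn hA (hZ₁.inter (hZ₂.translate_preimage_right a)) (h₁.mono inter_subset_left)
    ((h₂.comp_const_add a).mono inter_subset_right) ⟨hx₁, hx₂⟩ hx ⟨hy₁, hy₂⟩

theorem eq_integralCurve (hA : IsCommutingFamily A) (hZ : Convex ℝ Z) (h : IsOrbitMapOn A Φ Z)
    {a v : V} {T : ℝ} {η : ℝ → M}
    (hη : IsMIntegralCurveOn (I := 𝓘(ℝ, E)) η (fun m => A m v) (uIcc 0 T)) (h0 : η 0 = Φ a)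
    (ha : a ∈ Z) (hT : a + T • v ∈ Z) : η T = Φ (a + T • v) := by
  have hS : ∀ t ∈ Icc (0 : ℝ) 1, a + t • (T • v) ∈ Z := fun t ht => by
    simpa using hZ.add_smul_sub_mem ha hT ht
  simpa using hA.eqOn_Icc (isMIntegralCurveOn_comp_mul_Icc hη)
    (h.isMIntegralCurveOn a (T • v) hS) (by simpa using h0) (right_mem_Icc.2 zero_le_one)

end IsOrbitMapOn

end CommutingFamilies

section OrbitCharts

variable {E V W : Type*} [NormedAddCommGroup E] [NormedSpace ℝ E] [NormedAddCommGroup V]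
  [NormedSpace ℝ V] [NormedAddCommGroup W] [NormedSpace ℝ W]

variable {M : Type*} [TopologicalSpace M] [ChartedSpace E M]
  {A : (m : M) → V →L[ℝ] TangentSpace 𝓘(ℝ, E) m} {G : M → W}

/-- `G` is a vector-valued first integral of the fields of the family `A`. -/
structure IsFirstIntegral (A : (m : M) → V →L[ℝ] TangentSpace 𝓘(ℝ, E) m) (G : M → W) :
    Prop where
  contMDiff : ContMDiff 𝓘(ℝ, E) 𝓘(ℝ, W) 1 G
  mfderiv_apply : ∀ m v, mfderiv 𝓘(ℝ, E) 𝓘(ℝ, W) G m (A m v) = (0 : W)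

/-- The part of the level set `G = c` of a first integral on which `G` is submersive and the fields
of the family are linearly independent. -/
def regularLevel (A : (m : M) → V →L[ℝ] TangentSpace 𝓘(ℝ, E) m) (G : M → W) (c : W) : Set M :=
  {m | G m = c ∧ Function.Injective (A m) ∧
    Function.Surjective (mfderiv 𝓘(ℝ, E) 𝓘(ℝ, W) G m)}

/-- On the ball of radius `ε` the map `Φ` is an orbit map through `p`, and near `p` the function `T`
is of class `C¹` and inverts it on the level set `G = c`. -/
structure IsOrbitChart (A : (m : M) → V →L[ℝ] TangentSpace 𝓘(ℝ, E) m) (G : M → W) (c : W) (p : M)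
    (ε : ℝ) (Φ : V → M) (T : M → V) : Prop where
  pos : 0 < ε
  map_zero : Φ 0 = p
  isOrbitMapOn : IsOrbitMapOn A Φ (Metric.ball 0 ε)
  inverse_self : T p = 0
  contMDiffAt : ∀ᶠ q in 𝓝 p, ContMDiffAt 𝓘(ℝ, E) 𝓘(ℝ, V) 1 T q
  map_inverse : ∀ᶠ q in 𝓝 p, G q = c → T q ∈ Metric.ball 0 ε ∧ Φ (T q) = q

theorem IsFirstIntegral.mdifferentiableAt (hG : IsFirstIntegral A G) (m : M) :
    MDifferentiableAt 𝓘(ℝ, E) 𝓘(ℝ, W) G m :=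
  hG.contMDiff.mdifferentiableAt one_ne_zero

namespace IsOrbitMapOn

variable {Φ : V → M} {Z : Set V}

theorem firstIntegral_eq (h : IsOrbitMapOn A Φ Z) (hG : IsFirstIntegral A G) (hZ : Convex ℝ Z)
    {s t : V} (hs : s ∈ Z) (ht : t ∈ Z) : G (Φ s) = G (Φ t) := by
  have hderiv : ∀ s ∈ Z, HasFDerivWithinAt (fun s => G (Φ s)) (0 : V →L[ℝ] W) Z s :=
    fun s hs => (((hG.mdifferentiableAt (Φ s)).hasMFDerivAt.comp s (h s hs)).congr_mfderiv
      (f₁' := (0 : V →L[ℝ] W)) (ContinuousLinearMap.ext fun v =>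
        hG.mfderiv_apply (Φ s) v)).hasFDerivAt.hasFDerivWithinAt
  have := hZ.norm_image_sub_le_of_norm_hasFDerivWithin_le hderiv (C := 0) (by simp) ht hs
  simpa [sub_eq_zero] using this

variable {e : OpenPartialHomeomorph M E}

theorem hasFDerivAt_chart_comp (h : IsOrbitMapOn A Φ Z)
    (he : e ∈ IsManifold.maximalAtlas 𝓘(ℝ, E) 1 M) {s : V} (hs : s ∈ Z) (hse : Φ s ∈ e.source) :
    HasFDerivAt (fun s => e (Φ s)) (chartRep A e (e (Φ s))) s := by
  have hrep : chartRep A e (e (Φ s)) = (mfderiv 𝓘(ℝ, E) 𝓘(ℝ, E) e (Φ s)).comp (A (Φ s)) := by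
    rw [chartRep, e.left_inv hse]
  rw [hrep]
  exact (((mdifferentiable_of_mem_maximalAtlas he).mdifferentiableAt hse).hasMFDerivAt.comp s
    (h s hs)).hasFDerivAt

theorem contDiffAt_chart_comp (h : IsOrbitMapOn A Φ Z) (he : IsCommutingInChart A e) {s : V}
    (hZ : Z ∈ 𝓝 s) (hse : Φ s ∈ e.source) : ContDiffAt ℝ 1 (fun s => e (Φ s)) s := by
  have hnear : ∀ᶠ t in 𝓝 s, t ∈ Z ∧ Φ t ∈ e.source := Filter.Eventually.and hZ
    ((h s (mem_of_mem_nhds hZ)).continuousAt.eventually_mem (e.open_source.mem_nhds hse))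
  refine contDiffAt_one_iff.2 ⟨fun s => chartRep A e (e (Φ s)), _, hnear, fun t ht => ?_,
    fun t ht => h.hasFDerivAt_chart_comp he.mem ht.1 ht.2⟩
  exact (ContinuousAt.comp (f := fun s => e (Φ s)) (he.contDiffOn.continuousOn.continuousAt
    (e.open_target.mem_nhds (e.map_source ht.2)))
    (h.hasFDerivAt_chart_comp he.mem ht.1 ht.2).continuousAt).continuousWithinAt

end IsOrbitMapOn

theorem IsFirstIntegral.contDiffAt_comp_symm (hG : IsFirstIntegral A G)
    {e : OpenPartialHomeomorph M E} (he : e ∈ IsManifold.maximalAtlas 𝓘(ℝ, E) 1 M) {x : E}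
    (hx : x ∈ e.target) : ContDiffAt ℝ 1 (fun x => G (e.symm x)) x :=
  (hG.contMDiff.contMDiffAt.comp x (contMDiffAt_symm_of_mem_maximalAtlas he hx)).contDiffAt

theorem IsFirstIntegral.exists_hasFDerivAt_comp_symm (hG : IsFirstIntegral A G)
    {e : OpenPartialHomeomorph M E} (he : e ∈ IsManifold.maximalAtlas 𝓘(ℝ, E) 1 M) {m : M}
    (hm : m ∈ e.source) (hsurj : Function.Surjective (mfderiv 𝓘(ℝ, E) 𝓘(ℝ, W) G m)) :
    ∃ D : E →L[ℝ] W, HasFDerivAt (fun x => G (e.symm x)) D (e m) ∧ Function.Surjective D := by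
  have hd := mdifferentiable_of_mem_maximalAtlas he
  refine ⟨(mfderiv 𝓘(ℝ, E) 𝓘(ℝ, W) G m).comp (mfderiv 𝓘(ℝ, E) 𝓘(ℝ, E) e.symm (e m)), ?_,
    hsurj.comp (hd.symm.mfderiv_surjective (x := e m) (e.map_source hm))⟩
  have hcomp := (hG.mdifferentiableAt (e.symm (e m))).hasMFDerivAt.comp (e m)
    (hd.mdifferentiableAt_symm (e.map_source hm)).hasMFDerivAt
  rw [e.left_inv hm] at hcomp
  exact hcomp.hasFDerivAt

variable [FiniteDimensional ℝ E]

theorem range_eq_ker_of_finrank_eq_add [FiniteDimensional ℝ W]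
    (hdim : Module.finrank ℝ E = Module.finrank ℝ V + Module.finrank ℝ W) {D : E →L[ℝ] W}
    {A : V →L[ℝ] E} (hD : Function.Surjective D) (hA : Function.Injective A)
    (hDA : ∀ v, D (A v) = 0) : LinearMap.range A.toLinearMap = LinearMap.ker D.toLinearMap := by
  refine Submodule.eq_of_le_of_finrank_eq ?_ ?_
  · rintro _ ⟨v, rfl⟩
    exact hDA v
  · have hrank := D.toLinearMap.finrank_range_add_finrank_ker
    rw [LinearMap.range_eq_top.2 hD, finrank_top] at hrank
    rw [LinearMap.finrank_range_of_inj hA]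
    omega

variable [FiniteDimensional ℝ V]

theorem exists_equiv_prod_of_finrank_eq_add [FiniteDimensional ℝ W]
    (hdim : Module.finrank ℝ E = Module.finrank ℝ V + Module.finrank ℝ W) {D : E →L[ℝ] W}
    {A : V →L[ℝ] E} {P : E →L[ℝ] V} (hD : Function.Surjective D) (hP : ∀ v, P (A v) = v)
    (hDA : ∀ v, D (A v) = 0) : ∃ L : E ≃L[ℝ] W × V, (L : E →L[ℝ] W × V) = D.prod P := by
  have hinj : Function.Injective (D.prod P).toLinearMap := by
    rw [← LinearMap.ker_eq_bot, LinearMap.ker_eq_bot']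
    intro x hx
    obtain ⟨hDx, hPx⟩ : D x = 0 ∧ P x = 0 := Prod.mk.inj hx
    obtain ⟨v, rfl⟩ : x ∈ LinearMap.range A.toLinearMap := by
      rw [range_eq_ker_of_finrank_eq_add hdim hD (Function.LeftInverse.injective hP) hDA]
      exact hDx
    rw [show v = 0 from (hP v).symm.trans hPx]
    exact map_zero _
  exact ⟨(LinearEquiv.ofInjectiveOfFinrankEq _ hinj
    (by rw [hdim, Module.finrank_prod, add_comm])).toContinuousLinearEquiv, rfl⟩

theorem exists_leftInverse_eventually_rightInverse {f : V → V} {a : V} (hf : ContDiffAt ℝ 1 f a)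
    (hf' : HasFDerivAt f (ContinuousLinearMap.id ℝ V) a) :
    ∃ g : V → V, ContDiffAt ℝ 1 g (f a) ∧ g (f a) = a ∧ ∀ᶠ y in 𝓝 (f a), f (g y) = y := by
  have hid : HasFDerivAt f (ContinuousLinearEquiv.refl ℝ V : V →L[ℝ] V) a := hf'
  exact ⟨hf.localInverse hid one_ne_zero, hf.to_localInverse hid one_ne_zero,
    hf.localInverse_apply_image hid one_ne_zero,
    (hf.hasStrictFDerivAt' hid one_ne_zero).eventually_right_inverse⟩

/-- Let `P` be a linear left inverse of `dΨ(0)`. Then `T = (P ∘ Ψ)⁻¹ ∘ P` works because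
`(G, P)` is injective near `x₀`. -/
theorem exists_leftInverse_on_level [FiniteDimensional ℝ W]
    (hdim : Module.finrank ℝ E = Module.finrank ℝ V + Module.finrank ℝ W) {Ψ : V → E}
    {G : E → W} {A : V →L[ℝ] E} {D : E →L[ℝ] W} (hΨ : ContDiffAt ℝ 1 Ψ 0)
    (hΨ' : HasFDerivAt Ψ A 0) (hA : Function.Injective A) (hG : ContDiffAt ℝ 1 G (Ψ 0))
    (hG' : HasFDerivAt G D (Ψ 0)) (hD : Function.Surjective D)
    (hconst : ∀ᶠ s in 𝓝 0, G (Ψ s) = G (Ψ 0)) :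
    ∃ T : E → V, ContDiffAt ℝ 1 T (Ψ 0) ∧ T (Ψ 0) = 0 ∧
      ∀ᶠ x in 𝓝 (Ψ 0), G x = G (Ψ 0) → Ψ (T x) = x := by
  obtain ⟨P₀, hP₀⟩ := A.toLinearMap.exists_leftInverse_of_injective (LinearMap.ker_eq_bot.2 hA)
  set P : E →L[ℝ] V := LinearMap.toContinuousLinearMap P₀
  have hP : ∀ v, P (A v) = v := fun v => LinearMap.congr_fun hP₀ v
  have hDA : ∀ v, D (A v) = 0 := fun v => by
    have h := (hG'.comp 0 hΨ').unique
      ((hasFDerivAt_const (G (Ψ 0)) (0 : V)).congr_of_eventuallyEq hconst)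
    exact congrArg (fun L : V →L[ℝ] W => L v) h
  obtain ⟨g, hg, hg0, hright⟩ := exists_leftInverse_eventually_rightInverse
    (f := fun s => P (Ψ s)) (P.contDiff.contDiffAt.comp 0 hΨ)
    ((P.hasFDerivAt.comp (0 : V) hΨ').congr_fderiv (ContinuousLinearMap.ext hP))
  have hT : ContDiffAt ℝ 1 (fun x => g (P x)) (Ψ 0) := hg.comp (Ψ 0) P.contDiff.contDiffAt
  obtain ⟨L, hL⟩ := exists_equiv_prod_of_finrank_eq_add hdim hD hP hDA
  have hGP : HasFDerivAt (fun x => (G x, P x)) (L : E →L[ℝ] W × V) (Ψ 0) := by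
    rw [hL]
    exact hG'.prodMk P.hasFDerivAt
  have hleft := ((hG.prodMk P.contDiff.contDiffAt).hasStrictFDerivAt' hGP
    one_ne_zero).eventually_left_inverse
  have hT0 : Filter.Tendsto (fun x => g (P x)) (𝓝 (Ψ 0)) (𝓝 0) := by
    simpa only [hg0] using hT.continuousAt.tendsto
  refine ⟨fun x => g (P x), hT, hg0, ?_⟩
  filter_upwards [hleft, (hΨ.continuousAt.tendsto.comp hT0).eventually hleft,
    hT0.eventually hconst, P.continuous.continuousAt.eventually hright]
    with x hx hΨx hGx hPx hlevel
  have hGP_eq : (G (Ψ (g (P x))), P (Ψ (g (P x)))) = (G x, P x) :=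
    Prod.ext (hGx.trans hlevel.symm) hPx
  exact hΨx.symm.trans ((congrArg _ hGP_eq).trans hx)

theorem IsCommutingFamily.exists_orbitChart [FiniteDimensional ℝ W] [IsManifold 𝓘(ℝ, E) 1 M]
    (hA : IsCommutingFamily A) (hG : IsFirstIntegral A G)
    (hdim : Module.finrank ℝ E = Module.finrank ℝ V + Module.finrank ℝ W) {c : W} {p : M}
    (hp : p ∈ regularLevel A G c) :
    ∃ (ε : ℝ) (Φ : V → M) (T : M → V), IsOrbitChart A G c p ε Φ T := by
  obtain ⟨hpc, hinj, hsurj⟩ := hp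
  obtain ⟨ε, hε, Φ, rfl, hΦ⟩ := hA.exists_isOrbitMapOn_ball p
  set e := chartAt E (Φ 0)
  have he : IsCommutingInChart A e := hA _
  have hsrc : Φ 0 ∈ e.source := mem_chart_source _ _
  have hball : Metric.ball (0 : V) ε ∈ 𝓝 0 := Metric.ball_mem_nhds 0 hε
  have h0 : (0 : V) ∈ Metric.ball 0 ε := mem_of_mem_nhds hball
  have hnear : ∀ᶠ s in 𝓝 (0 : V), s ∈ Metric.ball 0 ε ∧ Φ s ∈ e.source :=
    Filter.Eventually.and hball
      ((hΦ 0 h0).continuousAt.eventually_mem (e.open_source.mem_nhds hsrc))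
  have hrepinj : Function.Injective (chartRep A e (e (Φ 0))) := fun v w h => hinj <| by
    have h' := congrArg (mfderiv 𝓘(ℝ, E) 𝓘(ℝ, E) e.symm (e (Φ 0))) h
    rwa [mfderiv_symm_chartRep he.mem (e.map_source hsrc),
      mfderiv_symm_chartRep he.mem (e.map_source hsrc), e.left_inv hsrc] at h'
  obtain ⟨D, hD, hDsurj⟩ := hG.exists_hasFDerivAt_comp_symm he.mem hsrc hsurj
  obtain ⟨T, hT, hT0, hleft⟩ := exists_leftInverse_on_level (Ψ := fun s => e (Φ s))
    (G := fun x => G (e.symm x)) hdim (hΦ.contDiffAt_chart_comp he hball hsrc)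
    (hΦ.hasFDerivAt_chart_comp he.mem h0 hsrc) hrepinj
    (hG.contDiffAt_comp_symm he.mem (e.map_source hsrc)) hD hDsurj (by
      filter_upwards [hnear] with s hs
      rw [e.left_inv hs.2, e.left_inv hsrc, hΦ.firstIntegral_eq hG (convex_ball _ _) hs.1 h0])
  have hTe : ContMDiffAt 𝓘(ℝ, E) 𝓘(ℝ, V) 1 (fun q => T (e q)) (Φ 0) :=
    hT.contMDiffAt.comp (Φ 0) (contMDiffAt_of_mem_maximalAtlas he.mem hsrc)
  have hT_tendsto : Filter.Tendsto (fun q => T (e q)) (𝓝 (Φ 0)) (𝓝 0) := by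
    simpa only [hT0] using hTe.continuousAt.tendsto
  refine ⟨ε, Φ, fun q => T (e q), hε, rfl, hΦ, hT0,
    (contMDiffAt_iff_contMDiffAt_nhds (by simp)).1 hTe, ?_⟩
  filter_upwards [(e.continuousAt hsrc).eventually hleft, hT_tendsto.eventually hnear,
    e.open_source.mem_nhds hsrc] with q hq hTq hqe hGq
  rw [e.left_inv hsrc, e.left_inv hqe, hpc] at hq
  exact ⟨hTq.1, e.injOn hTq.2 hqe (hq hGq)⟩

end OrbitCharts

section Developments

variable {E V W M : Type*} [NormedAddCommGroup E] [NormedSpace ℝ E] [NormedAddCommGroup V]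
  [NormedSpace ℝ V] [TopologicalSpace M] [ChartedSpace E M]
  {A : (m : M) → V →L[ℝ] TangentSpace 𝓘(ℝ, E) m} {γ : ℝ → M}

/-- On `S` the curve `γ` runs in an orbit of the local action generated by `A`, and `σ` records its
displacement: `γ(t)` is obtained from `γ(t₀)` by acting with `σ(t) - σ(t₀)` for `t` near `t₀`. -/
def IsDevelopmentOn (A : (m : M) → V →L[ℝ] TangentSpace 𝓘(ℝ, E) m) (γ : ℝ → M) (σ : ℝ → V)
    (S : Set ℝ) : Prop :=
  ∀ t₀ ∈ S, ∃ ε > 0, ∃ Φ : V → M, Φ 0 = γ t₀ ∧ IsOrbitMapOn A Φ (Metric.ball 0 ε) ∧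
    ∀ᶠ t in 𝓝[S] t₀, σ t - σ t₀ ∈ Metric.ball 0 ε ∧ Φ (σ t - σ t₀) = γ t

namespace IsDevelopmentOn

variable [T2Space M] {σ : ℝ → V} {S : Set ℝ} {Φ : V → M} {Z : Set V} {c : V}

theorem eq_orbitMap (h : IsDevelopmentOn A γ σ S) (hA : IsCommutingFamily A)
    (hS : IsPreconnected S) (hZ : Convex ℝ Z) (hΦ : IsOrbitMapOn A Φ Z)
    (hσ : ∀ t ∈ S, c + σ t ∈ Z) {t₁ t : ℝ} (ht₁ : t₁ ∈ S) (h₁ : γ t₁ = Φ (c + σ t₁))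
    (ht : t ∈ S) : γ t = Φ (c + σ t) := by
  have key : (γ t₁ = Φ (c + σ t₁)) ↔ (γ t = Φ (c + σ t)) := by
    refine hS.induction₂ (fun s t => (γ s = Φ (c + σ s)) ↔ (γ t = Φ (c + σ t))) (fun s hs => ?_)
      (fun _ _ _ _ _ _ h h' => h.trans h') (fun _ _ _ _ h => h.symm) ht₁ ht
    obtain ⟨ε, hε, Φ₀, hΦ₀s, hΦ₀, hnear⟩ := h s hs
    filter_upwards [hnear, self_mem_nhdsWithin] with t ⟨htε, htγ⟩ ht
    have h0 : (0 : V) ∈ Metric.ball 0 ε := Metric.mem_ball_self hε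
    have hs0 : c + σ s + 0 ∈ Z := by rw [add_zero]; exact hσ s hs
    have hadd : c + σ s + (σ t - σ s) = c + σ t := by abel
    have hts : c + σ s + (σ t - σ s) ∈ Z := by rw [hadd]; exact hσ t ht
    rw [← hΦ₀s, ← htγ, ← hadd, ← add_zero (c + σ s), add_assoc (c + σ s), zero_add]
    exact ⟨fun h => hΦ₀.eq_of_eq_translate hA (convex_ball _ _) hZ hΦ h0 hs0 h htε hts,
      fun h => hΦ₀.eq_of_eq_translate hA (convex_ball _ _) hZ hΦ htε hts h h0 hs0⟩
  exact key.1 h₁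

theorem orbitMap_period {a b ρ : ℝ} (h : IsDevelopmentOn A γ σ (Icc a b))
    (hA : IsCommutingFamily A) (hclosed : γ a = γ b) (hΦ : IsOrbitMapOn A Φ (Metric.ball 0 ρ))
    (hσ : ∀ s ∈ Icc a b, ∀ t ∈ Icc a b, σ t - σ s ∈ Metric.ball 0 ρ) {t₁ : ℝ}
    (ht₁ : t₁ ∈ Icc a b) (h0 : Φ 0 = γ t₁) : Φ (σ b - σ a) = Φ 0 := by
  have ha : a ∈ Icc a b := left_mem_Icc.2 (ht₁.1.trans ht₁.2)
  have hb : b ∈ Icc a b := right_mem_Icc.2 (ht₁.1.trans ht₁.2)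
  have hσ₁ : ∀ t ∈ Icc a b, -σ t₁ + σ t ∈ Metric.ball 0 ρ := fun t ht => by
    rw [neg_add_eq_sub]
    exact hσ t₁ ht₁ t ht
  have hγ : ∀ t ∈ Icc a b, γ t = Φ (-σ t₁ + σ t) := fun t ht =>
    h.eq_orbitMap hA isPreconnected_Icc (convex_ball _ _) hΦ hσ₁ ht₁ (by simp [h0]) ht
  have hshift : σ b - σ a + (-σ t₁ + σ a) = -σ t₁ + σ b := by abel
  have hperiod := hΦ.eq_of_eq_translate hA (convex_ball _ _) (convex_ball _ _) hΦ (hσ₁ a ha)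
    (hshift ▸ hσ₁ b hb) (by rw [hshift, ← hγ a ha, ← hγ b hb, hclosed])
    (y := 0) (by simpa using hσ a ha a ha) (by simpa using hσ a ha b hb)
  simpa using hperiod.symm

end IsDevelopmentOn

/-- The components `θ(γ̇)` of the velocity of a curve with respect to a vector-valued 1-form. -/
noncomputable def frameSpeed (θ : (m : M) → TangentSpace 𝓘(ℝ, E) m →ₗ[ℝ] V) (γ : ℝ → M) (t : ℝ) :
    V :=
  θ (γ t) (mfderiv 𝓘(ℝ, ℝ) 𝓘(ℝ, E) γ t (1 : ℝ))

variable {θ : (m : M) → TangentSpace 𝓘(ℝ, E) m →ₗ[ℝ] V} {Φ : V → M} {Z : Set V}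

theorem IsOrbitMapOn.frameSpeed_eq (hΦ : IsOrbitMapOn A Φ Z) {τ : ℝ → V} {τ' : V} {t : ℝ}
    (hτ : HasDerivAt τ τ' t) (ht : τ t ∈ Z) (hγ : γ =ᶠ[𝓝 t] fun t => Φ (τ t))
    (hθ : ∀ v, θ (γ t) (A (γ t) v) = v) : frameSpeed θ γ t = τ' := by
  have hmf := ((hΦ _ ht).comp t hτ.hasFDerivAt.hasMFDerivAt).congr_of_eventuallyEq hγ
  have hvel : mfderiv 𝓘(ℝ, ℝ) 𝓘(ℝ, E) γ t (1 : ℝ) = (A (Φ (τ t)) τ' : E) := by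
    rw [hmf.mfderiv]
    exact congrArg (A (Φ (τ t))) (one_smul ℝ τ')
  rw [frameSpeed, hvel, ← show γ t = Φ (τ t) from hγ.eq_of_nhds]
  exact hθ τ'

theorem IsOrbitMapOn.integral_frameSpeed [CompleteSpace V] (hΦ : IsOrbitMapOn A Φ Z) {a b : ℝ}
    {τ : ℝ → V} (hτ : ContDiffOn ℝ 1 τ (Icc a b)) (hτZ : ∀ t ∈ Icc a b, τ t ∈ Z)
    (hγ : ∀ t ∈ Icc a b, Φ (τ t) = γ t) (hθ : ∀ t ∈ Icc a b, ∀ v, θ (γ t) (A (γ t) v) = v) :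
    MeasureTheory.IntegrableOn (frameSpeed θ γ) (Icc a b) ∧
      ∀ s ∈ Icc a b, ∀ t ∈ Icc a b, ∫ x in s..t, frameSpeed θ γ x = τ t - τ s := by
  have hderiv : ∀ t ∈ Ioo a b, HasDerivAt τ (derivWithin τ (Icc a b) t) t := fun t ht =>
    ((hτ.differentiableOn one_ne_zero t (Ioo_subset_Icc_self ht)).hasDerivWithinAt).hasDerivAt
      (Icc_mem_nhds ht.1 ht.2)
  have hspeed : ∀ t ∈ Ioo a b, frameSpeed θ γ t = derivWithin τ (Icc a b) t := fun t ht =>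
    hΦ.frameSpeed_eq (hderiv t ht) (hτZ t (Ioo_subset_Icc_self ht))
      (by filter_upwards [Icc_mem_nhds ht.1 ht.2] with s hs using (hγ s hs).symm)
      (hθ t (Ioo_subset_Icc_self ht))
  have hint : MeasureTheory.IntegrableOn (frameSpeed θ γ) (Icc a b) := by
    rcases lt_or_ge a b with hab | hba
    · rw [integrableOn_Icc_iff_integrableOn_Ioo]
      exact ((hτ.continuousOn_derivWithin (uniqueDiffOn_Icc hab) le_rfl).integrableOn_Icc.mono_set
        Ioo_subset_Icc_self).congr_fun (fun t ht => (hspeed t ht).symm) measurableSet_Ioo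
    · rw [integrableOn_Icc_iff_integrableOn_Ioo, Ioo_eq_empty hba.not_gt]
      exact MeasureTheory.integrableOn_empty
  have hle : ∀ s ∈ Icc a b, ∀ t ∈ Icc a b, s ≤ t →
      ∫ x in s..t, frameSpeed θ γ x = τ t - τ s := by
    intro s hs t ht hst
    have hsub : Icc s t ⊆ Icc a b := Icc_subset_Icc hs.1 ht.2
    refine intervalIntegral.integral_eq_sub_of_hasDerivAt_of_le hst (hτ.continuousOn.mono hsub)
      (fun x hx => ?_) ((hint.mono_set (by rwa [uIcc_of_le hst])).intervalIntegrable)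
    have hx' : x ∈ Ioo a b := ⟨hs.1.trans_lt hx.1, hx.2.trans_le ht.2⟩
    rw [hspeed x hx']
    exact hderiv x hx'
  refine ⟨hint, fun s hs t ht => (le_total s t).elim (hle s hs t ht) fun hts => ?_⟩
  rw [intervalIntegral.integral_symm, hle t ht s hs hts, neg_sub]

theorem exists_Icc_mem_nhdsWithin_Icc {a b t : ℝ} {s : Set ℝ} (ht : t ∈ Icc a b)
    (hs : s ∈ 𝓝[Icc a b] t) :
    ∃ a' b', t ∈ Icc a' b' ∧ Icc a' b' ∈ 𝓝[Icc a b] t ∧ Icc a' b' ⊆ Icc a b ∩ s := by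
  obtain ⟨u, hu, hus⟩ := mem_nhdsWithin_iff_exists_mem_nhds_inter.1 hs
  obtain ⟨a', b', htab, hnhds, hsub⟩ := exists_Icc_mem_subset_of_mem_nhds hu
  refine ⟨max a' a, min b' b, ?_⟩
  rw [← Icc_inter_Icc]
  exact ⟨⟨htab, ht⟩, Filter.inter_mem (mem_nhdsWithin_of_mem_nhds hnhds) self_mem_nhdsWithin,
    fun x hx => ⟨hx.2, hus ⟨hsub hx.1, hx.2⟩⟩⟩

variable {G : M → W} {c : W}

theorem IsOrbitChart.exists_integral_frameSpeed [CompleteSpace V] {p : M} {ε : ℝ} {T : M → V}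
    (h : IsOrbitChart A G c p ε Φ T) {a b t₀ : ℝ}
    (hγ : ContMDiffOn 𝓘(ℝ, ℝ) 𝓘(ℝ, E) 1 γ (Icc a b)) (hγc : ∀ t ∈ Icc a b, G (γ t) = c)
    (hθ : ∀ t ∈ Icc a b, ∀ v, θ (γ t) (A (γ t) v) = v) (ht₀ : t₀ ∈ Icc a b) (hp : γ t₀ = p) :
    ∃ J ∈ 𝓝[Icc a b] t₀, MeasureTheory.IntegrableOn (frameSpeed θ γ) J ∧ ∀ t ∈ J,
      ∫ x in t₀..t, frameSpeed θ γ x ∈ Metric.ball 0 ε ∧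
        Φ (∫ x in t₀..t, frameSpeed θ γ x) = γ t := by
  subst hp
  have hcont : ContinuousWithinAt γ (Icc a b) t₀ := hγ.continuousOn t₀ ht₀
  obtain ⟨a', b', ht₀', hnhds, hsub⟩ := exists_Icc_mem_nhdsWithin_Icc ht₀
    (hcont.eventually (h.contMDiffAt.and h.map_inverse))
  have hΦT : ∀ t ∈ Icc a' b', T (γ t) ∈ Metric.ball 0 ε ∧ Φ (T (γ t)) = γ t := fun t ht =>
    (hsub ht).2.2 (hγc t (hsub ht).1)
  have hTγ : ContDiffOn ℝ 1 (fun t => T (γ t)) (Icc a' b') := fun t ht =>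
    ((hsub ht).2.1.comp_contMDiffWithinAt t
      ((hγ t (hsub ht).1).mono fun s hs => (hsub hs).1)).contDiffWithinAt
  obtain ⟨hint, hI⟩ := h.isOrbitMapOn.integral_frameSpeed hTγ (fun t ht => (hΦT t ht).1)
    (fun t ht => (hΦT t ht).2) (fun t ht => hθ t (hsub ht).1)
  refine ⟨_, hnhds, hint, fun t ht => ?_⟩
  rw [hI t₀ ht₀' t ht, h.inverse_self, sub_zero]
  exact hΦT t ht

variable [NormedAddCommGroup W] [NormedSpace ℝ W] [FiniteDimensional ℝ E]
  [FiniteDimensional ℝ V] [FiniteDimensional ℝ W] [IsManifold 𝓘(ℝ, E) 1 M]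

theorem IsCommutingFamily.integrableOn_frameSpeed (hA : IsCommutingFamily A)
    (hG : IsFirstIntegral A G)
    (hdim : Module.finrank ℝ E = Module.finrank ℝ V + Module.finrank ℝ W)
    (hθ : ∀ m ∈ regularLevel A G c, ∀ v, θ m (A m v) = v) {a b : ℝ}
    (hγ : ContMDiffOn 𝓘(ℝ, ℝ) 𝓘(ℝ, E) 1 γ (Icc a b))
    (hreg : ∀ t ∈ Icc a b, γ t ∈ regularLevel A G c) :
    MeasureTheory.IntegrableOn (frameSpeed θ γ) (Icc a b) := by
  have := FiniteDimensional.complete ℝ V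
  refine isCompact_Icc.induction_on MeasureTheory.integrableOn_empty
    (fun _ _ h h' => h'.mono_set h) (fun _ _ h h' => h.union h') fun t₀ ht₀ => ?_
  obtain ⟨ε, Φ, T, hchart⟩ := hA.exists_orbitChart hG hdim (hreg t₀ ht₀)
  obtain ⟨J, hJ, hint, -⟩ := hchart.exists_integral_frameSpeed hγ (fun t ht => (hreg t ht).1)
    (fun t ht => hθ _ (hreg t ht)) ht₀ rfl
  exact ⟨J, hJ, hint⟩

end Developments

section PiecewiseLoops

theorem Icc_subset_biUnion_Icc_of_monotone {τ : ℕ → ℝ} {N : ℕ} (hτ : Monotone τ)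
    (h : τ 0 < τ N) : Icc (τ 0) (τ N) ⊆ ⋃ k ∈ Iio N, Icc (τ k) (τ (k + 1)) := by
  intro t ht
  simp only [mem_iUnion, mem_Iio, exists_prop]
  rcases ht.1.eq_or_lt with rfl | ht0
  · exact ⟨0, Nat.pos_of_ne_zero fun hN => h.ne (by rw [hN]), le_rfl, hτ (Nat.le_succ 0)⟩
  · have hmem : t ∈ ⋃ k ∈ Ico 0 N, Ioc (τ k) (τ (Order.succ k)) := by
      rw [hτ.biUnion_Ico_Ioc_map_succ]
      exact ⟨ht0, ht.2⟩
    simp only [mem_iUnion, mem_Ico, exists_prop] at hmem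
    obtain ⟨k, hk, hkt⟩ := hmem
    exact ⟨k, hk.2, Ioc_subset_Icc_self hkt⟩

variable {n : ℕ} {V W M : Type*} [NormedAddCommGroup V] [NormedSpace ℝ V]
  [FiniteDimensional ℝ V] [NormedAddCommGroup W] [NormedSpace ℝ W] [FiniteDimensional ℝ W]
  [TopologicalSpace M] [ChartedSpace (R2 n) M] [IsManifold 𝓘(ℝ, R2 n) 1 M]
  {A : (m : M) → V →L[ℝ] TangentSpace 𝓘(ℝ, R2 n) m} {G : M → W} {c : W}
  {θ : (m : M) → TangentSpace 𝓘(ℝ, R2 n) m →ₗ[ℝ] V} {γ : ℝ → M}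

namespace IsPiecewiseC1Loop

theorem intervalIntegrable_frameSpeed (hγ : IsPiecewiseC1Loop (n := n) γ)
    (hA : IsCommutingFamily A) (hG : IsFirstIntegral A G)
    (hdim : Module.finrank ℝ (R2 n) = Module.finrank ℝ V + Module.finrank ℝ W)
    (hθ : ∀ m ∈ regularLevel A G c, ∀ v, θ m (A m v) = v)
    (hreg : ∀ t ∈ Icc (0 : ℝ) 1, γ t ∈ regularLevel A G c) :
    IntervalIntegrable (frameSpeed θ γ) MeasureTheory.volume 0 1 := by
  obtain ⟨N, τ, hmono, h0, hN, hC⟩ := hγ.piecewise_C1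
  rw [← h0, ← hN] at hreg ⊢
  refine IntervalIntegrable.trans_iterate fun k hk => ?_
  refine MeasureTheory.IntegrableOn.intervalIntegrable ?_
  rw [uIcc_of_le (hmono (Nat.le_succ k))]
  exact hA.integrableOn_frameSpeed hG hdim hθ (hC k hk) fun t ht =>
    hreg t (Icc_subset_Icc (hmono (Nat.zero_le _)) (hmono hk) ht)

theorem isDevelopmentOn (hγ : IsPiecewiseC1Loop (n := n) γ) (hA : IsCommutingFamily A)
    (hG : IsFirstIntegral A G)
    (hdim : Module.finrank ℝ (R2 n) = Module.finrank ℝ V + Module.finrank ℝ W)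
    (hθ : ∀ m ∈ regularLevel A G c, ∀ v, θ m (A m v) = v)
    (hreg : ∀ t ∈ Icc (0 : ℝ) 1, γ t ∈ regularLevel A G c) :
    IsDevelopmentOn A γ (fun t => ∫ x in 0..t, frameSpeed θ γ x) (Icc 0 1) := by
  have := FiniteDimensional.complete ℝ V
  have hint := hγ.intervalIntegrable_frameSpeed hA hG hdim hθ hreg
  have hint₀ : ∀ t ∈ Icc (0 : ℝ) 1,
      IntervalIntegrable (frameSpeed θ γ) MeasureTheory.volume 0 t := fun t ht =>
    hint.mono_set (by simpa [uIcc_of_le ht.1] using Icc_subset_Icc_right ht.2)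
  intro t₀ ht₀
  obtain ⟨ε, Φ, T, hchart⟩ := hA.exists_orbitChart hG hdim (hreg t₀ ht₀)
  refine ⟨ε, hchart.pos, Φ, hchart.map_zero, hchart.isOrbitMapOn, ?_⟩
  suffices hlift : ∀ᶠ t in 𝓝[Icc 0 1] t₀, ∫ x in t₀..t, frameSpeed θ γ x ∈ Metric.ball 0 ε ∧
      Φ (∫ x in t₀..t, frameSpeed θ γ x) = γ t by
    filter_upwards [hlift, self_mem_nhdsWithin] with t ht ht01
    rwa [intervalIntegral.integral_interval_sub_left (hint₀ t ht01) (hint₀ t₀ ht₀)]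
  obtain ⟨N, τ, hmono, h0, hN, hC⟩ := hγ.piecewise_C1
  have hcover := Icc_subset_biUnion_Icc_of_monotone hmono (N := N)
    (by rw [h0, hN]; exact one_pos)
  rw [h0, hN] at hcover
  refine Filter.Eventually.filter_mono (nhdsWithin_mono t₀ hcover) ?_
  rw [nhdsWithin_biUnion (finite_Iio N)]
  simp only [Filter.eventually_iSup]
  intro k hk
  by_cases ht : t₀ ∈ Icc (τ k) (τ (k + 1))
  · have hreg_k : ∀ t ∈ Icc (τ k) (τ (k + 1)), γ t ∈ regularLevel A G c := fun t ht =>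
      hreg t (Icc_subset_Icc (h0 ▸ hmono (Nat.zero_le _)) (hN ▸ hmono hk) ht)
    obtain ⟨J, hJ, -, hJ'⟩ := hchart.exists_integral_frameSpeed (hC k hk)
      (fun t ht => (hreg_k t ht).1) (fun t ht => hθ _ (hreg_k t ht)) ht rfl
    exact Filter.mem_of_superset hJ hJ'
  · rw [notMem_closure_iff_nhdsWithin_eq_bot.1 (by rwa [isClosed_Icc.closure_eq])]
    exact Filter.eventually_bot

end IsPiecewiseC1Loop

theorem norm_integral_le_integral_sqrt_sum_sq {ι : Type*} [Fintype ι] {g : ℝ → ι → ℝ}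
    {a b s t : ℝ} (hg : IntervalIntegrable g MeasureTheory.volume a b) (hs : s ∈ Icc a b)
    (ht : t ∈ Icc a b) :
    ‖∫ x in s..t, g x‖ ≤ ∫ x in a..b, Real.sqrt (∑ i, g x i ^ 2) := by
  have hab : a ≤ b := hs.1.trans hs.2
  have hg' := (intervalIntegrable_iff_integrableOn_Ioc_of_le hab).1 hg
  have hnorm : ∀ x, ‖WithLp.toLp 2 (g x)‖ = Real.sqrt (∑ i, g x i ^ 2) := fun x => by
    simp only [EuclideanSpace.norm_eq, Real.norm_eq_abs, sq_abs]
  have hle : ∀ x, ‖g x‖ ≤ Real.sqrt (∑ i, g x i ^ 2) := fun x => by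
    rw [← hnorm, pi_norm_le_iff_of_nonneg (norm_nonneg _)]
    exact PiLp.norm_apply_le (WithLp.toLp 2 (g x))
  have hint : MeasureTheory.IntegrableOn (fun x => Real.sqrt (∑ i, g x i ^ 2)) (Ioc a b) := by
    simp only [← hnorm]
    exact ((PiLp.continuousLinearEquiv 2 ℝ fun _ : ι => ℝ).symm.toContinuousLinearMap
      |>.integrable_comp hg').norm
  have hsub : uIoc s t ⊆ Ioc a b := Ioc_subset_Ioc (le_min hs.1 ht.1) (max_le hs.2 ht.2)
  calc ‖∫ x in s..t, g x‖ ≤ ∫ x in uIoc s t, ‖g x‖ :=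
        intervalIntegral.norm_integral_le_integral_norm_uIoc
    _ ≤ ∫ x in uIoc s t, Real.sqrt (∑ i, g x i ^ 2) :=
        MeasureTheory.setIntegral_mono (hg'.mono_set hsub).norm (hint.mono_set hsub) hle
    _ ≤ ∫ x in Ioc a b, Real.sqrt (∑ i, g x i ^ 2) := MeasureTheory.setIntegral_mono_set hint
        (Filter.Eventually.of_forall fun x => Real.sqrt_nonneg _) hsub.eventuallyLE
    _ = ∫ x in a..b, Real.sqrt (∑ i, g x i ^ 2) :=
        (intervalIntegral.integral_of_le hab).symm

end PiecewiseLoops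

section PeriodicLines

variable {E V M : Type*} [NormedAddCommGroup E] [NormedSpace ℝ E] [NormedAddCommGroup V]
  [NormedSpace ℝ V] {T : ℝ}

theorem exists_eventually_sub_zsmul_mem_Ioo (hT : 0 < T) (t₀ : ℝ) :
    ∃ k : ℤ, ∀ᶠ t in 𝓝 t₀, t - k • T ∈ Ioo (-T) T := by
  have hmem := sub_toIcoDiv_zsmul_mem_Ico hT 0 t₀
  rw [zero_add] at hmem
  exact ⟨toIcoDiv hT 0 t₀, (isOpen_Ioo.preimage (by fun_prop)).mem_nhds
    ⟨(neg_lt_zero.2 hT).trans_le hmem.1, hmem.2⟩⟩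

theorem norm_smul_le_norm_smul_of_mem_Ioo (a : V) {s : ℝ} (hs : s ∈ Ioo (-T) T) :
    ‖s • a‖ ≤ ‖T • a‖ := by
  rw [norm_smul, norm_smul, Real.norm_eq_abs]
  gcongr
  exact (abs_lt.2 hs).le.trans (le_abs_self T)

variable [hT : Fact (0 < T)]

theorem liftIco_coe_eq_of_sub_zsmul_mem_Ioo {α : Type*} {η : ℝ → α}
    (hη : ∀ s ∈ Ioo (-T) 0, η (s + T) = η s) {t : ℝ} {k : ℤ} (ht : t - k • T ∈ Ioo (-T) T) :
    AddCircle.liftIco T 0 η t = η (t - k • T) := by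
  have hcoe : (t : AddCircle T) = ((t - k • T : ℝ) : AddCircle T) := by
    rw [AddCircle.coe_sub, AddCircle.coe_zsmul, AddCircle.coe_period, smul_zero, sub_zero]
  rw [hcoe]
  rcases le_or_gt 0 (t - k • T) with h | h
  · exact AddCircle.liftIco_zero_coe_apply ⟨h, ht.2⟩
  · rw [← hη _ ⟨ht.1, h⟩, ← AddCircle.coe_add_period]
    exact AddCircle.liftIco_zero_coe_apply ⟨by linarith [ht.1], by linarith⟩

variable (T) in
/-- The `T`-periodic curve which on `[0, T)` runs along the line `t ↦ Φ (t • a)`. -/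
noncomputable def periodicLine (Φ : V → M) (a : V) (t : ℝ) : M :=
  AddCircle.liftIco T 0 (fun s : ℝ => Φ (s • a)) t

theorem periodicLine_periodic (Φ : V → M) (a : V) : Function.Periodic (periodicLine T Φ a) T :=
  fun t => by rw [periodicLine, AddCircle.coe_add_period, periodicLine]

theorem periodicLine_zero (Φ : V → M) (a : V) : periodicLine T Φ a 0 = Φ 0 := by
  rw [periodicLine, AddCircle.liftIco_zero_coe_apply ⟨le_rfl, hT.out⟩, zero_smul]

variable [TopologicalSpace M] [ChartedSpace E M] {A : (m : M) → V →L[ℝ] TangentSpace 𝓘(ℝ, E) m}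

namespace IsOrbitMapOn

variable [T2Space M] {Φ : V → M} {a w x y : V} {ρ : ℝ}

theorem period_of_period (hA : IsCommutingFamily A) (hΦ : IsOrbitMapOn A Φ (Metric.ball 0 ρ))
    (h : Φ (w + x) = Φ x) (hx : x ∈ Metric.ball 0 ρ) (hwx : w + x ∈ Metric.ball 0 ρ)
    (hy : y ∈ Metric.ball 0 ρ) (hwy : w + y ∈ Metric.ball 0 ρ) : Φ (w + y) = Φ y :=
  (hΦ.eq_of_eq_translate hA (convex_ball _ _) (convex_ball _ _) hΦ hx hwx h.symm hy hwy).symm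

theorem periodicLine_eq (hA : IsCommutingFamily A) (hΦ : IsOrbitMapOn A Φ (Metric.ball 0 ρ))
    (hρ : ‖T • a‖ < ρ) (hper : Φ (T • a) = Φ 0) {t : ℝ} {k : ℤ} (ht : t - k • T ∈ Ioo (-T) T) :
    periodicLine T Φ a t = Φ ((t - k • T) • a) := by
  have hball : ∀ s ∈ Ioo (-T) T, s • a ∈ Metric.ball (0 : V) ρ := fun s hs =>
    mem_ball_zero_iff.2 ((norm_smul_le_norm_smul_of_mem_Ioo a hs).trans_lt hρ)
  refine liftIco_coe_eq_of_sub_zsmul_mem_Ioo (η := fun s => Φ (s • a)) (fun s hs => ?_) ht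
  have hsT : T • a + s • a = (s + T) • a := by rw [add_smul, add_comm]
  have hperiod := hΦ.period_of_period hA (w := T • a) (x := 0) (y := s • a) (by rwa [add_zero])
    (by simpa using (norm_nonneg _).trans_lt hρ) (by simpa using hρ)
    (hball s ⟨hs.1, hs.2.trans hT.out⟩)
    (hsT ▸ hball (s + T) ⟨by linarith [hs.1, hT.out], by linarith [hs.2]⟩)
  rwa [hsT] at hperiod

theorem isMIntegralCurve_periodicLine (hA : IsCommutingFamily A)
    (hΦ : IsOrbitMapOn A Φ (Metric.ball 0 ρ)) (hρ : ‖T • a‖ < ρ) (hper : Φ (T • a) = Φ 0) :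
    IsMIntegralCurve (I := 𝓘(ℝ, E)) (periodicLine T Φ a) (fun m => A m a) := by
  intro t₀
  obtain ⟨k, hk⟩ := exists_eventually_sub_zsmul_mem_Ioo hT.out t₀
  have hshift : ∀ t : ℝ, -(k • T) • a + t • a = (t - k • T) • a := fun t => by
    rw [← add_smul, neg_add_eq_sub]
  have hline := hΦ.isMIntegralCurveOn (-(k • T) • a) a (S := {t | t - k • T ∈ Ioo (-T) T})
    fun t ht => by
      rw [hshift, mem_ball_zero_iff]
      exact (norm_smul_le_norm_smul_of_mem_Ioo a ht).trans_lt hρ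
  have hev : periodicLine T Φ a =ᶠ[𝓝 t₀] fun t => Φ (-(k • T) • a + t • a) := by
    filter_upwards [hk] with t ht
    rw [hΦ.periodicLine_eq hA hρ hper ht, hshift]
  rw [hev.eq_of_nhds]
  exact ((hline t₀ hk.self_of_nhds).hasMFDerivAt hk).congr_of_eventuallyEq hev

end IsOrbitMapOn

end PeriodicLines

section OrbitMapFamilies

variable {E V W M X : Type*} [NormedAddCommGroup E] [NormedSpace ℝ E] [NormedAddCommGroup V]
  [NormedSpace ℝ V] [NormedAddCommGroup W] [NormedSpace ℝ W] [TopologicalSpace M]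
  [ChartedSpace E M] [TopologicalSpace X]

/-- For `u` in `I`, the map `Φ u` is an orbit map on a ball of radius greater than `ℓ`, and its
base point `p u = Φ u 0` moves continuously in the regular part of the level set `G = c`. -/
structure IsOrbitMapFamily (A : (m : M) → V →L[ℝ] TangentSpace 𝓘(ℝ, E) m) (G : M → W) (c : W)
    (ℓ : ℝ) (I : Set X) (p : X → M) (Φ : X → V → M) : Prop where
  continuousOn : ContinuousOn p I
  mem_regularLevel : ∀ u ∈ I, p u ∈ regularLevel A G c
  map_zero : ∀ u ∈ I, Φ u 0 = p u
  isOrbitMapOn : ∀ u ∈ I, ∃ ρ > ℓ, IsOrbitMapOn A (Φ u) (Metric.ball 0 ρ)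

namespace IsOrbitMapFamily

theorem mono {A : (m : M) → V →L[ℝ] TangentSpace 𝓘(ℝ, E) m} {G : M → W} {c : W} {ℓ ℓ' : ℝ}
    {I : Set X} {p : X → M} {Φ : X → V → M} (h : IsOrbitMapFamily A G c ℓ I p Φ) (hℓ : ℓ' ≤ ℓ) :
    IsOrbitMapFamily A G c ℓ' I p Φ where
  __ := h
  isOrbitMapOn u hu := (h.isOrbitMapOn u hu).imp fun _ hρ => ⟨hℓ.trans_lt hρ.1, hρ.2⟩

variable [FiniteDimensional ℝ E] [FiniteDimensional ℝ V] [FiniteDimensional ℝ W] [T2Space M]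
  [IsManifold 𝓘(ℝ, E) 1 M] {A : (m : M) → V →L[ℝ] TangentSpace 𝓘(ℝ, E) m} {G : M → W} {c : W}
  {ℓ : ℝ} {I : Set X} {p : X → M} {Φ : X → V → M}

theorem exists_translation (h : IsOrbitMapFamily A G c ℓ I p Φ) (hA : IsCommutingFamily A)
    (hG : IsFirstIntegral A G)
    (hdim : Module.finrank ℝ E = Module.finrank ℝ V + Module.finrank ℝ W) (hℓ : 0 ≤ ℓ) {u₀ : X}
    (hu₀ : u₀ ∈ I) {ρ : ℝ} (hρ : ℓ < ρ) (hΦ : IsOrbitMapOn A (Φ u₀) (Metric.ball 0 ρ)) :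
    ∃ τ : X → V, ContinuousWithinAt τ I u₀ ∧ τ u₀ = 0 ∧ ∀ᶠ u in 𝓝[I] u₀, ∀ s : V, ‖s‖ ≤ ℓ →
      τ u + s ∈ Metric.ball 0 ρ ∧ Φ u s = Φ u₀ (τ u + s) := by
  obtain ⟨ε, Ψ, Q, hQ⟩ := hA.exists_orbitChart hG hdim (h.mem_regularLevel u₀ hu₀)
  have hp : Filter.Tendsto p (𝓝[I] u₀) (𝓝 (p u₀)) := h.continuousOn u₀ hu₀
  have hQp : ContinuousWithinAt (fun u => Q (p u)) I u₀ :=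
    hQ.contMDiffAt.self_of_nhds.continuousAt.comp_continuousWithinAt (f := p) hp
  have hQp0 : Filter.Tendsto (fun u => Q (p u)) (𝓝[I] u₀) (𝓝 0) := by
    simpa only [ContinuousWithinAt, hQ.inverse_self] using hQp
  refine ⟨fun u => Q (p u), hQp, hQ.inverse_self, ?_⟩
  filter_upwards [self_mem_nhdsWithin, hp.eventually hQ.map_inverse,
    hQp0.norm.eventually_lt_const (u := ρ - ℓ) (by simpa using hρ)] with u hu hinv hlt s hs
  obtain ⟨hmem, hΨ⟩ := hinv (h.mem_regularLevel u hu).1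
  obtain ⟨ρu, hρu, hΦu⟩ := h.isOrbitMapOn u hu
  have hball : ∀ s : V, ‖s‖ ≤ ℓ → Q (p u) + s ∈ Metric.ball 0 ρ := fun s hs => by
    rw [mem_ball_zero_iff]
    linarith [norm_add_le (Q (p u)) s]
  have h0 : ‖(0 : V)‖ ≤ ℓ := by rwa [norm_zero]
  have hbase : Ψ (Q (p u)) = Φ u₀ (Q (p u)) :=
    IsOrbitMapOn.eqOn hA ((convex_ball _ _).inter (convex_ball _ _))
      (hQ.isOrbitMapOn.mono inter_subset_left) (hΦ.mono inter_subset_right)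
      ⟨Metric.mem_ball_self hQ.pos, Metric.mem_ball_self (hℓ.trans_lt hρ)⟩
      (hQ.map_zero.trans (h.map_zero u₀ hu₀).symm) ⟨hmem, by simpa using hball 0 h0⟩
  exact ⟨hball s hs, hΦu.eq_of_eq_translate hA (convex_ball _ _) (convex_ball _ _) hΦ
    (mem_ball_zero_iff.2 (h0.trans_lt hρu)) (hball 0 h0)
    (by rw [h.map_zero u hu, add_zero, ← hbase, hΨ])
    (mem_ball_zero_iff.2 (hs.trans_lt hρu)) (hball s hs)⟩

theorem period_of_period {w : V} (h : IsOrbitMapFamily A G c ‖w‖ I p Φ)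
    (hA : IsCommutingFamily A) (hG : IsFirstIntegral A G)
    (hdim : Module.finrank ℝ E = Module.finrank ℝ V + Module.finrank ℝ W)
    (hI : IsPreconnected I) {u u' : X} (hu : u ∈ I) (hw : Φ u w = Φ u 0) (hu' : u' ∈ I) :
    Φ u' w = Φ u' 0 := by
  refine (hI.induction₂ (fun u u' => (Φ u w = Φ u 0) ↔ (Φ u' w = Φ u' 0)) (fun u₀ hu₀ => ?_)
    (fun _ _ _ _ _ _ h h' => h.trans h') (fun _ _ _ _ h => h.symm) hu hu').1 hw
  obtain ⟨ρ, hρ, hΦ⟩ := h.isOrbitMapOn u₀ hu₀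
  obtain ⟨τ, -, -, hτ⟩ := h.exists_translation hA hG hdim (norm_nonneg w) hu₀ hρ hΦ
  filter_upwards [hτ] with u hu
  obtain ⟨hτw, hΦw⟩ := hu w le_rfl
  obtain ⟨hτ0, hΦ0⟩ := hu 0 (by simp)
  have h0 : (0 : V) ∈ Metric.ball 0 ρ := Metric.mem_ball_self ((norm_nonneg w).trans_lt hρ)
  have hw0 : w + 0 ∈ Metric.ball 0 ρ := by rwa [add_zero, mem_ball_zero_iff]
  rw [hΦw, hΦ0, add_comm (τ u) w, add_zero]
  rw [add_zero] at hτ0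
  rw [add_comm] at hτw
  constructor
  · intro h
    exact hΦ.period_of_period hA (by rwa [add_zero]) h0 hw0 hτ0 hτw
  · intro h
    simpa using hΦ.period_of_period hA h hτ0 hτw h0 hw0

theorem continuousOn_periodicLine {T : ℝ} [hT : Fact (0 < T)] {a : V}
    (h : IsOrbitMapFamily A G c ‖T • a‖ I p Φ)
    (hA : IsCommutingFamily A) (hG : IsFirstIntegral A G)
    (hdim : Module.finrank ℝ E = Module.finrank ℝ V + Module.finrank ℝ W)
    (hper : ∀ u ∈ I, Φ u (T • a) = Φ u 0) :
    ContinuousOn (fun q : X × ℝ => periodicLine T (Φ q.1) a q.2) (I ×ˢ univ) := by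
  rintro ⟨u₀, t₀⟩ ⟨hu₀, -⟩
  obtain ⟨ρ₀, hρ₀, hΦ₀⟩ := h.isOrbitMapOn u₀ hu₀
  obtain ⟨τ, hτc, -, hτ⟩ := h.exists_translation hA hG hdim (norm_nonneg _) hu₀ hρ₀ hΦ₀
  obtain ⟨k, hk⟩ := exists_eventually_sub_zsmul_mem_Ioo hT.out t₀
  have hline : ContinuousWithinAt (fun q : X × ℝ => τ q.1 + (q.2 - k • T) • a) (I ×ˢ univ)
      (u₀, t₀) :=
    (ContinuousWithinAt.comp (x := ((u₀, t₀) : X × ℝ)) hτc continuous_fst.continuousWithinAt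
      fun q hq => hq.1).add (by fun_prop)
  have heq : ∀ u ∈ I, ∀ t, (∀ s : V, ‖s‖ ≤ ‖T • a‖ →
      τ u + s ∈ Metric.ball 0 ρ₀ ∧ Φ u s = Φ u₀ (τ u + s)) → t - k • T ∈ Ioo (-T) T →
      τ u + (t - k • T) • a ∈ Metric.ball 0 ρ₀ ∧
        periodicLine T (Φ u) a t = Φ u₀ (τ u + (t - k • T) • a) := by
    intro u hu t hτu ht
    obtain ⟨ρ, hρ, hΦ⟩ := h.isOrbitMapOn u hu
    rw [hΦ.periodicLine_eq hA hρ (hper u hu) ht]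
    exact hτu _ (norm_smul_le_norm_smul_of_mem_Ioo a ht)
  have hnear : ∀ᶠ q in 𝓝[I ×ˢ univ] (u₀, t₀),
      periodicLine T (Φ q.1) a q.2 = Φ u₀ (τ q.1 + (q.2 - k • T) • a) := by
    rw [nhdsWithin_prod_eq, nhdsWithin_univ]
    filter_upwards [(hτ.and self_mem_nhdsWithin).prod_mk hk] with q hq
    exact (heq q.1 hq.1.2 q.2 hq.1.1 hq.2).2
  have hself := heq u₀ hu₀ t₀ (hτ.self_of_nhdsWithin hu₀) hk.self_of_nhds
  exact (ContinuousAt.comp_continuousWithinAt (x := ((u₀, t₀) : X × ℝ))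
    (f := fun q : X × ℝ => τ q.1 + (q.2 - k • T) • a) (g := Φ u₀)
    (hΦ₀ _ hself.1).continuousAt hline).congr_of_eventuallyEq hnear hself.2

theorem rel_of_eventually_rel {r : M → M → Prop} (h : IsOrbitMapFamily A G c ℓ I p Φ)
    (hA : IsCommutingFamily A) (hG : IsFirstIntegral A G)
    (hdim : Module.finrank ℝ E = Module.finrank ℝ V + Module.finrank ℝ W) (hℓ : 0 ≤ ℓ)
    (hI : IsPreconnected I) (hr : Equivalence r)
    (hloc : ∀ u ∈ I, ∀ᶠ s in 𝓝 0, r (Φ u 0) (Φ u s)) {u u' : X} (hu : u ∈ I) (hu' : u' ∈ I) :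
    r (p u) (p u') := by
  refine hI.induction₂ (fun u u' => r (p u) (p u')) (fun u₀ hu₀ => ?_)
    (fun _ _ _ _ _ _ h h' => hr.trans h h') (fun _ _ _ _ h => hr.symm h) hu hu'
  obtain ⟨ρ, hρ, hΦ⟩ := h.isOrbitMapOn u₀ hu₀
  obtain ⟨τ, hτc, hτ0, hτ⟩ := h.exists_translation hA hG hdim hℓ hu₀ hρ hΦ
  rw [ContinuousWithinAt, hτ0] at hτc
  filter_upwards [self_mem_nhdsWithin, hτ, hτc.eventually (hloc u₀ hu₀)] with u hu hτu hru
  rwa [← h.map_zero u₀ hu₀, ← h.map_zero u hu, (hτu 0 (by rwa [norm_zero])).2, add_zero]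

end IsOrbitMapFamily

end OrbitMapFamilies

section HamiltonianFrames

variable {n : ℕ} {M : Type*} [TopologicalSpace M] [ChartedSpace (R2 n) M]

/-- The family of Hamiltonian vector fields `m ↦ ∑ vᵢ X_{fᵢ}(m)` parametrized by `v ∈ ℝⁿ`: the
infinitesimal generators of the local Hamiltonian `ℝⁿ`-action. -/
noncomputable def hamFrame (Ω : SymplecticForm n M) (F : M → Fin n → ℝ) (m : M) :
    (Fin n → ℝ) →L[ℝ] TangentSpace 𝓘(ℝ, R2 n) m :=
  ∑ i, (ContinuousLinearMap.proj (R := ℝ) (φ := fun _ : Fin n => ℝ) i).smulRight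
    (hamVF Ω (component F i) m)

/-- `F` is a smooth momentum map whose components are pairwise in involution, with no condition of
functional independence. -/
structure IsInvolutiveSystem (Ω : SymplecticForm n M) (F : M → Fin n → ℝ) : Prop where
  contMDiff : ContMDiff 𝓘(ℝ, R2 n) 𝓘(ℝ, Fin n → ℝ) ∞ F
  involution : ∀ (i j : Fin n) (m : M),
    Ω.form m ![hamVF Ω (component F i) m, hamVF Ω (component F j) m] = 0

variable {Ω : SymplecticForm n M} {F : M → Fin n → ℝ} {m : M}

theorem IsIntegrableSystem.isInvolutiveSystem (hF : IsIntegrableSystem Ω F) :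
    IsInvolutiveSystem Ω F :=
  ⟨hF.analytic.of_le le_top, hF.involution⟩

theorem IsInvolutiveSystem.mdifferentiableAt (hF : IsInvolutiveSystem Ω F) (m : M) :
    MDifferentiableAt 𝓘(ℝ, R2 n) 𝓘(ℝ, Fin n → ℝ) F m :=
  hF.contMDiff.mdifferentiableAt (by simp)

theorem hamFrame_apply (m : M) (v : Fin n → ℝ) :
    hamFrame Ω F m v = ∑ i, v i • hamVF Ω (component F i) m := by
  simp [hamFrame]

theorem hamFrame_single (m : M) (i : Fin n) :
    hamFrame Ω F m (Pi.single i 1) = hamVF Ω (component F i) m := by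
  simp [hamFrame_apply, Pi.single_apply]

theorem mfderiv_dotProduct (hF : MDifferentiableAt 𝓘(ℝ, R2 n) 𝓘(ℝ, Fin n → ℝ) F m)
    (v : Fin n → ℝ) (w : TangentSpace 𝓘(ℝ, R2 n) m) :
    mfderiv 𝓘(ℝ, R2 n) 𝓘(ℝ, ℝ) (fun m => v ⬝ᵥ F m) m w
      = v ⬝ᵥ (mfderiv 𝓘(ℝ, R2 n) 𝓘(ℝ, Fin n → ℝ) F m w : Fin n → ℝ) := by
  let L : (Fin n → ℝ) →L[ℝ] ℝ := (dotProductBilin ℝ ℝ v).toContinuousLinearMap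
  exact congrArg (fun D : R2 n →L[ℝ] ℝ => D w)
    ((ContinuousLinearMap.hasMFDerivAt L).comp m hF.hasMFDerivAt).mfderiv

theorem form_hamFrame (hF : MDifferentiableAt 𝓘(ℝ, R2 n) 𝓘(ℝ, Fin n → ℝ) F m) (v : Fin n → ℝ)
    (w : TangentSpace 𝓘(ℝ, R2 n) m) : Ω.form m ![w, hamFrame Ω F m v]
      = v ⬝ᵥ (mfderiv 𝓘(ℝ, R2 n) 𝓘(ℝ, Fin n → ℝ) F m w : Fin n → ℝ) := by
  rw [hamFrame_apply]
  refine (form_sum_smul_right (E := R2 n) (Ω.form m) w v _).trans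
    (Finset.sum_congr rfl fun i _ => congrArg (v i * ·) ?_)
  have hcomp : component F i = fun m => Pi.single i 1 ⬝ᵥ F m := by
    funext m
    rw [single_dotProduct, one_mul, component]
  refine (hamVF_spec Ω (component F i) m w).trans ?_
  rw [hcomp, mfderiv_dotProduct hF]
  exact (single_dotProduct _ 1 i).trans (one_mul _)

theorem SymplecticForm.eq_of_form_eq {v w : TangentSpace 𝓘(ℝ, R2 n) m}
    (h : ∀ u, Ω.form m ![u, v] = Ω.form m ![u, w]) : v = w := by
  obtain ⟨e, he⟩ := exists_equiv_eq_formBilin (E := R2 n) (η := Ω.form m) (Ω.nondegenerate m)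
  refine e.injective (ContinuousLinearMap.ext fun u => ?_)
  rw [← ContinuousLinearEquiv.coe_coe, he]
  exact (formBilin_apply (E := R2 n) (Ω.form m) v u).trans
    ((h u).trans (formBilin_apply (E := R2 n) (Ω.form m) w u).symm)

theorem hamVF_dotProduct (hF : MDifferentiableAt 𝓘(ℝ, R2 n) 𝓘(ℝ, Fin n → ℝ) F m)
    (v : Fin n → ℝ) : hamVF Ω (fun m => v ⬝ᵥ F m) m = hamFrame Ω F m v :=
  SymplecticForm.eq_of_form_eq fun w => by
    rw [hamVF_spec, form_hamFrame hF, mfderiv_dotProduct hF]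

theorem hamFrame_eq_zero_iff (hF : MDifferentiableAt 𝓘(ℝ, R2 n) 𝓘(ℝ, Fin n → ℝ) F m)
    {v : Fin n → ℝ} : hamFrame Ω F m v = 0 ↔
      ∀ w, v ⬝ᵥ (mfderiv 𝓘(ℝ, R2 n) 𝓘(ℝ, Fin n → ℝ) F m w : Fin n → ℝ) = 0 := by
  have hzero : ∀ w, Ω.form m ![w, 0] = 0 := fun w =>
    (formBilin_apply (E := R2 n) (Ω.form m) 0 w).symm.trans (by rw [map_zero]; rfl)
  refine ⟨fun h w => ?_, fun h => Ω.nondegenerate m _ fun w => ?_⟩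
  · rw [← form_hamFrame (Ω := Ω) hF, h, hzero]
  · rw [form_hamFrame hF, h]

theorem hamFrame_eq_zero_of_rankAt_eq_zero
    (hF : MDifferentiableAt 𝓘(ℝ, R2 n) 𝓘(ℝ, Fin n → ℝ) F m) (hm : rankAt F m = 0)
    (v : Fin n → ℝ) : hamFrame Ω F m v = 0 := by
  let D : R2 n →L[ℝ] (Fin n → ℝ) := mfderiv 𝓘(ℝ, R2 n) 𝓘(ℝ, Fin n → ℝ) F m
  have hD : D.toLinearMap = 0 := LinearMap.range_eq_bot.1 (Submodule.finrank_eq_zero.1 hm)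
  exact (hamFrame_eq_zero_iff hF).2 fun w =>
    (congrArg (v ⬝ᵥ ·) (LinearMap.congr_fun hD w)).trans (dotProduct_zero v)

theorem notMem_singSet_iff :
    m ∉ singSet F ↔ Function.Surjective (mfderiv 𝓘(ℝ, R2 n) 𝓘(ℝ, Fin n → ℝ) F m) := by
  let D : R2 n →ₗ[ℝ] (Fin n → ℝ) := (mfderiv 𝓘(ℝ, R2 n) 𝓘(ℝ, Fin n → ℝ) F m).toLinearMap
  have hle : Module.finrank ℝ (LinearMap.range D) ≤ n :=
    (Submodule.finrank_le _).trans_eq (Module.finrank_fin_fun ℝ)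
  calc m ∉ singSet F ↔ Module.finrank ℝ (LinearMap.range D) = Module.finrank ℝ (Fin n → ℝ) := by
        rw [Module.finrank_fin_fun]
        exact not_lt.trans ⟨hle.antisymm, ge_of_eq⟩
    _ ↔ LinearMap.range D = ⊤ := ⟨Submodule.eq_top_of_finrank_eq, fun h => by rw [h, finrank_top]⟩
    _ ↔ Function.Surjective D := LinearMap.range_eq_top

theorem hamFrame_injective_iff (hF : MDifferentiableAt 𝓘(ℝ, R2 n) 𝓘(ℝ, Fin n → ℝ) F m) :
    Function.Injective (hamFrame Ω F m) ↔
      Function.Surjective (mfderiv 𝓘(ℝ, R2 n) 𝓘(ℝ, Fin n → ℝ) F m) := by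
  let D : R2 n →ₗ[ℝ] (Fin n → ℝ) := (mfderiv 𝓘(ℝ, R2 n) 𝓘(ℝ, Fin n → ℝ) F m).toLinearMap
  rw [injective_iff_map_eq_zero]
  refine ⟨fun h => ?_, fun h v hv => ?_⟩
  · by_contra hD
    obtain ⟨φ, hφ, hφD⟩ := Submodule.exists_dual_map_eq_bot_of_lt_top
      (lt_top_iff_ne_top.2 fun htop : LinearMap.range D = ⊤ => hD (LinearMap.range_eq_top.1 htop))
      inferInstance
    have hφ_eq : ∀ x, φ x = (fun i => φ (Pi.single i 1)) ⬝ᵥ x := fun x => by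
      conv_lhs => rw [pi_eq_sum_univ' x]
      simp [dotProduct, mul_comm]
    have hzero := h _ ((hamFrame_eq_zero_iff hF).2 fun w => (hφ_eq (D w)).symm.trans <|
      (Submodule.eq_bot_iff _).1 hφD _ ⟨D w, ⟨w, rfl⟩, rfl⟩)
    exact hφ (LinearMap.ext fun x => by rw [hφ_eq, hzero, zero_dotProduct, LinearMap.zero_apply])
  · obtain ⟨w, hw⟩ := h v
    have hvw := (hamFrame_eq_zero_iff hF).1 hv w
    rw [hw] at hvw
    exact dotProduct_self_eq_zero.1 hvw

namespace IsInvolutiveSystem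

theorem form_hamFrame_hamFrame (hF : IsInvolutiveSystem Ω F) (m : M) (v w : Fin n → ℝ) :
    Ω.form m ![hamFrame Ω F m v, hamFrame Ω F m w] = 0 := by
  rw [hamFrame_apply m w]
  refine (form_sum_smul_right (E := R2 n) (Ω.form m) _ w _).trans
    (Finset.sum_eq_zero fun j _ => mul_eq_zero_of_right _ ?_)
  refine (form_swap (E := R2 n) (Ω.form m) _ _).trans (neg_eq_zero.2 ?_)
  rw [hamFrame_apply]
  exact (form_sum_smul_right (E := R2 n) (Ω.form m) _ v _).trans
    (Finset.sum_eq_zero fun i _ => mul_eq_zero_of_right _ (hF.involution j i m))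

theorem isFirstIntegral (hF : IsInvolutiveSystem Ω F) : IsFirstIntegral (hamFrame Ω F) F where
  contMDiff := hF.contMDiff.of_le (by simp)
  mfderiv_apply m v := dotProduct_eq_zero _ fun u => (dotProduct_comm _ u).trans <|
    (form_hamFrame (hF.mdifferentiableAt m) u _).symm.trans (hF.form_hamFrame_hamFrame m v u)

theorem regFibre_eq (hF : IsInvolutiveSystem Ω F) :
    regFibre F = regularLevel (hamFrame Ω F) F 0 := by
  ext m
  have hinj := hamFrame_injective_iff (Ω := Ω) (hF.mdifferentiableAt m)
  exact and_congr Iff.rfl (notMem_singSet_iff.trans (by rw [hinj, and_self]))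

end IsInvolutiveSystem

end HamiltonianFrames

section SymplecticCharts

variable {n : ℕ} {M : Type*} [TopologicalSpace M] [ChartedSpace (R2 n) M]
  {Ω : SymplecticForm n M} {F : M → Fin n → ℝ} {e : OpenPartialHomeomorph M (R2 n)}

/-- A smooth chart in which `Ω` is represented by a smooth closed form. Besides the charts of the
analytic structure these include canonical charts, which are only assumed to be smooth. -/
structure IsSymplecticChart (Ω : SymplecticForm n M) (e : OpenPartialHomeomorph M (R2 n)) :
    Prop where
  mem : e ∈ IsManifold.maximalAtlas 𝓘(ℝ, R2 n) ∞ M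
  contDiffOn : ContDiffOn ℝ ∞ (pullbackForm Ω.form e.symm) e.target
  closed : ∀ x ∈ e.target, extDeriv (pullbackForm Ω.form e.symm) x = 0

theorem isSymplecticChart_chartAt [IsManifold 𝓘(ℝ, R2 n) ω M] (m : M) :
    IsSymplecticChart Ω (chartAt (R2 n) m) :=
  have he := IsManifold.chart_mem_maximalAtlas (I := 𝓘(ℝ, R2 n)) (n := ω) m
  ⟨IsManifold.maximalAtlas_subset_of_le le_top he, (Ω.analytic _ he).of_le le_top, Ω.closed _ he⟩

theorem pullbackForm_apply (ψ : R2 n → M) (x v w : R2 n) :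
    pullbackForm Ω.form ψ x ![v, w] = Ω.form (ψ x)
      ![mfderiv 𝓘(ℝ, R2 n) 𝓘(ℝ, R2 n) ψ x v, mfderiv 𝓘(ℝ, R2 n) 𝓘(ℝ, R2 n) ψ x w] := by
  refine congrArg (Ω.form (ψ x) : R2 n [⋀^Fin 2]→L[ℝ] ℝ) ?_
  ext i : 1
  fin_cases i <;> rfl

namespace IsSymplecticChart

theorem mem_one (he : IsSymplecticChart Ω e) : e ∈ IsManifold.maximalAtlas 𝓘(ℝ, R2 n) 1 M :=
  IsManifold.maximalAtlas_subset_of_le (by simp) he.mem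

theorem pullbackForm_nondegenerate (he : IsSymplecticChart Ω e) {x : R2 n} (hx : x ∈ e.target)
    (v : R2 n) (hv : ∀ w, pullbackForm Ω.form e.symm x ![w, v] = 0) : v = 0 := by
  have hbij := (mdifferentiable_of_mem_maximalAtlas he.mem_one).symm.mfderiv_bijective (x := x) hx
  refine hbij.1 (Eq.trans ?_ (ContinuousLinearMap.map_zero _).symm)
  refine Ω.nondegenerate _ _ fun w => ?_
  obtain ⟨w, rfl⟩ := hbij.2 w
  exact (pullbackForm_apply _ _ _ _).symm.trans (hv w)

theorem pullbackForm_chartRep_hamFrame (he : IsSymplecticChart Ω e)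
    (hF : IsInvolutiveSystem Ω F) {x : R2 n} (hx : x ∈ e.target) (v : Fin n → ℝ) (w : R2 n) :
    pullbackForm Ω.form e.symm x ![w, chartRep (hamFrame Ω F) e x v]
      = fderiv ℝ (fun y => v ⬝ᵥ F (e.symm y)) x w := by
  have hFx := hF.mdifferentiableAt (e.symm x)
  have hsymm := (mdifferentiable_of_mem_maximalAtlas he.mem_one).mdifferentiableAt_symm hx
  let L : (Fin n → ℝ) →L[ℝ] ℝ := (dotProductBilin ℝ ℝ v).toContinuousLinearMap
  have hcomp : HasFDerivAt (fun y => F (e.symm y))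
      ((mfderiv 𝓘(ℝ, R2 n) 𝓘(ℝ, Fin n → ℝ) F (e.symm x)).comp
        (mfderiv 𝓘(ℝ, R2 n) 𝓘(ℝ, R2 n) e.symm x)) x :=
    (hFx.hasMFDerivAt.comp x hsymm.hasMFDerivAt).hasFDerivAt
  rw [pullbackForm_apply, mfderiv_symm_chartRep he.mem_one hx, form_hamFrame hFx]
  exact congrArg (fun D : R2 n →L[ℝ] ℝ => D w) (L.hasFDerivAt.comp x hcomp).fderiv.symm

theorem contDiffOn_dotProduct_comp_symm (he : IsSymplecticChart Ω e)
    (hF : IsInvolutiveSystem Ω F) (v : Fin n → ℝ) :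
    ContDiffOn ℝ ∞ (fun y => v ⬝ᵥ F (e.symm y)) e.target :=
  (dotProductBilin ℝ ℝ v).toContinuousLinearMap.contDiff.comp_contDiffOn
    (hF.contMDiff.comp_contMDiffOn (contMDiffOn_symm_of_mem_maximalAtlas he.mem)).contDiffOn

theorem isCommutingInChart_hamFrame (he : IsSymplecticChart Ω e) (hF : IsInvolutiveSystem Ω F) :
    IsCommutingInChart (hamFrame Ω F) e where
  mem := he.mem_one
  contDiffOn := (contDiffOn_hamiltonian e.open_target he.contDiffOn
    (fun _ hx => he.pullbackForm_nondegenerate hx) (he.contDiffOn_dotProduct_comp_symm hF)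
    (fun _ hx => he.pullbackForm_chartRep_hamFrame hF hx)).of_le (WithTop.coe_le_coe.2 le_top)
  commute _ hx := fderiv_hamiltonian_comm e.open_target he.contDiffOn he.closed
    (fun _ hx => he.pullbackForm_nondegenerate hx) (he.contDiffOn_dotProduct_comp_symm hF)
    (fun _ hx => he.pullbackForm_chartRep_hamFrame hF hx)
    (fun y hy v w => by
      rw [pullbackForm_apply, mfderiv_symm_chartRep he.mem_one hy,
        mfderiv_symm_chartRep he.mem_one hy, hF.form_hamFrame_hamFrame]) hx

end IsSymplecticChart

theorem IsInvolutiveSystem.isCommutingFamily [IsManifold 𝓘(ℝ, R2 n) ω M]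
    (hF : IsInvolutiveSystem Ω F) : IsCommutingFamily (hamFrame Ω F) := fun m =>
  (isSymplecticChart_chartAt m).isCommutingInChart_hamFrame hF

theorem finrank_R2_eq_add (n : ℕ) : Module.finrank ℝ (R2 n)
    = Module.finrank ℝ (Fin n → ℝ) + Module.finrank ℝ (Fin n → ℝ) := by
  rw [finrank_euclideanSpace_fin, Module.finrank_fin_fun, two_mul]

end SymplecticCharts

section LoopPeriods

variable {n : ℕ} {M : Type*} [TopologicalSpace M] [ChartedSpace (R2 n) M]
  {Ω : SymplecticForm n M} {F : M → Fin n → ℝ} {γ : ℝ → M}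

theorem IsInvolutiveSystem.coframe_hamFrame (hF : IsInvolutiveSystem Ω F) {m : M}
    (hm : m ∈ regFibre F) (v : Fin n → ℝ) :
    LinearMap.pi (fun i => coframe Ω F i m) (hamFrame Ω F m v) = v := by
  funext i
  rw [LinearMap.pi_apply, hamFrame_apply, map_sum]
  simp [coframe_spec Ω F i m (hF.mdifferentiableAt m) hm.2]

variable [IsManifold 𝓘(ℝ, R2 n) ω M]

theorem IsPiecewiseC1Loop.intervalIntegrable_coframe (hγ : IsPiecewiseC1Loop (n := n) γ)
    (hF : IsInvolutiveSystem Ω F) (hreg : ∀ t ∈ Icc (0 : ℝ) 1, γ t ∈ regFibre F) :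
    IntervalIntegrable (frameSpeed (fun m => LinearMap.pi fun i => coframe Ω F i m) γ)
      MeasureTheory.volume 0 1 := by
  rw [hF.regFibre_eq] at hreg
  exact hγ.intervalIntegrable_frameSpeed hF.isCommutingFamily hF.isFirstIntegral
    (finrank_R2_eq_add n) (fun m hm => hF.coframe_hamFrame (hF.regFibre_eq ▸ hm)) hreg

theorem IsPiecewiseC1Loop.loopIntegral_eq_integral_frameSpeed
    (hγ : IsPiecewiseC1Loop (n := n) γ) (hF : IsInvolutiveSystem Ω F)
    (hreg : ∀ t ∈ Icc (0 : ℝ) 1, γ t ∈ regFibre F) :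
    (fun i => loopIntegral Ω F i γ)
      = ∫ t in (0 : ℝ)..1, frameSpeed (fun m => LinearMap.pi fun i => coframe Ω F i m) γ t :=
  funext fun i => (ContinuousLinearMap.proj (R := ℝ) (φ := fun _ : Fin n => ℝ) i)
    |>.intervalIntegral_comp_comm (hγ.intervalIntegrable_coframe hF hreg)

theorem IsPiecewiseC1Loop.norm_loopIntegral_le_loopLength (hγ : IsPiecewiseC1Loop (n := n) γ)
    (hF : IsInvolutiveSystem Ω F) (hreg : ∀ t ∈ Icc (0 : ℝ) 1, γ t ∈ regFibre F) :
    ‖fun i => loopIntegral Ω F i γ‖ ≤ loopLength Ω F γ := by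
  rw [hγ.loopIntegral_eq_integral_frameSpeed hF hreg]
  exact norm_integral_le_integral_sqrt_sum_sq (hγ.intervalIntegrable_coframe hF hreg)
    (left_mem_Icc.2 zero_le_one) (right_mem_Icc.2 zero_le_one)

theorem IsPiecewiseC1Loop.orbitMap_loopIntegral [T2Space M] (hγ : IsPiecewiseC1Loop (n := n) γ)
    (hF : IsInvolutiveSystem Ω F) (hreg : ∀ t ∈ Icc (0 : ℝ) 1, γ t ∈ regFibre F)
    {Φ : (Fin n → ℝ) → M} {ρ : ℝ} (hΦ : IsOrbitMapOn (hamFrame Ω F) Φ (Metric.ball 0 ρ))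
    (hρ : loopLength Ω F γ < ρ) {t : ℝ} (ht : t ∈ Icc (0 : ℝ) 1) (h0 : Φ 0 = γ t) :
    Φ (fun i => loopIntegral Ω F i γ) = Φ 0 := by
  have hint := hγ.intervalIntegrable_coframe hF hreg
  have hint_sub : ∀ t ∈ Icc (0 : ℝ) 1, IntervalIntegrable
      (frameSpeed (fun m => LinearMap.pi fun i => coframe Ω F i m) γ)
      MeasureTheory.volume 0 t := fun t ht =>
    hint.mono_set (by simpa [uIcc_of_le ht.1] using Icc_subset_Icc_right ht.2)
  rw [hγ.loopIntegral_eq_integral_frameSpeed hF hreg]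
  rw [hF.regFibre_eq] at hreg
  have hdev := hγ.isDevelopmentOn hF.isCommutingFamily hF.isFirstIntegral (finrank_R2_eq_add n)
    (fun m hm => hF.coframe_hamFrame (hF.regFibre_eq ▸ hm)) hreg
  have hperiod := hdev.orbitMap_period hF.isCommutingFamily hγ.closed hΦ (fun s hs t ht => ?_) ht h0
  · simpa using hperiod
  · rw [intervalIntegral.integral_interval_sub_left (hint_sub t ht) (hint_sub s hs),
      mem_ball_zero_iff]
    exact (norm_integral_le_integral_sqrt_sum_sq hint hs ht).trans_lt hρ

end LoopPeriods

section HamiltonianOrbits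

theorem replaceFirst_eq_mulVec {n : ℕ} [NeZero n] {M : Type*} (F : M → Fin n → ℝ)
    (a : Fin n → ℝ) :
    replaceFirst F a = fun m => ((1 : Matrix (Fin n) (Fin n) ℝ).updateRow 0 a).mulVec (F m) := by
  funext m
  rw [Matrix.updateRow_mulVec, Matrix.one_mulVec]
  rfl

theorem det_updateRow_one {ι R : Type*} [DecidableEq ι] [Fintype ι] [CommRing R] (i : ι)
    (a : ι → R) : ((1 : Matrix ι ι R).updateRow i a).det = a i := by
  rw [← Matrix.cramer_transpose_apply, Matrix.transpose_one, Matrix.cramer_one]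
  rfl

variable {n : ℕ} {M : Type*} [TopologicalSpace M] [ChartedSpace (R2 n) M]
  {Ω : SymplecticForm n M} {F : M → Fin n → ℝ}

theorem hamOrbit_equivalence (Ω : SymplecticForm n M) (F : M → Fin n → ℝ) :
    Equivalence fun p q => q ∈ hamOrbit Ω F p where
  refl _ := Relation.ReflTransGen.refl
  trans := Relation.ReflTransGen.trans
  symm := fun {p q} h => by
    induction h with
    | refl => exact Relation.ReflTransGen.refl
    | tail _ hstep ih =>
    refine Relation.ReflTransGen.head ?_ ih
    obtain ⟨i, γ, T, hγ, h0, hT⟩ := hstep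
    refine ⟨i, fun t => γ (t + T), -T, (hγ.comp_add T).mono fun t ht => ?_, by simpa using hT,
      by simpa using h0⟩
    change t + T ∈ uIcc 0 T
    rw [mem_uIcc] at ht ⊢
    rcases ht with ht | ht
    · right; constructor <;> linarith [ht.1, ht.2]
    · left; constructor <;> linarith [ht.1, ht.2]

theorem IsInvolutiveSystem.hamVF_component_mulVec (hF : IsInvolutiveSystem Ω F)
    (B : Matrix (Fin n) (Fin n) ℝ) (i : Fin n) :
    hamVF Ω (component (fun m => B.mulVec (F m)) i) = fun m => hamFrame Ω F m (B i) :=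
  funext fun m => hamVF_dotProduct (hF.mdifferentiableAt m) (B i)

theorem IsOrbitMapOn.mem_hamOrbit_mulVec {Φ : (Fin n → ℝ) → M} {Z : Set (Fin n → ℝ)}
    (hΦ : IsOrbitMapOn (hamFrame Ω F) Φ Z) (hF : IsInvolutiveSystem Ω F) (hZ : Convex ℝ Z)
    (B : Matrix (Fin n) (Fin n) ℝ) (i : Fin n) {s : Fin n → ℝ} {T : ℝ} (hs : s ∈ Z)
    (hsT : s + T • B i ∈ Z) :
    Φ (s + T • B i) ∈ hamOrbit Ω (fun m => B.mulVec (F m)) (Φ s) := by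
  refine Relation.ReflTransGen.single ⟨i, fun t => Φ (s + t • B i), T, ?_, by simp, rfl⟩
  rw [hF.hamVF_component_mulVec]
  refine hΦ.isMIntegralCurveOn s (B i) fun t ht => ?_
  rw [← segment_eq_uIcc, segment_eq_image] at ht
  obtain ⟨θ, hθ, rfl⟩ := ht
  simpa [smul_smul] using hZ.add_smul_mem hs hsT hθ

theorem IsOrbitMapOn.eventually_mem_hamOrbit_mulVec {Φ : (Fin n → ℝ) → M} {ρ : ℝ}
    (hΦ : IsOrbitMapOn (hamFrame Ω F) Φ (Metric.ball 0 ρ)) (hF : IsInvolutiveSystem Ω F)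
    {B : Matrix (Fin n) (Fin n) ℝ} (hB : B.det ≠ 0) (hρ : 0 < ρ) :
    ∀ᶠ s in 𝓝 (0 : Fin n → ℝ), Φ s ∈ hamOrbit Ω (fun m => B.mulVec (F m)) (Φ 0) := by
  have hpartial : ∀ᶠ s in 𝓝 (0 : Fin n → ℝ), ∀ J : Finset (Fin n),
      ∑ i ∈ J, Matrix.vecMul s B⁻¹ i • B i ∈ Metric.ball (0 : Fin n → ℝ) ρ := by
    refine Filter.eventually_all.2 fun J => ?_
    have hcont : Continuous fun s : Fin n → ℝ => ∑ i ∈ J, Matrix.vecMul s B⁻¹ i • B i := by fun_prop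
    exact hcont.continuousAt.eventually_mem (Metric.isOpen_ball.mem_nhds (by simpa using hρ))
  filter_upwards [hpartial] with s hs
  have horbit : ∀ J : Finset (Fin n), Φ (∑ i ∈ J, Matrix.vecMul s B⁻¹ i • B i)
      ∈ hamOrbit Ω (fun m => B.mulVec (F m)) (Φ 0) := fun J => by
    induction J using Finset.induction_on with
    | empty => exact Relation.ReflTransGen.refl
    | insert i J hi ih =>
      have hsum := hs (insert i J)
      rw [Finset.sum_insert hi, add_comm] at hsum ⊢
      exact Relation.ReflTransGen.trans ih
        (hΦ.mem_hamOrbit_mulVec hF (convex_ball 0 ρ) B i (hs J) hsum)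
  have hcoord : ∑ i, Matrix.vecMul s B⁻¹ i • B i = s := by
    rw [← Matrix.vecMul_eq_sum, Matrix.vecMul_vecMul,
      Matrix.nonsing_inv_mul B (isUnit_iff_ne_zero.2 hB), Matrix.vecMul_one]
  exact hcoord ▸ horbit Finset.univ

variable [T2Space M] [IsManifold 𝓘(ℝ, R2 n) ω M] [NeZero n]

theorem IsOrbitMapFamily.periodicityCondition_mulVec {c : Fin n → ℝ} {p : ℝ → M}
    {Φ : ℝ → (Fin n → ℝ) → M} {B : Matrix (Fin n) (Fin n) ℝ}
    (h : IsOrbitMapFamily (hamFrame Ω F) F c ‖(2 * Real.pi) • B 0‖ (Ioc 0 1) p Φ)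
    (hF : IsInvolutiveSystem Ω F) (hB : B.det ≠ 0)
    (hperiod : Φ 1 ((2 * Real.pi) • B 0) = Φ 1 0) {m₀ : M} (hrank : rankAt F m₀ = 0)
    (hm₀ : m₀ ∈ closure (p '' Ioc 0 1)) :
    PeriodicityCondition Ω (fun m => B.mulVec (F m)) m₀ (p 1) := by
  have : IsManifold 𝓘(ℝ, R2 n) 1 M := IsManifold.of_le (n := ω) le_top
  have : Fact (0 < 2 * Real.pi) := ⟨Real.two_pi_pos⟩
  have h1 : (1 : ℝ) ∈ Ioc (0 : ℝ) 1 := right_mem_Ioc.2 one_pos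
  have hA := hF.isCommutingFamily
  have hG := hF.isFirstIntegral
  have hdim := finrank_R2_eq_add n
  have hperiod_all : ∀ u ∈ Ioc (0 : ℝ) 1, Φ u ((2 * Real.pi) • B 0) = Φ u 0 := fun u hu =>
    h.period_of_period hA hG hdim isPreconnected_Ioc h1 hperiod hu
  have hstart : ∀ u ∈ Ioc (0 : ℝ) 1, periodicLine (2 * Real.pi) (Φ u) (B 0) 0 = p u :=
    fun u hu => (periodicLine_zero _ _).trans (h.map_zero u hu)
  have hcurve : ∀ u ∈ Ioc (0 : ℝ) 1, IsMIntegralCurve (I := 𝓘(ℝ, R2 n))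
      (periodicLine (2 * Real.pi) (Φ u) (B 0))
      (hamVF Ω (component (fun m => B.mulVec (F m)) 0)) := fun u hu => by
    obtain ⟨ρ, hρ, hΦ⟩ := h.isOrbitMapOn u hu
    rw [hF.hamVF_component_mulVec]
    exact hΦ.isMIntegralCurve_periodicLine hA hρ (hperiod_all u hu)
  have horbit : ∀ u ∈ Ioc (0 : ℝ) 1, p u ∈ hamOrbit Ω (fun m => B.mulVec (F m)) (p 1) :=
    fun u hu => h.rel_of_eventually_rel hA hG hdim (norm_nonneg _) isPreconnected_Ioc
      (hamOrbit_equivalence Ω _) (fun u hu => by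
        obtain ⟨ρ, hρ, hΦ⟩ := h.isOrbitMapOn u hu
        exact hΦ.eventually_mem_hamOrbit_mulVec hF hB ((norm_nonneg _).trans_lt hρ)) h1 hu
  refine ⟨fun _ => m₀, fun u => periodicLine (2 * Real.pi) (Φ u) (B 0), ?_,
    ⟨1, one_pos, fun _ => rfl⟩, h.continuousOn_periodicLine hA hG hdim hperiod_all,
    fun u hu => ⟨hcurve u hu, periodicLine_periodic _ _, ?_⟩, ⟨0, hstart 1 h1⟩, ⟨0, rfl⟩, ?_⟩
  · refine isMIntegralCurve_const ?_
    rw [hF.hamVF_component_mulVec]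
    exact hamFrame_eq_zero_of_rankAt_eq_zero (hF.mdifferentiableAt m₀) hrank (B 0)
  · rintro _ ⟨t, rfl⟩
    exact (horbit u hu).tail ⟨0, _, t, (hcurve u hu).isMIntegralCurveOn _, hstart u hu, rfl⟩
  · rintro _ ⟨_, rfl⟩
    refine closure_mono ?_ hm₀
    rintro _ ⟨u, hu, rfl⟩
    exact mem_biUnion hu ⟨0, hstart u hu⟩

theorem IsOrbitMapFamily.exists_periodicityCondition_replaceFirst {c w : Fin n → ℝ} {p : ℝ → M}
    {Φ : ℝ → (Fin n → ℝ) → M} (h : IsOrbitMapFamily (hamFrame Ω F) F c ‖w‖ (Ioc 0 1) p Φ)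
    (hF : IsInvolutiveSystem Ω F) (hw : w 0 ≠ 0) (hperiod : Φ 1 w = Φ 1 0) {m₀ : M}
    (hrank : rankAt F m₀ = 0) (hm₀ : m₀ ∈ closure (p '' Ioc 0 1)) :
    ∃ a : Fin n → ℝ, a 0 ≠ 0 ∧ PeriodicityCondition Ω (replaceFirst F a) m₀ (p 1) := by
  have hπ : 2 * Real.pi ≠ 0 := Real.two_pi_pos.ne'
  have ha : ((2 * Real.pi)⁻¹ • w) 0 ≠ 0 := mul_ne_zero (inv_ne_zero hπ) hw
  have hrow : (2 * Real.pi) • (1 : Matrix (Fin n) (Fin n) ℝ).updateRow 0 ((2 * Real.pi)⁻¹ • w) 0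
      = w := by
    rw [Matrix.updateRow_self, smul_inv_smul₀ hπ]
  refine ⟨(2 * Real.pi)⁻¹ • w, ha, ?_⟩
  rw [replaceFirst_eq_mulVec]
  rw [← hrow] at h hperiod
  exact h.periodicityCondition_mulVec hF ((det_updateRow_one 0 _).trans_ne ha) hperiod hrank hm₀

end HamiltonianOrbits

section CompleteFlows

variable {E V W M : Type*} [NormedAddCommGroup E] [NormedSpace ℝ E] [NormedAddCommGroup V]
  [NormedSpace ℝ V] [TopologicalSpace M] [ChartedSpace E M]
  {A : (m : M) → V →L[ℝ] TangentSpace 𝓘(ℝ, E) m} {Φ : V → M} {Z : Set V} {v : V}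

theorem isOpen_setOf_exists_add_smul_mem (hZ : IsOpen Z) (v : V) :
    IsOpen {s | ∃ t : ℝ, s + t • v ∈ Z} := by
  rw [ofPred_exists]
  exact isOpen_iUnion fun t => hZ.preimage (by fun_prop)

theorem convex_setOf_exists_add_smul_mem (hZ : Convex ℝ Z) (v : V) :
    Convex ℝ {s | ∃ t : ℝ, s + t • v ∈ Z} := by
  rintro s ⟨t, hs⟩ s' ⟨t', hs'⟩ a b ha hb hab
  refine ⟨a * t + b * t', ?_⟩
  convert hZ hs hs' ha hb hab using 1
  module

namespace IsOrbitMapOn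

variable [T2Space M]

theorem exists_isOrbitMapOn_endpoints {Φ ψ : V → M} {U B : Set V} {η : V → ℝ → M} {s₀ x : V}
    {T : ℝ} (hA : IsCommutingFamily A) (hU : U ∈ 𝓝 s₀) (hΦ : IsOrbitMapOn A Φ U)
    (hBo : IsOpen B) (hB : Convex ℝ B) (hψ : IsOrbitMapOn A ψ B) (hx : x ∈ B)
    (hxT : x + T • v ∈ B) (hxs : ψ x = Φ s₀)
    (hη : ∀ s ∈ U, IsMIntegralCurveOn (I := 𝓘(ℝ, E)) (η s) (fun m => A m v) (uIcc 0 T))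
    (hη0 : ∀ s ∈ U, η s 0 = Φ s) :
    ∃ U' ∈ 𝓝 s₀, IsOrbitMapOn A (fun s => η s T) U' := by
  obtain ⟨δ, hδ, hδU⟩ := Metric.mem_nhds_iff.1 hU
  have hnear : ∀ y ∈ B, ∀ᶠ s in 𝓝 s₀, y - s₀ + s ∈ B := fun y hy =>
    (by fun_prop : ContinuousAt (fun s => y - s₀ + s) s₀).eventually_mem
      (hBo.mem_nhds (by simpa using hy))
  have heq : ∀ᶠ s in 𝓝 s₀, η s T = ψ (x + T • v - s₀ + s) := by
    filter_upwards [Metric.ball_mem_nhds s₀ hδ, hnear x hx, hnear _ hxT] with s hs hsx hsT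
    have hsU := hδU hs
    have hstart : Φ s = ψ (x - s₀ + s) :=
      eq_of_eq_translate hA (convex_ball s₀ δ) (hΦ.mono hδU) hB hψ (Metric.mem_ball_self hδ)
        (by simpa using hx) (by simpa using hxs.symm) hs hsx
    have hshift : x - s₀ + s + T • v = x + T • v - s₀ + s := by module
    rw [← hshift] at hsT ⊢
    exact hψ.eq_integralCurve hA hB (hη s hsU) ((hη0 s hsU).trans hstart) hsx hsT
  obtain ⟨U', hU', hopen, hsU'⟩ := eventually_nhds_iff.1 (heq.and (hnear _ hxT))
  refine ⟨U', hopen.mem_nhds hsU', IsOrbitMapOn.congr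
    ((hψ.comp_const_add (x + T • v - s₀)).mono fun s hs => (hU' s hs).2) fun s hs => ?_⟩
  filter_upwards [hopen.mem_nhds hs] with s' hs' using (hU' s' hs').1

variable [FiniteDimensional ℝ E] [FiniteDimensional ℝ V] {η : V → ℝ → M}

theorem isOrbitMapOn_flow (hΦ : IsOrbitMapOn A Φ Z) (hA : IsCommutingFamily A) (hZ : IsOpen Z)
    (hη : ∀ s ∈ Z, IsMIntegralCurve (I := 𝓘(ℝ, E)) (η s) (fun m => A m v))
    (hη0 : ∀ s ∈ Z, η s 0 = Φ s) (t : ℝ) : IsOrbitMapOn A (fun s => η s t) Z := by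
  intro s₀ hs₀
  let Q : ℝ → Prop := fun t => ∃ U ∈ 𝓝 s₀, IsOrbitMapOn A (fun s => η s t) U
  suffices Q 0 → Q t by
    obtain ⟨U, hU, h⟩ := this ⟨Z, hZ.mem_nhds hs₀, hΦ.congr fun s hs => by
      filter_upwards [hZ.mem_nhds hs] with s' hs' using hη0 s' hs'⟩
    exact h s₀ (mem_of_mem_nhds hU)
  refine isPreconnected_univ.induction₂' (fun t t' => Q t → Q t') (fun t₀ _ => ?_)
    (fun _ _ _ _ _ _ h h' => h' ∘ h) (mem_univ _) (mem_univ _)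
  obtain ⟨ε, hε, ψ, hψ0, hψ⟩ := hA.exists_isOrbitMapOn_ball (η s₀ t₀)
  have hstep : ∀ t₁ t₂ : ℝ, (t₁ - t₀) • v ∈ Metric.ball (0 : V) ε →
      (t₂ - t₀) • v ∈ Metric.ball (0 : V) ε → Q t₁ → Q t₂ := by
    rintro t₁ t₂ h₁ h₂ ⟨U, hU, hΦU⟩
    have hx : ψ ((t₁ - t₀) • v) = η s₀ t₁ := by
      have := hψ.eq_integralCurve hA (convex_ball 0 ε) (a := 0) (T := t₁ - t₀)
        (((hη s₀ hs₀).comp_add t₀).isMIntegralCurveOn _) (by simpa using hψ0.symm)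
        (Metric.mem_ball_self hε) (by simpa using h₁)
      simpa using this.symm
    have hx₂ : (t₁ - t₀) • v + (t₂ - t₁) • v = (t₂ - t₀) • v := by module
    have := exists_isOrbitMapOn_endpoints (η := fun s => η s ∘ (· + t₁)) hA
      (Filter.inter_mem hU (hZ.mem_nhds hs₀)) (hΦU.mono inter_subset_left) Metric.isOpen_ball
      (convex_ball 0 ε) hψ h₁ (hx₂ ▸ h₂) hx
      (fun s hs => ((hη s hs.2).comp_add t₁).isMIntegralCurveOn _) (fun s _ => by simp)
    simpa using this
  have hnear : ∀ᶠ t in 𝓝 t₀, (t - t₀) • v ∈ Metric.ball (0 : V) ε :=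
    (by fun_prop : ContinuousAt (fun t => (t - t₀) • v) t₀).eventually_mem
      (Metric.isOpen_ball.mem_nhds (by simpa using hε))
  rw [nhdsWithin_univ]
  filter_upwards [hnear] with t ht
  exact ⟨hstep t₀ t hnear.self_of_nhds ht, hstep t t₀ ht hnear.self_of_nhds⟩

theorem exists_extension_along_line (hΦ : IsOrbitMapOn A Φ Z) (hA : IsCommutingFamily A)
    (hZo : IsOpen Z) (hZ : Convex ℝ Z) (hcomplete : ∀ s ∈ Z, ∃ η : ℝ → M,
      IsMIntegralCurve (I := 𝓘(ℝ, E)) η (fun m => A m v) ∧ η 0 = Φ s) :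
    ∃ Ψ : V → M, EqOn Ψ Φ Z ∧ IsOrbitMapOn A Ψ {s | ∃ t : ℝ, s + t • v ∈ Z} := by
  rcases isEmpty_or_nonempty M with hM | hM
  · exact ⟨Φ, fun _ _ => rfl, fun s => hM.elim (Φ s)⟩
  choose! η hη hη0 using hcomplete
  have hflow := hΦ.isOrbitMapOn_flow hA hZo hη hη0
  have hshift : ∀ s t t', s + t • v ∈ Z → s + t' • v ∈ Z →
      η (s + t • v) (-t) = η (s + t' • v) (-t') := fun s t t' ht ht' => by
    have heq : s + t • v + (t' - t) • v = s + t' • v := by module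
    have := (hflow (-t')).eq_integralCurve hA hZ (a := s + t • v) (v := v) (T := t' - t)
      (((hη _ ht).comp_add (-t')).isMIntegralCurveOn _) (by simp) ht (heq ▸ ht')
    simpa [heq, show t' - t + -t' = -t by ring] using this
  choose! τ hτ using fun s (hs : ∃ t : ℝ, s + t • v ∈ Z) => hs
  have hΨ : ∀ s t, s + t • v ∈ Z → η (s + τ s • v) (-τ s) = η (s + t • v) (-t) := fun s t ht =>
    hshift s _ t (hτ s ⟨t, ht⟩) ht
  refine ⟨fun s => η (s + τ s • v) (-τ s), fun s hs => ?_, fun s₀ ⟨t, ht⟩ => ?_⟩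
  · simpa [hη0 s hs] using hΨ s 0 (by simpa using hs)
  · have hloc : IsOrbitMapOn A (fun s => η (s + τ s • v) (-τ s)) ((t • v + ·) ⁻¹' Z) :=
      ((hflow (-t)).comp_const_add (t • v)).congr fun s hs => by
        filter_upwards [(hZo.preimage (continuous_const_add (t • v))).mem_nhds hs] with s' hs'
        rw [mem_preimage, add_comm] at hs'
        simpa only [add_comm (t • v)] using hΨ s' t hs'
    exact hloc s₀ (by rwa [mem_preimage, add_comm])

end IsOrbitMapOn

theorem IsCommutingFamily.exists_isOrbitMapOn_univ [T2Space M] [FiniteDimensional ℝ E]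
    [FiniteDimensional ℝ V] [NormedAddCommGroup W] [NormedSpace ℝ W] {G : M → W} {c : W}
    {ι : Type*} (hA : IsCommutingFamily A) (hG : IsFirstIntegral A G) (b : Module.Basis ι ℝ V)
    (hcomplete : ∀ i, ∀ q ∈ G ⁻¹' {c}, ∃ η : ℝ → M,
      IsMIntegralCurve (I := 𝓘(ℝ, E)) η (fun m => A m (b i)) ∧ η 0 = q)
    {p : M} (hp : G p = c) : ∃ Φ : V → M, Φ 0 = p ∧ IsOrbitMapOn A Φ univ := by
  classical
  have hpartial : ∀ J : Finset ι, ∃ (Z : Set V) (Φ : V → M), IsOpen Z ∧ Convex ℝ Z ∧ Φ 0 = p ∧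
      IsOrbitMapOn A Φ Z ∧ ∀ x : ι → ℝ, ∑ i ∈ J, x i • b i ∈ Z := fun J => by
    induction J using Finset.induction_on with
    | empty =>
      obtain ⟨ε, hε, Φ, h0, hΦ⟩ := hA.exists_isOrbitMapOn_ball p
      exact ⟨_, Φ, Metric.isOpen_ball, convex_ball 0 ε, h0, hΦ, fun _ => Metric.mem_ball_self hε⟩
    | insert k J hk ih =>
      obtain ⟨Z, Φ, hZo, hZ, h0, hΦ, hJ⟩ := ih
      have hZ0 : (0 : V) ∈ Z := by simpa using hJ 0
      obtain ⟨Ψ, hΨ, hΨorbit⟩ := hΦ.exists_extension_along_line hA hZo hZ fun s hs =>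
        hcomplete k (Φ s) ((hΦ.firstIntegral_eq hG hZ hs hZ0).trans (by rw [h0, hp]))
      refine ⟨_, Ψ, isOpen_setOf_exists_add_smul_mem hZo (b k),
        convex_setOf_exists_add_smul_mem hZ (b k), (hΨ hZ0).trans h0, hΨorbit,
        fun x => ⟨-x k, ?_⟩⟩
      rw [Finset.sum_insert hk, neg_smul, add_neg_cancel_comm]
      exact hJ x
  have : Fintype ι := FiniteDimensional.fintypeBasisIndex b
  obtain ⟨Z, Φ, -, -, h0, hΦ, hZ⟩ := hpartial Finset.univ
  exact ⟨Φ, h0, hΦ.mono fun s _ => b.sum_repr s ▸ hZ (b.repr s)⟩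

namespace IsOrbitMapOn

variable [T2Space M]

theorem map_add_eq_of_apply_eq_zero (hΦ : IsOrbitMapOn A Φ univ) (hA : IsCommutingFamily A)
    {s : V} (hv : A (Φ s) v = 0) (x : V) : Φ (x + v) = Φ x := by
  have hfixed : Φ (s + v) = Φ s := by
    have := hΦ.eq_integralCurve hA convex_univ (η := fun _ => Φ s) (a := s) (T := 1)
      ((isMIntegralCurve_const (v := fun m => A m v) hv).isMIntegralCurveOn _) rfl
      (mem_univ _) (mem_univ _)
    simpa using this.symm
  rw [add_comm]
  exact (eq_of_eq_translate hA convex_univ hΦ convex_univ hΦ (mem_univ s) (mem_univ _)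
    (by rw [add_comm, hfixed]) (mem_univ x) (mem_univ _)).symm

theorem injective_of_injective (hΦ : IsOrbitMapOn A Φ univ) (hA : IsCommutingFamily A) {s₀ : V}
    (h₀ : Function.Injective (A (Φ s₀))) (s : V) : Function.Injective (A (Φ s)) := by
  refine (injective_iff_map_eq_zero _).2 fun v hv => ?_
  have hconst : ∀ t : ℝ, Φ (s₀ + t • v) = Φ s₀ := fun t =>
    hΦ.map_add_eq_of_apply_eq_zero hA (by rw [map_smul, hv, smul_zero]) s₀
  have hcurve := (hΦ.isMIntegralCurveOn s₀ v (S := univ) (fun _ _ => mem_univ _) 0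
    (mem_univ 0)).hasMFDerivAt Filter.univ_mem
  have hzero : HasMFDerivAt 𝓘(ℝ, ℝ) 𝓘(ℝ, E) (fun t : ℝ => Φ (s₀ + t • v)) 0
      (0 : ℝ →L[ℝ] E) := by
    rw [funext hconst]
    exact hasMFDerivAt_const _ _
  have hvel := congrArg (fun L : ℝ →L[ℝ] E => L 1) (hasMFDerivAt_unique hcurve hzero)
  have hvel' : (1 : ℝ) • (A (Φ (s₀ + (0 : ℝ) • v)) v : E) = 0 := hvel
  rw [one_smul, hconst] at hvel'
  exact h₀ (hvel'.trans (map_zero (A (Φ s₀))).symm)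

end IsOrbitMapOn

theorem exists_continuousOn_Ioc_dense {X : Type*} [TopologicalSpace X]
    [TopologicalSpace.SeparableSpace X] [TietzeExtension.{0} X] (x : X) :
    ∃ c : ℝ → X, ContinuousOn c (Ioc 0 1) ∧ c 1 = x ∧ Dense (c '' Ioc 0 1) := by
  have : Nonempty X := ⟨x⟩
  let f : C(ℕ, X) := ⟨fun k => Nat.casesOn k x (TopologicalSpace.denseSeq X),
    continuous_of_discreteTopology⟩
  obtain ⟨g, hg⟩ := f.exists_extension' Nat.isClosedEmbedding_coe_real
  have hgk : ∀ k : ℕ, g k = f k := fun k => congrFun hg k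
  refine ⟨fun u => g (u⁻¹ - 1), ?_, ?_, ?_⟩
  · exact g.continuous.comp_continuousOn
      ((continuousOn_inv₀.mono fun u hu => hu.1.ne').sub continuousOn_const)
  · simpa [f] using hgk 0
  · refine (TopologicalSpace.denseRange_denseSeq X).mono ?_
    rintro _ ⟨k, rfl⟩
    refine ⟨((k + 2 : ℕ) : ℝ)⁻¹, ⟨by positivity, inv_le_one_of_one_le₀ ?_⟩, ?_⟩
    · exact_mod_cast Nat.le_add_left 1 (k + 1)
    · have hk : (((k + 2 : ℕ) : ℝ)⁻¹)⁻¹ - 1 = ((k + 1 : ℕ) : ℝ) := by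
        rw [inv_inv]
        push_cast
        ring
      simp only [hk]; exact hgk (k + 1)

end CompleteFlows

section CompleteHamiltonianFlows

variable {n : ℕ} {M : Type*} [TopologicalSpace M] [ChartedSpace (R2 n) M]
  {Ω : SymplecticForm n M} {F : M → Fin n → ℝ}

theorem hamVF_component_eq_hamFrame (Ω : SymplecticForm n M) (F : M → Fin n → ℝ) (i : Fin n) :
    hamVF Ω (component F i) = fun m => hamFrame Ω F m (Pi.single i 1) :=
  funext fun m => (hamFrame_single m i).symm

variable [T2Space M] [IsManifold 𝓘(ℝ, R2 n) ω M]

theorem IsOrbitMapOn.hamOrbit_subset_range {Φ : (Fin n → ℝ) → M}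
    (hΦ : IsOrbitMapOn (hamFrame Ω F) Φ univ) (hF : IsInvolutiveSystem Ω F) :
    hamOrbit Ω F (Φ 0) ⊆ range Φ := by
  intro q hq
  induction hq with
  | refl => exact mem_range_self 0
  | tail _ hstep ih =>
    obtain ⟨s, rfl⟩ := ih
    obtain ⟨i, η, T, hη, h0, rfl⟩ := hstep
    rw [hamVF_component_eq_hamFrame] at hη
    exact ⟨_, (hΦ.eq_integralCurve hF.isCommutingFamily convex_univ hη h0 (mem_univ _)
      (mem_univ _)).symm⟩

theorem FlowsCompleteInZeroFibre.exists_isOrbitMapFamily (hcomp : FlowsCompleteInZeroFibre Ω F)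
    (hF : IsInvolutiveSystem Ω F) {m₀ m₁ : M} (hm₁ : m₁ ∈ regFibre F)
    (hm₀ : m₀ ∈ closure (hamOrbit Ω F m₁)) (ℓ : ℝ) :
    ∃ p Φ, IsOrbitMapFamily (hamFrame Ω F) F 0 ℓ (Ioc (0 : ℝ) 1) p Φ ∧ p 1 = m₁ ∧
      m₀ ∈ closure (p '' Ioc 0 1) := by
  have hA := hF.isCommutingFamily
  obtain ⟨Φ, rfl, hΦ⟩ := hA.exists_isOrbitMapOn_univ hF.isFirstIntegral (Pi.basisFun ℝ (Fin n))
    (fun i q hq => by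
      simpa [hamVF_component_eq_hamFrame] using hcomp i q hq) hm₁.1
  have hΦc : Continuous Φ := continuousOn_univ.1 hΦ.continuousOn
  obtain ⟨σ, hσ, hσ1, hσd⟩ := exists_continuousOn_Ioc_dense (0 : Fin n → ℝ)
  have hreg : ∀ s, Φ s ∈ regularLevel (hamFrame Ω F) F 0 := fun s => by
    have hinj := hΦ.injective_of_injective hA
      ((hamFrame_injective_iff (hF.mdifferentiableAt _)).2 (notMem_singSet_iff.1 hm₁.2)) s
    exact ⟨(hΦ.firstIntegral_eq hF.isFirstIntegral convex_univ (mem_univ s) (mem_univ 0)).trans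
      hm₁.1, hinj, (hamFrame_injective_iff (hF.mdifferentiableAt _)).1 hinj⟩
  refine ⟨Φ ∘ σ, fun u s => Φ (σ u + s), ⟨hΦc.comp_continuousOn hσ, fun u _ => hreg (σ u),
    fun u _ => by simp, fun u _ => ⟨ℓ + 1, lt_add_one ℓ,
      (hΦ.comp_const_add (σ u)).mono fun _ _ => mem_univ _⟩⟩, congrArg Φ hσ1, ?_⟩
  have hrange : range Φ ⊆ closure (Φ ∘ σ '' Ioc 0 1) := by
    rw [image_comp, ← image_univ, ← hσd.closure_eq]
    exact image_closure_subset_closure_image hΦc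
  exact closure_minimal ((hΦ.hamOrbit_subset_range hF).trans hrange) isClosed_closure hm₀

end CompleteHamiltonianFlows

section CanonicalCharts

theorem sum_eq_sum_even_add_odd {N : Type*} [AddCommMonoid N] {n : ℕ} (g : Fin (2 * n) → N) :
    ∑ k, g k = ∑ i : Fin n, (g ⟨2 * i, by omega⟩ + g ⟨2 * i + 1, by omega⟩) := by
  rw [← (finProdFinEquiv.trans (finCongr (mul_comm n 2))).sum_comp, Fintype.sum_prod_type]
  refine Finset.sum_congr rfl fun i _ => ?_
  rw [Fin.sum_univ_two]
  congr 2
  · ext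
    simp
  · ext
    simp [add_comm]

variable {n : ℕ} {M : Type*} [TopologicalSpace M] [ChartedSpace (R2 n) M]
  {Ω : SymplecticForm n M} {F : M → Fin n → ℝ}

theorem exists_norm_eq_stdSymplectic_eq_sq (X : R2 n) :
    ∃ w : R2 n, ‖w‖ = ‖X‖ ∧ stdSymplectic w X = ‖X‖ ^ 2 := by
  let w : R2 n := WithLp.toLp 2 fun k => if (k : ℕ) % 2 = 0 then
    X ⟨2 * (k / 2) + 1, by omega⟩ else -X ⟨2 * (k / 2), by omega⟩
  have hw_even : ∀ i : Fin n, w ⟨2 * i, by omega⟩ = X ⟨2 * i + 1, by omega⟩ := fun i => by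
    simp [w]
  have hw_odd : ∀ i : Fin n, w ⟨2 * i + 1, by omega⟩ = -X ⟨2 * i, by omega⟩ := fun i => by
    simp [w, Nat.add_mod, Nat.mul_add_div]
  have hX : ‖X‖ ^ 2 = ∑ i : Fin n, (X ⟨2 * i, by omega⟩ ^ 2 + X ⟨2 * i + 1, by omega⟩ ^ 2) := by
    rw [EuclideanSpace.real_norm_sq_eq, sum_eq_sum_even_add_odd]
  refine ⟨w, ?_, ?_⟩
  · rw [← sq_eq_sq₀ (norm_nonneg _) (norm_nonneg _), hX, EuclideanSpace.real_norm_sq_eq,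
      sum_eq_sum_even_add_odd]
    exact Finset.sum_congr rfl fun i _ => by rw [hw_even, hw_odd]; ring
  · rw [hX, stdSymplectic]
    exact Finset.sum_congr rfl fun i _ => by rw [hw_even, hw_odd]; ring

theorem norm_le_of_stdSymplectic_eq {X : R2 n} {D : R2 n →L[ℝ] ℝ}
    (h : ∀ w, stdSymplectic w X = D w) : ‖X‖ ≤ ‖D‖ := by
  obtain ⟨w, hw, hwX⟩ := exists_norm_eq_stdSymplectic_eq_sq X
  rcases (norm_nonneg X).eq_or_lt with hX | hX
  · exact hX ▸ norm_nonneg D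
  · refine le_of_mul_le_mul_right ?_ hX
    calc ‖X‖ * ‖X‖ = D w := by rw [← h, hwX, sq]
      _ ≤ ‖D w‖ := Real.le_norm_self _
      _ ≤ ‖D‖ * ‖X‖ := hw ▸ D.le_opNorm w

theorem norm_fderiv_dotProduct_le {E : Type*} [NormedAddCommGroup E] [NormedSpace ℝ E]
    {G : E → Fin n → ℝ} {x : E} {C : ℝ} (hG : DifferentiableAt ℝ G x)
    (hC : ∀ i, ‖fderiv ℝ (fun y => G y i) x‖ ≤ C) (v : Fin n → ℝ) :
    ‖fderiv ℝ (fun y => v ⬝ᵥ G y) x‖ ≤ n * C * ‖v‖ := by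
  have hsum : fderiv ℝ (fun y => v ⬝ᵥ G y) x = ∑ i, v i • fderiv ℝ (fun y => G y i) x :=
    (HasFDerivAt.fun_sum fun i _ =>
      ((differentiableAt_pi.1 hG i).hasFDerivAt.const_mul (v i))).fderiv
  calc ‖fderiv ℝ (fun y => v ⬝ᵥ G y) x‖
      ≤ ∑ _i : Fin n, ‖v‖ * C := hsum ▸ norm_sum_le_of_le _ fun i _ => by
        rw [norm_smul]
        exact mul_le_mul (norm_le_pi_norm v i) (hC i) (norm_nonneg _) (norm_nonneg _)
    _ = n * C * ‖v‖ := by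
      rw [Finset.sum_const, Finset.card_univ, Fintype.card_fin, nsmul_eq_mul]
      ring

namespace IsCanonicalChart

variable {m₀ : M} {r c : ℝ} {φ : OpenPartialHomeomorph M (R2 n)}

theorem pullbackForm_eq (hφ : IsCanonicalChart Ω m₀ r φ) {x : R2 n} (hx : x ∈ φ.target)
    (v : Fin 2 → R2 n) : pullbackForm Ω.form φ.symm x v = stdSymplectic (v 0) (v 1) := by
  have hd := mdifferentiable_of_mem_maximalAtlas
    (IsManifold.maximalAtlas_subset_of_le (n := ∞) (by simp) hφ.smooth)
  have hcancel : ∀ w : R2 n, mfderiv 𝓘(ℝ, R2 n) 𝓘(ℝ, R2 n) φ (φ.symm x)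
      (mfderiv 𝓘(ℝ, R2 n) 𝓘(ℝ, R2 n) φ.symm x w) = w := fun w =>
    congrArg (fun L : R2 n →L[ℝ] R2 n => L w) (hd.comp_symm_deriv hx)
  have h := hφ.canonical (φ.symm x) (φ.map_target hx)
    (mfderiv 𝓘(ℝ, R2 n) 𝓘(ℝ, R2 n) φ.symm x (v 0))
    (mfderiv 𝓘(ℝ, R2 n) 𝓘(ℝ, R2 n) φ.symm x (v 1))
  rw [hcancel, hcancel, ← pullbackForm_apply] at h
  rw [← h]
  congr 1
  ext i : 1
  fin_cases i <;> rfl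

theorem isSymplecticChart (hφ : IsCanonicalChart Ω m₀ r φ) : IsSymplecticChart Ω φ := by
  have hconst : ∀ x ∈ φ.target, ∀ y ∈ φ.target,
      pullbackForm Ω.form φ.symm x = pullbackForm Ω.form φ.symm y := by
    intro x hx y hy
    ext v
    rw [hφ.pullbackForm_eq hx, hφ.pullbackForm_eq hy]
  refine ⟨hφ.smooth, fun x hx => ?_, fun x hx => ?_⟩
  · exact contDiffWithinAt_const.congr (fun y hy => hconst y hy x hx) rfl
  · have h : pullbackForm Ω.form φ.symm =ᶠ[𝓝 x] fun _ => pullbackForm Ω.form φ.symm x := by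
      filter_upwards [φ.open_target.mem_nhds hx] with y hy using hconst y hy x hx
    rw [h.extDeriv.eq_of_nhds, extDeriv, fderiv_fun_const]
    exact map_zero (ContinuousAlternatingMap.alternatizeUncurryFinCLM ℝ (R2 n) ℝ)

theorem norm_chartRep_hamFrame_le (hφ : IsCanonicalChart Ω m₀ r φ) (hF : IsInvolutiveSystem Ω F)
    (hc : 0 ≤ c) {x : R2 n} (hx : x ∈ φ.target)
    (hbd : ∀ i, ‖fderiv ℝ (fun y => component F i (φ.symm y)) x‖ ≤ c * ‖x‖) :
    ‖chartRep (hamFrame Ω F) φ x‖ ≤ n * c * ‖x‖ := by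
  have he := hφ.isSymplecticChart
  have hsymm := (mdifferentiable_of_mem_maximalAtlas he.mem_one).mdifferentiableAt_symm hx
  have hG : DifferentiableAt ℝ (fun y => F (φ.symm y)) x :=
    ((hF.mdifferentiableAt (φ.symm x)).comp x hsymm).differentiableAt
  refine ContinuousLinearMap.opNorm_le_bound _ (by positivity) fun v => ?_
  rw [mul_assoc (n : ℝ)]
  refine (norm_le_of_stdSymplectic_eq fun w => ?_).trans (norm_fderiv_dotProduct_le hG hbd v)
  rw [← he.pullbackForm_chartRep_hamFrame hF hx, hφ.pullbackForm_eq hx]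
  rfl

theorem exists_isOrbitMapOn (hφ : IsCanonicalChart Ω m₀ r φ) (hF : IsInvolutiveSystem Ω F)
    (hc : 0 ≤ c) (hbd : ∀ x ∈ Metric.ball (0 : R2 n) r, ∀ i : Fin n,
      ‖fderiv ℝ (fun y => component F i (φ.symm y)) x‖ ≤ c * ‖x‖)
    {q : M} (hq : q ∈ φ.source) {ρ : ℝ} (hρ : 0 < ρ) (hqρ : ‖φ q‖ * Real.exp (n * c * ρ) < r) :
    ∃ Φ, Φ 0 = q ∧ IsOrbitMapOn (hamFrame Ω F) Φ (Metric.ball 0 ρ) := by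
  have he := hφ.isSymplecticChart.isCommutingInChart_hamFrame hF
  have ht : ∀ x ∈ Metric.ball (0 : R2 n) r, x ∈ φ.target := fun x hx => hφ.target_eq ▸ hx
  obtain ⟨Ψ, hΨ0, hΨ⟩ := exists_timeOne_of_commuting (A := chartRep (hamFrame Ω F) φ) (c := 0)
    (x₀ := φ q) (R := r) (α := 0) (κ := n * c) (by positivity) le_rfl (he.contDiffOn.mono ht)
    (fun x hx => he.commute x (ht x hx))
    (fun x hx => by simpa using hφ.norm_chartRep_hamFrame_le hF hc (ht x hx) (hbd x hx)) hρ
    (by simpa using hqρ)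
  exact ⟨fun s => φ.symm (Ψ s), by simp [hΨ0, φ.left_inv hq], fun s hs =>
    hasMFDerivAt_symm_comp_of_chartRep he.mem (ht _ (hΨ s hs).1) (hΨ s hs).2⟩

theorem exists_isOrbitMapFamily {X : Type*} [TopologicalSpace X]
    (hφ : IsCanonicalChart Ω m₀ r φ) (hF : IsInvolutiveSystem Ω F)
    (hc : 0 ≤ c) (hbd : ∀ x ∈ Metric.ball (0 : R2 n) r, ∀ i : Fin n,
      ‖fderiv ℝ (fun y => component F i (φ.symm y)) x‖ ≤ c * ‖x‖)
    {ℓ : ℝ} (hℓ : 0 ≤ ℓ) {I : Set X} {p : X → M} (hp : ContinuousOn p I)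
    (hpφ : ∀ u ∈ I, p u ∈ regFibre F ∧ p u ∈ φ.source ∧
      φ (p u) ∈ Metric.ball (0 : R2 n) (r * Real.exp (-(n * c * ℓ)))) :
    ∃ Φ, IsOrbitMapFamily (hamFrame Ω F) F 0 ℓ I p Φ := by
  have hex : ∀ u ∈ I, ∃ Φ, Φ 0 = p u ∧
      ∃ ρ > ℓ, IsOrbitMapOn (hamFrame Ω F) Φ (Metric.ball 0 ρ) := by
    intro u hu
    obtain ⟨-, hsrc, hball⟩ := hpφ u hu
    have hlt : ‖φ (p u)‖ * Real.exp (n * c * ℓ) < r := by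
      rwa [mem_ball_zero_iff, Real.exp_neg, ← div_eq_mul_inv,
        lt_div_iff₀ (Real.exp_pos _)] at hball
    have hcont : ContinuousAt (fun ρ => ‖φ (p u)‖ * Real.exp (n * c * ρ)) ℓ := by fun_prop
    obtain ⟨ρ, hρ, hρℓ⟩ := (((hcont.eventually_lt_const hlt).filter_mono
      nhdsWithin_le_nhds).and (self_mem_nhdsWithin : Ioi ℓ ∈ 𝓝[>] ℓ)).exists
    obtain ⟨Φ, hΦ0, hΦ⟩ := hφ.exists_isOrbitMapOn hF hc hbd hsrc (hℓ.trans_lt hρℓ) hρ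
    exact ⟨Φ, hΦ0, ρ, hρℓ, hΦ⟩
  have : Nonempty M := ⟨m₀⟩
  choose! Φ hΦ0 hΦ using hex
  exact ⟨Φ, hp, fun u hu => hF.regFibre_eq ▸ (hpφ u hu).1, hΦ0, hΦ⟩

end IsCanonicalChart

end CanonicalCharts

theorem mainTheorem8_general {n : ℕ} [NeZero n] {M : Type*} [TopologicalSpace M] [T2Space M]
    [ChartedSpace (R2 n) M] [IsManifold 𝓘(ℝ, R2 n) ω M]
    (Ω : SymplecticForm n M) (F : M → Fin n → ℝ) (hF : IsInvolutiveSystem Ω F)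
    (m₀ : M) (hrank : rankAt F m₀ = 0)
    (γ : ℝ → M) (hγ : IsPiecewiseC1Loop (n := n) γ)
    (hγreg : ∀ t ∈ Icc (0 : ℝ) 1, γ t ∈ regFibre F)
    (ha : loopIntegral Ω F 0 γ ≠ 0)
    (m₁ : M) (hm₁ : m₁ ∈ γ '' Icc 0 1)
    (hb : (FlowsCompleteInZeroFibre Ω F ∧ m₀ ∈ closure (hamOrbit Ω F m₁)) ∨
      ∃ (r : ℝ) (φ : OpenPartialHomeomorph M (R2 n)) (c : ℝ) (p : ℝ → M),
        IsCanonicalChart Ω m₀ r φ ∧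
        0 < c ∧
        (∀ x ∈ Metric.ball (0 : R2 n) r, ∀ i : Fin n,
          ‖fderiv ℝ (fun y => component F i (φ.symm y)) x‖ ≤ c * ‖x‖) ∧
        ContinuousOn p (Ioc 0 1) ∧
        (∀ u ∈ Ioc (0 : ℝ) 1, p u ∈ regFibre F ∧ p u ∈ φ.source ∧
          φ (p u) ∈ Metric.ball (0 : R2 n) (r * Real.exp (-(n * c * loopLength Ω F γ)))) ∧
        p 1 = m₁ ∧
        m₀ ∈ closure (p '' Ioc 0 1)) :
    ∃ a : Fin n → ℝ, a 0 ≠ 0 ∧ PeriodicityCondition Ω (replaceFirst F a) m₀ m₁ := by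
  obtain ⟨t₁, ht₁, rfl⟩ := hm₁
  have hℓ := hγ.norm_loopIntegral_le_loopLength hF hγreg
  obtain ⟨p, Φ, h, hp1, hm₀⟩ : ∃ p Φ,
      IsOrbitMapFamily (hamFrame Ω F) F 0 (loopLength Ω F γ) (Ioc (0 : ℝ) 1) p Φ ∧
        p 1 = γ t₁ ∧ m₀ ∈ closure (p '' Ioc 0 1) := by
    rcases hb with ⟨hcomp, hm₀⟩ | ⟨r, φ, c, p, hφ, hc, hbd, hp, hpφ, hp1, hm₀⟩
    · exact hcomp.exists_isOrbitMapFamily hF (hγreg t₁ ht₁) hm₀ _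
    · obtain ⟨Φ, h⟩ := hφ.exists_isOrbitMapFamily hF hc.le hbd ((norm_nonneg _).trans hℓ) hp hpφ
      exact ⟨p, Φ, h, hp1, hm₀⟩
  have h1 : (1 : ℝ) ∈ Ioc (0 : ℝ) 1 := right_mem_Ioc.2 zero_lt_one
  obtain ⟨ρ, hρ, hΦ⟩ := h.isOrbitMapOn 1 h1
  have hperiod := hγ.orbitMap_loopIntegral hF hγreg hΦ hρ ht₁ ((h.map_zero 1 h1).trans hp1)
  rw [← hp1]
  exact (h.mono hℓ).exists_periodicityCondition_replaceFirst hF ha hperiod hrank hm₀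

theorem mainTheorem8 {n : ℕ} [NeZero n] {M : Type*} [TopologicalSpace M] [T2Space M]
    [SecondCountableTopology M] [ChartedSpace (R2 n) M] [IsManifold 𝓘(ℝ, R2 n) ω M]
    (Ω : SymplecticForm n M) (F : M → Fin n → ℝ) (hF : IsIntegrableSystem Ω F)
    (m₀ : M) (hm₀ : F m₀ = 0) (hrank : rankAt F m₀ = 0)
    (γ : ℝ → M) (hγ : IsPiecewiseC1Loop (n := n) γ)
    (hγreg : ∀ t ∈ Icc (0 : ℝ) 1, γ t ∈ regFibre F)
    (ha : loopIntegral Ω F 0 γ ≠ 0)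
    (m₁ : M) (hm₁ : m₁ ∈ γ '' Icc 0 1)
    (hb : (FlowsCompleteInZeroFibre Ω F ∧ m₀ ∈ closure (hamOrbit Ω F m₁)) ∨
      ∃ (r : ℝ) (φ : OpenPartialHomeomorph M (R2 n)) (c : ℝ) (p : ℝ → M),
        IsCanonicalChart Ω m₀ r φ ∧
        0 < c ∧
        (∀ x ∈ Metric.ball (0 : R2 n) r, ∀ i : Fin n,
          ‖fderiv ℝ (fun y => component F i (φ.symm y)) x‖ ≤ c * ‖x‖) ∧
        ContinuousOn p (Ioc 0 1) ∧
        (∀ u ∈ Ioc (0 : ℝ) 1, p u ∈ regFibre F ∧ p u ∈ φ.source ∧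
          φ (p u) ∈ Metric.ball (0 : R2 n) (r * Real.exp (-(n * c * loopLength Ω F γ)))) ∧
        p 1 = m₁ ∧
        m₀ ∈ closure (p '' Ioc 0 1)) :
    ∃ a : Fin n → ℝ, a 0 ≠ 0 ∧ PeriodicityCondition Ω (replaceFirst F a) m₀ m₁ :=
  mainTheorem8_general Ω F hF.isInvolutiveSystem m₀ hrank γ hγ hγreg ha m₁ hm₁ hb
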